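/- **Setting.** Let $\Omega\subset\mathbb R^N$ be nonempty, open and bounded with Lipschitz boundary, let $m\ge 2$, $I=\{1,\dots,m\}$, and let $(\Omega_i)_{i\in I}$ be pairwise disjoint open subsets of $\Omega$ with Lipschitz boundaries such that $\overline\Omega=\bigcup_{i\in I}\overline{\Omega_i}$. Set $\Upsilon_{ii}=\operatorname{int}_{\operatorname{bdry}\Omega}(\operatorname{bdry}\Omega_i\cap\operatorname{bdry}\Omega)$ and, for $i<j$, $\Upsilon_{ij}=\Upsilon_{ji}=\operatorname{int}_{\operatorname{bdry}\Omega_i}(\operatorname{bdry}\Omega_i\cap\operatorname{bdry}\Omega_j)$ (relative interiors). Assume that, for every $i\in I$, $\Upsilon_{ii}\ne\varnothing$, that the closure of every connected component of $\Omega_i$ meets $\Upsilon_{ii}$ (this is automatic if $\Omega_i$ is connected), and that $J(i)=\{j\in I\smallsetminus\{i\}\mid \Upsilon_{ij}\neq\varnothing\}$ is nonempty. Put $J(i+)=\{j\in J(i)\mid j>i\}$, $J(i-)=\{j\in J(i)\mid j<i\}$ and $K=\{(i,j)\in I^2\mid i<j,\ \Upsilon_{ij}\ne\varnothing\}$. Let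 $S$ be the surface measure, let $\mathsf T_i\colon H^1(\Omega_i)\to L^2(\operatorname{bdry}\Omega_i)$ be the trace operator, i.e. the bounded linear operator with $\mathsf T_iv=v|_{\operatorname{bdry}\Omega_i}$ for all $v\in C^1(\overline{\Omega_i})$, let $\mathcal H_i=\{u\in H^1(\Omega_i)\mid \mathsf T_iu=0\text{ on }\Upsilon_{ii}\}$ with scalar product $\langle u,v\rangle=\int_{\Omega_i}(Du)^\top Dv$, and, for $j\in J(i)$, let $\mathsf T_{ij}\colon\mathcal H_i\to L^2(\Upsilon_{ij})$, $u\mapsto(\mathsf T_iu)|_{\Upsilon_{ij}}$. For $f\in L^2(\Omega_i)$ and $h_j\in L^2(\Upsilon_{ij})$ ($j\in J(i)$), let $Q_i(f,(h_j)_{j\in J(i)})$ be the weak solution $u\in\mathcal H_i$ of $-\Delta u=f$ on $\Omega_i$, $u=0$ on $\Upsilon_{ii}$, $\nu_i^\top Du=h_j$ on $\Upsilon_{ij}$ for $j\in J(i+)$ and $\nu_i^\top Du=-h_j$ on $\Upsilon_{ij}$ for $j\in J(i-)$, that is, $$(\forall v\in\mathcal H_i)\quad \int_{\Omega_i}(Du)^\top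 Dv=\int_{\Omega_i}fv+\sum_{j\in J(i+)}\int_{\Upsilon_{ij}}h_j\,\mathsf T_{ij}v\,dS-\sum_{j\in J(i-)}\int_{\Upsilon_{ij}}h_j\,\mathsf T_{ij}v\,dS .$$ For a Hilbert space $H$, $\Gamma_0(H)$ is the class of lower semicontinuous convex functions $H\to\,]-\infty,+\infty]$ that are not identically $+\infty$, $\partial\varphi$ is the subdifferential of $\varphi\in\Gamma_0(H)$ and $\operatorname{prox}_\varphi u$ is the minimizer of $v\mapsto\varphi(v)+\frac12\|u-v\|^2$. Let $\varphi_i\in\Gamma_0(\mathcal H_i)$ for every $i\in I$ and $\psi_{ij}\in\Gamma_0(L^2(\Upsilon_{ij}))$ for every $(i,j)\in K$. Write $Q_i[g]=Q_i\big(0,(g_{ij})_{j\in J(i+)},(g_{ji})_{j\in J(i-)}\big)$, and let $Z$ be the set of all $(u,g)\in\bigoplus_{i\in I}\mathcal H_i\oplus\bigoplus_{(i,j)\in K}L^2(\Upsilon_{ij})$ such that $$(\forall (i,j)\in K)\ \ g_{ij}\in\partial\psi_{ij}(\mathsf T_{ij}u_i-\mathsf T_{ji}u_j)\quad\text{and}\quad(\forall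 i\in I)\ \ -Q_i[g]\in\partial\varphi_i(u_i).$$ Assume that $Z\neq\varnothing$. **Algorithm.** Let $x_0=(u_0,g_0)$ be any point of this direct sum, let $\varepsilon\in\,]0,1[$, let $(\gamma_n)_{n\in\mathbb N}$ and $(\mu_n)_{n\in\mathbb N}$ be sequences in $[\varepsilon,1/\varepsilon]$ and $(\lambda_n)_{n\in\mathbb N}$ a sequence in $[\varepsilon,1]$. For $n=0,1,\dots$, given $x_n=((u_{i,n})_{i\in I},(g_{ij,n})_{(i,j)\in K})$, compute, for all $i\in I$ and all $(i,j)\in K$ respectively, $$p_{i,n}=\operatorname{prox}_{\gamma_n\varphi_i}(u_{i,n}-\gamma_nQ_i[g_n]),\qquad l_{ij,n}=\mathsf T_{ij}u_{i,n}-\mathsf T_{ji}u_{j,n},\qquad q_{ij,n}=\operatorname{prox}_{\mu_n\psi_{ij}}(l_{ij,n}+\mu_ng_{ij,n}),$$ $$t_{ij,n}=q_{ij,n}-\mathsf T_{ij}p_{i,n}+\mathsf T_{ji}p_{j,n},\qquad s_{i,n}=\gamma_n^{-1}(u_{i,n}-p_{i,n})+\mu_n^{-1}Q_i[l_n-q_n],\qquad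 \tau_n=\sum_{i\in I}\|s_{i,n}\|^2+\sum_{(i,j)\in K}\|t_{ij,n}\|^2,$$ $\theta_n=0$ if $\tau_n=0$, and $$\theta_n=\frac{\lambda_n}{\tau_n}\Big(\gamma_n^{-1}\sum_{i\in I}\|u_{i,n}-p_{i,n}\|^2+\mu_n^{-1}\sum_{(i,j)\in K}\|l_{ij,n}-q_{ij,n}\|^2\Big)\quad\text{if }\tau_n>0,$$ then $x_{n+1/2}=\big((u_{i,n}-\theta_ns_{i,n})_{i\in I},(g_{ij,n}-\theta_nt_{ij,n})_{(i,j)\in K}\big)$ and, with the scalar product and norm of the direct sum, $\chi_n=\langle x_0-x_n,x_n-x_{n+1/2}\rangle$, $\kappa_n=\|x_0-x_n\|^2$, $\nu_n=\|x_n-x_{n+1/2}\|^2$, $\rho_n=\kappa_n\nu_n-\chi_n^2$, and $$x_{n+1}=\begin{cases}x_{n+1/2},&\text{if }\rho_n=0\text{ and }\chi_n\ge0;\\ x_0+(1+\chi_n/\nu_n)(x_{n+1/2}-x_n),&\text{if }\rho_n>0\text{ and }\chi_n\nu_n\ge\rho_n;\\ x_n+(\nu_n/\rho_n)\big(\chi_n(x_0-x_n)+\kappa_n(x_{n+1/2}-x_n)\big),&\text{if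 }\rho_n>0\text{ and }\chi_n\nu_n<\rho_n.\end{cases}$$ **Theorem.** There is a unique best approximation $(\overline u,\overline g)$ to $(u_0,g_0)$ from $Z$ in $\bigoplus_{i\in I}\mathcal H_i\oplus\bigoplus_{(i,j)\in K}L^2(\Upsilon_{ij})$, and $u_{i,n}\to\overline u_i$ strongly in $\mathcal H_i$ for every $i\in I$ and $g_{ij,n}\to\overline g_{ij}$ strongly in $L^2(\Upsilon_{ij})$ for every $(i,j)\in K$. -/

import Mathlib

open MeasureTheory Filter Topology
open scoped ContDiff

noncomputable section

namespace DomainDecomposition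

/-! ### Convex analysis in a real Hilbert space

The definitions are stated for a real vector space with a positive semidefinite inner product, so
that they apply to an energy space before its inner product is known to be definite. Extended real
functions take values in `EReal`; membership in `Gamma0` excludes the value `-∞`. -/

section Convex

variable {H : Type*} [SeminormedAddCommGroup H] [InnerProductSpace ℝ H]

/-- The class `Γ₀(H)` of lower semicontinuous convex functions from `H` to `]-∞, +∞]` which are not
identically `+∞`. -/
structure Gamma0 (φ : H → EReal) : Prop where
  ne_bot : ∀ x, φ x ≠ ⊥
  proper : ∃ x, φ x ≠ ⊤
  lsc : LowerSemicontinuous φ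
  convex : ∀ x y : H, ∀ a b : ℝ, 0 < a → 0 < b → a + b = 1 →
    φ (a • x + b • y) ≤ (a : EReal) * φ x + (b : EReal) * φ y

/-- The subdifferential `∂φ(u)`. -/
def subdifferential (φ : H → EReal) (u : H) : Set H :=
  {s | ∀ v : H, φ u + ((inner ℝ (v - u) s : ℝ) : EReal) ≤ φ v}

/-- `p` minimizes `v ↦ φ(v) + ‖u - v‖² / 2`. -/
def IsProx (φ : H → EReal) (u p : H) : Prop :=
  ∀ v : H, φ p + ((1 / 2 * ‖u - p‖ ^ 2 : ℝ) : EReal) ≤ φ v + ((1 / 2 * ‖u - v‖ ^ 2 : ℝ) : EReal)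

/-- The proximity operator of `φ`, i.e. the minimizer of `v ↦ φ(v) + ‖u - v‖² / 2`. -/
def prox (φ : H → EReal) (u : H) : H :=
  Classical.epsilon (IsProx φ u)

/-- The function `γ φ`. -/
def scale (γ : ℝ) (φ : H → EReal) : H → EReal :=
  fun x => (γ : EReal) * φ x

end Convex

/-! ### Haugazeau's update in a finite Hilbert direct sum -/

section DirectSum

variable {ι κ : Type*} [Fintype ι] [Fintype κ] {H : ι → Type*} {G : κ → Type*}
  [∀ i, SeminormedAddCommGroup (H i)] [∀ i, InnerProductSpace ℝ (H i)]
  [∀ k, SeminormedAddCommGroup (G k)] [∀ k, InnerProductSpace ℝ (G k)]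

/-- The inner product of the Hilbert direct sum `⨁ H i ⊕ ⨁ G k`. -/
def sumInner (x y : (∀ i, H i) × (∀ k, G k)) : ℝ :=
  ∑ i, (inner ℝ (x.1 i) (y.1 i) : ℝ) + ∑ k, (inner ℝ (x.2 k) (y.2 k) : ℝ)

/-- The squared norm of the Hilbert direct sum `⨁ H i ⊕ ⨁ G k`. -/
def sumNormSq (x : (∀ i, H i) × (∀ k, G k)) : ℝ :=
  ∑ i, ‖x.1 i‖ ^ 2 + ∑ k, ‖x.2 k‖ ^ 2

/-- `z` is a best approximation to `x₀` from `Z` in `⨁ H i ⊕ ⨁ G k`. -/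
def IsBestApprox (Z : Set ((∀ i, H i) × (∀ k, G k))) (x₀ z : (∀ i, H i) × (∀ k, G k)) : Prop :=
  z ∈ Z ∧ ∀ y ∈ Z, sumNormSq (x₀ - z) ≤ sumNormSq (x₀ - y)

open Classical in
/-- The explicit projection of `x₀` onto the intersection of the half-spaces determined by
`(x₀, x)` and `(x, y)`. The three displayed cases are those of the algorithm; the remaining case
`ρ = 0`, `χ < 0`, for which the algorithm prescribes nothing, leaves `x` unchanged. -/
def haugazeau (x₀ x y : (∀ i, H i) × (∀ k, G k)) : (∀ i, H i) × (∀ k, G k) :=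
  let χ := sumInner (x₀ - x) (x - y)
  let μ := sumNormSq (x₀ - x)
  let ν := sumNormSq (x - y)
  let ρ := μ * ν - χ ^ 2
  if ρ = 0 ∧ 0 ≤ χ then y
  else if 0 < ρ ∧ ρ ≤ χ * ν then x₀ + (1 + χ / ν) • (y - x)
  else if 0 < ρ ∧ χ * ν < ρ then x + (ν / ρ) • (χ • (x₀ - x) + μ • (y - x))
  else x

end DirectSum

/-! ### Lipschitz boundaries, surface measure, Sobolev spaces, traces -/

/-- The space `ℝ^N` with its Euclidean norm. -/
abbrev E (N : ℕ) := EuclideanSpace ℝ (Fin N)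

/-- `Ω` has a Lipschitz boundary: near each boundary point and after a rotation, `Ω` is the strict
epigraph of a Lipschitz function of the coordinates orthogonal to a unit vector `e`. -/
def HasLipschitzBoundary {N : ℕ} (Ω : Set (E N)) : Prop :=
  ∀ x ∈ frontier Ω, ∃ e : E N, ‖e‖ = 1 ∧ ∃ g : E N → ℝ, (∃ C, LipschitzWith C g) ∧
    ∃ U ∈ 𝓝 x, ∀ y ∈ U, y ∈ Ω ↔ g (y - (inner ℝ e y : ℝ) • e) < inner ℝ e y

/-- The surface measure on hypersurfaces of `ℝ^N`: the `(N-1)`-dimensional Hausdorff measure, with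
the Euclidean normalization. -/
def surface (N : ℕ) : Measure (E N) :=
  Measure.euclideanHausdorffMeasure (N - 1)

/-- `L²(Ω)` for a subset `Ω` of `ℝ^N` (Lebesgue measure). -/
abbrev L2 {N : ℕ} (Ω : Set (E N)) := Lp ℝ 2 (volume.restrict Ω)

/-- `(L²(Ω))^N`. -/
abbrev L2vec {N : ℕ} (Ω : Set (E N)) := Lp (E N) 2 (volume.restrict Ω)

/-- `L²(Γ)` for a subset `Γ` of a hypersurface of `ℝ^N` (surface measure). -/
abbrev L2surf {N : ℕ} (Γ : Set (E N)) := Lp ℝ 2 ((surface N).restrict Γ)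

/-- Restriction `L²(B) → L²(Γ)` for `Γ ⊆ B`. -/
def restrictSurf {N : ℕ} {Γ B : Set (E N)} (h : Γ ⊆ B) (w : L2surf B) : L2surf Γ :=
  ((Lp.memLp w).mono_measure (Measure.restrict_mono h le_rfl)).toLp w

/-- `G` is the weak gradient of `u` on `Ω`. -/
def IsWeakGradient {N : ℕ} (Ω : Set (E N)) (u : E N → ℝ) (G : E N → E N) : Prop :=
  ∀ φ : E N → ℝ, ContDiff ℝ ∞ φ → HasCompactSupport φ → tsupport φ ⊆ Ω →
    ∫ x in Ω, u x • gradient φ x = - ∫ x in Ω, φ x • G x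

lemma integrable_smul_gradient {N : ℕ} {Ω : Set (E N)} (u : L2 Ω) {φ : E N → ℝ}
    (hφ : ContDiff ℝ ∞ φ) (hc : HasCompactSupport φ) :
    Integrable (fun x => u x • gradient φ x) (volume.restrict Ω) := by
  have hg : Continuous (gradient φ) :=
    (InnerProductSpace.toDual ℝ (E N)).symm.continuous.comp (hφ.continuous_fderiv (by simp))
  have hgc : HasCompactSupport (gradient φ) :=
    (hc.fderiv (𝕜 := ℝ)).comp_left (g := (InnerProductSpace.toDual ℝ (E N)).symm) (map_zero _)
  have hm : MemLp (gradient φ) 2 (volume.restrict Ω) := hg.memLp_of_hasCompactSupport hgc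
  exact memLp_one_iff_integrable.mp (hm.smul (Lp.memLp u))

lemma integrable_smul_field {N : ℕ} {Ω : Set (E N)} (G : L2vec Ω) {φ : E N → ℝ}
    (hφ : ContDiff ℝ ∞ φ) (hc : HasCompactSupport φ) :
    Integrable (fun x => φ x • G x) (volume.restrict Ω) := by
  have hm : MemLp φ 2 (volume.restrict Ω) := hφ.continuous.memLp_of_hasCompactSupport hc
  exact memLp_one_iff_integrable.mp ((Lp.memLp G).smul hm)

/-- `H¹(Ω)`, realized as the space of pairs `(u, Du)` in `L²(Ω) ⊕ (L²(Ω))^N` such that `Du` is the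
weak gradient of `u`. The inherited inner product is `∫ u v + ∫ Du ⬝ Dv`. -/
def H1 {N : ℕ} (Ω : Set (E N)) : Submodule ℝ (WithLp 2 (L2 Ω × L2vec Ω)) where
  carrier := {w | IsWeakGradient Ω w.fst w.snd}
  zero_mem' := by
    intro φ hφ hc hs
    have h1 : ∫ x in Ω, (0 : L2 Ω) x • gradient φ x = 0 := by
      refine integral_eq_zero_of_ae ?_
      filter_upwards [Lp.coeFn_zero ℝ 2 (volume.restrict Ω)] with x hx
      simp only [hx, Pi.zero_apply, zero_smul]
    have h2 : ∫ x in Ω, φ x • (0 : L2vec Ω) x = 0 := by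
      refine integral_eq_zero_of_ae ?_
      filter_upwards [Lp.coeFn_zero (E N) 2 (volume.restrict Ω)] with x hx
      simp only [hx, Pi.zero_apply, smul_zero]
    change ∫ x in Ω, (0 : L2 Ω) x • gradient φ x = - ∫ x in Ω, φ x • (0 : L2vec Ω) x
    rw [h1, h2, neg_zero]
  add_mem' := by
    intro a b ha hb φ hφ hc hs
    have h1 : ∫ x in Ω, (a.fst + b.fst : L2 Ω) x • gradient φ x
        = (∫ x in Ω, a.fst x • gradient φ x) + ∫ x in Ω, b.fst x • gradient φ x := by
      rw [← integral_add (integrable_smul_gradient a.fst hφ hc)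
        (integrable_smul_gradient b.fst hφ hc)]
      refine integral_congr_ae ?_
      filter_upwards [Lp.coeFn_add a.fst b.fst] with x hx
      simp only [hx, Pi.add_apply, add_smul]
    have h2 : ∫ x in Ω, φ x • (a.snd + b.snd : L2vec Ω) x
        = (∫ x in Ω, φ x • a.snd x) + ∫ x in Ω, φ x • b.snd x := by
      rw [← integral_add (integrable_smul_field a.snd hφ hc) (integrable_smul_field b.snd hφ hc)]
      refine integral_congr_ae ?_
      filter_upwards [Lp.coeFn_add a.snd b.snd] with x hx
      simp only [hx, Pi.add_apply, smul_add]
    have e1 := ha φ hφ hc hs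
    have e2 := hb φ hφ hc hs
    change ∫ x in Ω, (a.fst + b.fst : L2 Ω) x • gradient φ x
      = - ∫ x in Ω, φ x • (a.snd + b.snd : L2vec Ω) x
    rw [h1, h2, e1, e2]
    abel
  smul_mem' := by
    intro c a ha φ hφ hc hs
    have h1 : ∫ x in Ω, (c • a.fst : L2 Ω) x • gradient φ x
        = c • ∫ x in Ω, a.fst x • gradient φ x := by
      rw [← integral_smul]
      refine integral_congr_ae ?_
      filter_upwards [Lp.coeFn_smul c a.fst] with x hx
      simp only [hx, Pi.smul_apply, smul_eq_mul, mul_smul]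
    have h2 : ∫ x in Ω, φ x • (c • a.snd : L2vec Ω) x
        = c • ∫ x in Ω, φ x • a.snd x := by
      rw [← integral_smul]
      refine integral_congr_ae ?_
      filter_upwards [Lp.coeFn_smul c a.snd] with x hx
      simp only [hx, Pi.smul_apply, smul_comm c (φ x)]
    change ∫ x in Ω, (c • a.fst : L2 Ω) x • gradient φ x
      = - ∫ x in Ω, φ x • (c • a.snd : L2vec Ω) x
    rw [h1, h2, ha φ hφ hc hs, smul_neg]

/-- `v` belongs to `C¹(Ω̄)`: it is continuous on the closure of `Ω` and differentiable on `Ω` with a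
gradient that extends continuously to the closure of `Ω`. -/
def C1Closure {N : ℕ} (Ω : Set (E N)) (v : E N → ℝ) : Prop :=
  ContinuousOn v (closure Ω) ∧
    ∃ G : E N → E N, ContinuousOn G (closure Ω) ∧ ∀ x ∈ Ω, HasGradientAt v (G x) x

/-- The bounded linear operator `T` maps (the class of) each `v ∈ C¹(Ω̄)` to its restriction to the
boundary. -/
def IsTrace {N : ℕ} (Ω : Set (E N)) (T : H1 Ω →L[ℝ] L2surf (frontier Ω)) : Prop :=
  ∀ v : E N → ℝ, C1Closure Ω v → ∀ w : H1 Ω, w.1.fst =ᵐ[volume.restrict Ω] v →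
    T w =ᵐ[(surface N).restrict (frontier Ω)] v

/-- The Sobolev trace operator `H¹(Ω) → L²(bdry Ω)`. -/
def trace {N : ℕ} (Ω : Set (E N)) : H1 Ω →L[ℝ] L2surf (frontier Ω) :=
  Classical.epsilon (IsTrace Ω)

/-- The subspace of the functions in `H¹(Ω)` with zero trace on `Γ`. -/
def zeroTrace {N : ℕ} (Ω Γ : Set (E N)) (hΓ : Γ ⊆ frontier Ω) : Submodule ℝ (H1 Ω) where
  carrier := {u | trace Ω u =ᵐ[(surface N).restrict Γ] 0}
  zero_mem' := by
    have h := Lp.coeFn_zero ℝ 2 ((surface N).restrict (frontier Ω))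
    change trace Ω 0 =ᵐ[(surface N).restrict Γ] 0
    rw [map_zero]
    exact ae_mono (Measure.restrict_mono hΓ le_rfl) h
  add_mem' := by
    intro a b ha hb
    have h := ae_mono (Measure.restrict_mono hΓ le_rfl) (Lp.coeFn_add (trace Ω a) (trace Ω b))
    change trace Ω (a + b) =ᵐ[(surface N).restrict Γ] 0
    rw [map_add]
    filter_upwards [h, ha, hb] with x hx h1 h2
    simp only [hx, Pi.add_apply, h1, h2, Pi.zero_apply, add_zero]
  smul_mem' := by
    intro c a ha
    have h := ae_mono (Measure.restrict_mono hΓ le_rfl) (Lp.coeFn_smul c (trace Ω a))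
    change trace Ω (c • a) =ᵐ[(surface N).restrict Γ] 0
    rw [map_smul]
    filter_upwards [h, ha] with x hx h1
    simp only [hx, Pi.smul_apply, h1, Pi.zero_apply, smul_zero]

/-- `H¹_{0,Γ}(Ω)`: the functions in `H¹(Ω)` with zero trace on `Γ`. It is a type of its own because
it carries the inner product `∫ Du ⬝ Dv` instead of the one of `H¹(Ω)`. -/
def EnergySpace {N : ℕ} (Ω Γ : Set (E N)) (hΓ : Γ ⊆ frontier Ω) : Type :=
  zeroTrace Ω Γ hΓ

section EnergySpace

variable {N : ℕ} {Ω Γ : Set (E N)} {hΓ : Γ ⊆ frontier Ω}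

instance : AddCommGroup (EnergySpace Ω Γ hΓ) :=
  inferInstanceAs (AddCommGroup (zeroTrace Ω Γ hΓ))

instance : Module ℝ (EnergySpace Ω Γ hΓ) :=
  inferInstanceAs (Module ℝ (zeroTrace Ω Γ hΓ))

/-- The inclusion in `H¹(Ω)`. -/
def EnergySpace.toH1 : EnergySpace Ω Γ hΓ →ₗ[ℝ] H1 Ω :=
  (zeroTrace Ω Γ hΓ).subtype

/-- The underlying element of `L²(Ω)`. -/
def EnergySpace.fn (u : EnergySpace Ω Γ hΓ) : L2 Ω := u.toH1.1.fst

/-- The weak gradient. -/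
def EnergySpace.grad : EnergySpace Ω Γ hΓ →ₗ[ℝ] L2vec Ω where
  toFun u := u.toH1.1.snd
  map_add' u v := by simp
  map_smul' c u := by simp

/-- The norm is the `L²` norm of the weak gradient. -/
instance : SeminormedAddCommGroup (EnergySpace Ω Γ hΓ) :=
  SeminormedAddCommGroup.induced (EnergySpace Ω Γ hΓ) (L2vec Ω) EnergySpace.grad

instance : NormedSpace ℝ (EnergySpace Ω Γ hΓ) :=
  NormedSpace.induced ℝ (EnergySpace Ω Γ hΓ) (L2vec Ω) EnergySpace.grad

/-- The inner product is `∫ Du ⬝ Dv`. -/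
instance : InnerProductSpace ℝ (EnergySpace Ω Γ hΓ) where
  inner u v := inner ℝ (EnergySpace.grad u) (EnergySpace.grad v)
  norm_sq_eq_re_inner u := norm_sq_eq_re_inner (𝕜 := ℝ) (EnergySpace.grad u)
  conj_inner_symm u v := inner_conj_symm (𝕜 := ℝ) (EnergySpace.grad u) (EnergySpace.grad v)
  add_left u v w := by rw [map_add, inner_add_left]
  smul_left u v r := by rw [map_smul, inner_smul_left]

lemma energy_inner_eq (u v : EnergySpace Ω Γ hΓ) :
    (inner ℝ u v : ℝ) =
      ∫ x in Ω, (inner ℝ (EnergySpace.grad u x) (EnergySpace.grad v x) : ℝ) :=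
  L2.inner_def (𝕜 := ℝ) (EnergySpace.grad u) (EnergySpace.grad v)

end EnergySpace

/-! ### Geometry of the decomposition -/

/-- The interior of `A` relative to `B`, for `A ⊆ B`. -/
def relInterior {N : ℕ} (B A : Set (E N)) : Set (E N) :=
  (Subtype.val : B → E N) '' interior ((Subtype.val : B → E N) ⁻¹' A)

lemma relInterior_subset {N : ℕ} (B A : Set (E N)) : relInterior B A ⊆ A := by
  rintro _ ⟨x, hx, rfl⟩
  have h : x ∈ (Subtype.val : B → E N) ⁻¹' A := interior_subset hx
  exact h

section Geometry

variable {N m : ℕ} (Ω : Set (E N)) (D : Fin m → Set (E N))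

/-- The sets `Υ i j`: for `i = j` the relative interior in `bdry Ω` of `bdry (D i) ∩ bdry Ω`, and
for `i < j` the relative interior in `bdry (D i)` of `bdry (D i) ∩ bdry (D j)`, with
`Υ j i = Υ i j`. -/
def Interface (i j : Fin m) : Set (E N) :=
  if i = j then relInterior (frontier Ω) (frontier (D i) ∩ frontier Ω)
  else relInterior (frontier (D (min i j))) (frontier (D (min i j)) ∩ frontier (D (max i j)))

lemma interface_comm (i j : Fin m) : Interface Ω D i j = Interface Ω D j i := by
  by_cases h : i = j
  · rw [h]
  · simp only [Interface, if_neg h, if_neg (Ne.symm h), min_comm i j, max_comm i j]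

lemma interface_subset (i j : Fin m) : Interface Ω D i j ⊆ frontier (D i) := by
  unfold Interface
  split_ifs with h
  · exact (relInterior_subset _ _).trans Set.inter_subset_left
  · refine (relInterior_subset _ _).trans ?_
    rcases le_total i j with hij | hij
    · rw [min_eq_left hij]; exact Set.inter_subset_left
    · rw [max_eq_left hij]; exact Set.inter_subset_right

/-- The index set `J(i)` of the neighbors of `D i`. -/
def J (i : Fin m) : Type := {j : Fin m // j ≠ i ∧ (Interface Ω D i j).Nonempty}

/-- The set `K` of the active interfaces `(i, j)`, `i < j`. -/
def K : Type := {k : Fin m × Fin m // k.1 < k.2 ∧ (Interface Ω D k.1 k.2).Nonempty}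

instance (i : Fin m) : Fintype (J Ω D i) :=
  @Fintype.ofFinite _ (inferInstanceAs (Finite {j : Fin m // j ≠ i ∧ (Interface Ω D i j).Nonempty}))

instance : Fintype (K Ω D) :=
  @Fintype.ofFinite _ (inferInstanceAs
    (Finite {k : Fin m × Fin m // k.1 < k.2 ∧ (Interface Ω D k.1 k.2).Nonempty}))

/-- The geometrical assumptions on the domain `Ω` and its subdomains `D i`. The last one says that
every connected component of a subdomain `D i` touches the Dirichlet part `Υ i i` of its boundary;
if `D i` is connected, it reduces to `Υ i i` being nonempty. -/
structure IsDecomposition : Prop where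
  isOpen : IsOpen Ω
  nonempty : Ω.Nonempty
  isBounded : Bornology.IsBounded Ω
  lipschitz : HasLipschitzBoundary Ω
  two_le : 2 ≤ m
  isOpen_sub : ∀ i, IsOpen (D i)
  sub_subset : ∀ i, D i ⊆ Ω
  disjoint : ∀ i j, i ≠ j → Disjoint (D i) (D j)
  lipschitz_sub : ∀ i, HasLipschitzBoundary (D i)
  closure_eq : closure Ω = ⋃ i, closure (D i)
  dirichlet_nonempty : ∀ i, (Interface Ω D i i).Nonempty
  neighbor : ∀ i, Nonempty (J Ω D i)
  component : ∀ i, ∀ x ∈ D i,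
    (closure (connectedComponentIn (D i) x) ∩ Interface Ω D i i).Nonempty

/-! ### Function spaces and operators of the decomposition -/

/-- The space `H i = H¹_{0, Υ i i}(D i)` with the inner product `∫ Du ⬝ Dv`. -/
abbrev H (i : Fin m) : Type := EnergySpace (D i) (Interface Ω D i i) (interface_subset Ω D i i)

/-- The space `L²(Υ i j)` of an active interface `k = (i, j)`. -/
abbrev L (k : K Ω D) : Type := L2surf (Interface Ω D k.1.1 k.1.2)

/-- The direct sum of the spaces `H i` and of the spaces `L²(Υ i j)`, `(i, j) ∈ K`. -/
abbrev PrimalDual : Type := (∀ i, H Ω D i) × (∀ k, L Ω D k)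

/-- The trace operator `T i j : H i → L²(Υ i j)`. -/
def T (i j : Fin m) (u : H Ω D i) : L2surf (Interface Ω D i j) :=
  restrictSurf (interface_subset Ω D i j) (trace (D i) u.toH1)

/-- The identification of `L²(Υ j i)` with `L²(Υ i j)`. -/
def swapSides (i j : Fin m) (w : L2surf (Interface Ω D j i)) : L2surf (Interface Ω D i j) :=
  restrictSurf (interface_comm Ω D i j).subset w

/-- `u` is the weak solution in `H i` of the Dirichlet-Neumann problem `-Δu = f` on `D i`, `u = 0`
on `Υ i i`, and `∂u/∂ν = h j` (respectively `∂u/∂ν = - h j`) on `Υ i j` for every neighbor `j > i`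
(respectively `j < i`). -/
def IsWeakSolution (i : Fin m) (f : L2 (D i)) (h : ∀ j : J Ω D i, L2surf (Interface Ω D i j.1))
    (u : H Ω D i) : Prop :=
  ∀ v : H Ω D i, (inner ℝ u v : ℝ) = (∫ x in D i, f x * v.fn x)
    + ∑ j : J Ω D i, (if i < j.1 then 1 else -1) *
        ∫ x in Interface Ω D i j.1, h j x * T Ω D i j.1 v x ∂(surface N)

/-- The solution operator `Q i` of the Dirichlet-Neumann problem. -/
def Q (i : Fin m) (f : L2 (D i)) (h : ∀ j : J Ω D i, L2surf (Interface Ω D i j.1)) : H Ω D i :=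
  Classical.epsilon (IsWeakSolution Ω D i f h)

/-- The family `((g i j)_{j ∈ J(i), j > i}, (g j i)_{j ∈ J(i), j < i})`. -/
def around (g : ∀ k, L Ω D k) (i : Fin m) (j : J Ω D i) : L2surf (Interface Ω D i j.1) :=
  if h : i < j.1 then g ⟨(i, j.1), h, j.2.2⟩
  else swapSides Ω D i j.1 (g ⟨(j.1, i), lt_of_le_of_ne (not_lt.mp h) j.2.1,
    (interface_comm Ω D i j.1) ▸ j.2.2⟩)

/-- The jump `T i j (u i) - T j i (u j)` across the interface `k = (i, j)`. -/
def jump (u : ∀ i, H Ω D i) (k : K Ω D) : L Ω D k :=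
  T Ω D k.1.1 k.1.2 (u k.1.1) - swapSides Ω D k.1.1 k.1.2 (T Ω D k.1.2 k.1.1 (u k.1.2))

/-- The Kuhn-Tucker set: all `(u, g)` with `g i j ∈ ∂ψ i j (T i j (u i) - T j i (u j))` for every
`(i, j) ∈ K` and `-Q i (0, g) ∈ ∂φ i (u i)` for every `i`. -/
def kuhnTucker (φ : ∀ i, H Ω D i → EReal) (ψ : ∀ k, L Ω D k → EReal) : Set (PrimalDual Ω D) :=
  {x | (∀ k, x.2 k ∈ subdifferential (ψ k) (jump Ω D x.1 k)) ∧
    ∀ i, - Q Ω D i 0 (around Ω D x.2 i) ∈ subdifferential (φ i) (x.1 i)}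

open Classical in
/-- The intermediate point `x_{n+1/2}` computed from `x_n = x` by the primal-dual proximal step with
parameters `γ_n, μ_n, λ_n`. -/
def halfStep (φ : ∀ i, H Ω D i → EReal) (ψ : ∀ k, L Ω D k → EReal) (γ μ lam : ℝ)
    (x : PrimalDual Ω D) : PrimalDual Ω D :=
  let u := x.1
  let g := x.2
  let v : ∀ i, H Ω D i := fun i => u i - γ • Q Ω D i 0 (around Ω D g i)
  let p : ∀ i, H Ω D i := fun i => prox (scale γ (φ i)) (v i)
  let l : ∀ k, L Ω D k := jump Ω D u
  let q : ∀ k, L Ω D k := fun k => prox (scale μ (ψ k)) (l k + μ • g k)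
  let t : ∀ k, L Ω D k := fun k => q k - jump Ω D p k
  let s : ∀ i, H Ω D i := fun i =>
    γ⁻¹ • (u i - p i) + μ⁻¹ • Q Ω D i 0 (around Ω D (fun k => l k - q k) i)
  let τ : ℝ := ∑ i, ‖s i‖ ^ 2 + ∑ k, ‖t k‖ ^ 2
  let θ : ℝ := if τ = 0 then 0 else
    lam * (γ⁻¹ * ∑ i, ‖u i - p i‖ ^ 2 + μ⁻¹ * ∑ k, ‖l k - q k‖ ^ 2) / τ
  (fun i => u i - θ • s i, fun k => g k - θ • t k)

/-- The sequence generated by the algorithm from `x₀ = (u₀, g₀)`. -/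
def iterate (φ : ∀ i, H Ω D i → EReal) (ψ : ∀ k, L Ω D k → EReal) (γ μ lam : ℕ → ℝ)
    (x₀ : PrimalDual Ω D) : ℕ → PrimalDual Ω D
  | 0 => x₀
  | n + 1 =>
    haugazeau x₀ (iterate φ ψ γ μ lam x₀ n)
      (halfStep Ω D φ ψ (γ n) (μ n) (lam n) (iterate φ ψ γ μ lam x₀ n))

end Geometry

end DomainDecomposition

end

open DomainDecomposition

/-! The algorithm is an instance of an abstract scheme. The jump map sending `u` to the family `T i
j (u i) - T j i (u j)` is a bounded operator `L` between the two direct sums, and testing the weak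
formulations shows that `g ↦ (Q i 0 (around g i))` is its adjoint (`IsDecomposition.sum_inner_Q`).
Hence `kuhnTucker` is the set of pairs with `-L* g ∈ A u` and `g ∈ B (L u)`, where `A` and `B` are
products of subdifferentials. These are monotone, and their resolvents, being proximity operators,
are defined everywhere.

The proximal points are elements of the graphs of `A` and `B`. Monotonicity turns them into a
half-space containing the Kuhn-Tucker set (`le_inner_of_mem_operatorKuhnTucker`), onto which the
half-step is a relaxed projection. Haugazeau's update projects `x₀` onto the intersection of this
half-space with the one determined by `x₀` and the current iterate (`haugazeauUpdate_spec`). The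
distances to `x₀` therefore increase and stay below the distance from `x₀` to the target, so the
steps tend to zero. Since the step lengths control the residuals, Minty's trick puts every weak
cluster point in the target (`mem_operatorKuhnTucker_of_weak_limit`). The bound on the distances
upgrades weak to strong convergence, and the limit satisfies the variational inequality of the best
approximation (`haugazeau_tendsto`, `primalDual_tendsto`).

The remaining work is to show that the objects exist, since `trace`, `prox` and `Q` are defined by
choice and the energy inner product is a priori only semidefinite. On a bounded Lipschitz domain,
`C¹` functions are dense in `H¹` (`C1Space.denseRange_toH1`); integration along the transverse
direction of a boundary chart gives the trace inequality and hence the trace operator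
(`exists_isTrace`). A Poincaré inequality, started at the Dirichlet part and propagated through each
connected component (`poincareOn_self`), makes the energy norm equivalent to the `H¹` norm. The
energy spaces are then Hilbert spaces, the trace maps are continuous on them, and Riesz
representation yields `Q`. -/

namespace DomainDecomposition

/-! ### Proximity operators and subdifferentials of functions in `Γ₀` -/

section Convex

variable {H : Type*} [SeminormedAddCommGroup H] [InnerProductSpace ℝ H] {φ : H → EReal}

lemma Gamma0.coe_toReal (hφ : Gamma0 φ) {v : H} (hv : φ v ≠ ⊤) :
    (((φ v).toReal : ℝ) : EReal) = φ v :=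
  EReal.coe_toReal hv (hφ.ne_bot v)

lemma Gamma0.toReal_convex (hφ : Gamma0 φ) {v w : H} (hv : φ v ≠ ⊤) (hw : φ w ≠ ⊤) {a b : ℝ}
    (ha : 0 < a) (hb : 0 < b) (hab : a + b = 1) :
    φ (a • v + b • w) ≠ ⊤ ∧
      (φ (a • v + b • w)).toReal ≤ a * (φ v).toReal + b * (φ w).toReal := by
  have h := hφ.convex v w a b ha hb hab
  rw [← hφ.coe_toReal hv, ← hφ.coe_toReal hw, ← EReal.coe_mul, ← EReal.coe_mul,
    ← EReal.coe_add] at h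
  have h1 : φ (a • v + b • w) ≠ ⊤ := ne_top_of_le_ne_top (EReal.coe_ne_top _) h
  refine ⟨h1, ?_⟩
  rw [← hφ.coe_toReal h1] at h
  exact EReal.coe_le_coe_iff.mp h

/-- Lower semicontinuity bounds `φ` below on a ball about a point of the domain, and convexity along
segments issued from that point allows at most linear decrease outside the ball. This conical
minorant replaces the affine one given by Hahn-Banach; it is all that coercivity of the proximal
objective requires. -/
lemma Gamma0.exists_lower_bound (hφ : Gamma0 φ) :
    ∃ x₀ : H, ∃ c r : ℝ, 0 < r ∧ φ x₀ ≠ ⊤ ∧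
      ∀ v, φ v ≠ ⊤ → c - ‖v - x₀‖ / r ≤ (φ v).toReal := by
  obtain ⟨x₀, hx₀⟩ := hφ.proper
  set f := (φ x₀).toReal
  have hlt : ((f - 1 : ℝ) : EReal) < φ x₀ := by
    rw [← hφ.coe_toReal hx₀, EReal.coe_lt_coe_iff]; linarith
  obtain ⟨r, hr, hball⟩ := Metric.eventually_nhds_iff.mp (hφ.lsc x₀ _ hlt)
  refine ⟨x₀, f - 1, r / 2, by positivity, hx₀, fun v hv => ?_⟩
  rcases lt_or_ge (dist v x₀) r with hd | hd
  · have h : ((f - 1 : ℝ) : EReal) < φ v := hball hd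
    rw [← hφ.coe_toReal hv, EReal.coe_lt_coe_iff] at h
    have : 0 ≤ ‖v - x₀‖ / (r / 2) := by positivity
    linarith
  · rw [dist_eq_norm] at hd
    set d := ‖v - x₀‖
    have hdpos : 0 < d := hr.trans_le hd
    -- This `t` places the intermediate point at distance `r / 2` from `x₀`, inside the ball; the
    -- slope `1 / (r / 2)` comes from `1 / t`.
    set t := r / (2 * d) with ht
    have ht0 : 0 < t := by positivity
    have ht1 : t < 1 := by rw [ht, div_lt_one (by positivity)]; linarith
    obtain ⟨h1, h2⟩ := hφ.toReal_convex hx₀ hv (a := 1 - t) (b := t) (by linarith) ht0 (by ring)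
    have hy : dist ((1 - t) • x₀ + t • v) x₀ < r := by
      have : (1 - t) • x₀ + t • v - x₀ = t • (v - x₀) := by module
      rw [dist_eq_norm, this, norm_smul, Real.norm_of_nonneg ht0.le]
      change t * d < r
      rw [ht]; field_simp; linarith
    have h : ((f - 1 : ℝ) : EReal) < φ ((1 - t) • x₀ + t • v) := hball hy
    rw [← hφ.coe_toReal h1, EReal.coe_lt_coe_iff] at h
    have h3 : t * (f - (φ v).toReal) ≤ 1 := by linarith
    have h4 : f - (φ v).toReal ≤ 1 / t := by rw [le_div_iff₀ ht0]; linarith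
    have h5 : 1 / t = d / (r / 2) := by rw [ht]; field_simp
    rw [h5] at h4
    linarith

lemma Gamma0.le_of_tendsto (hφ : Gamma0 φ) {v : ℕ → H} {p : H} {c : ℕ → ℝ} {c₀ : ℝ}
    (hv : Tendsto v atTop (𝓝 p)) (hc : Tendsto c atTop (𝓝 c₀)) (h : ∀ n, φ (v n) ≤ c n) :
    φ p ≤ c₀ := by
  by_contra! hlt
  obtain ⟨y, hy1, hy2⟩ := EReal.lt_iff_exists_real_btwn.mp hlt
  have h1 : ∀ᶠ n in atTop, (y : EReal) < φ (v n) := hv.eventually (hφ.lsc p _ hy2)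
  have h2 : ∀ᶠ n in atTop, c n < y := hc.eventually_lt_const (EReal.coe_lt_coe_iff.mp hy1)
  obtain ⟨n, hn1, hn2⟩ := (h1.and h2).exists
  exact absurd (hn1.trans_le (h n)) (not_lt.mpr (EReal.coe_le_coe_iff.mpr hn2.le))

/-- Transfers minimality from extended reals to reals on the domain of `φ`: properness forces a
minimizer to have a finite value, and points with value `⊤` impose no condition. -/
lemma isProx_scale_iff (hφ : Gamma0 φ) {γ : ℝ} (hγ : 0 < γ) (u p : H) :
    IsProx (scale γ φ) u p ↔ φ p ≠ ⊤ ∧ ∀ v, φ v ≠ ⊤ →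
      γ * (φ p).toReal + 1 / 2 * ‖u - p‖ ^ 2 ≤ γ * (φ v).toReal + 1 / 2 * ‖u - v‖ ^ 2 := by
  have key : ∀ v, φ v ≠ ⊤ → scale γ φ v + ((1 / 2 * ‖u - v‖ ^ 2 : ℝ) : EReal)
      = ((γ * (φ v).toReal + 1 / 2 * ‖u - v‖ ^ 2 : ℝ) : EReal) := by
    intro v hv
    rw [scale, EReal.coe_add, EReal.coe_mul γ, hφ.coe_toReal hv]
  have ktop : ∀ v, φ v = ⊤ → scale γ φ v + ((1 / 2 * ‖u - v‖ ^ 2 : ℝ) : EReal) = ⊤ := by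
    intro v hv
    rw [scale, hv, EReal.coe_mul_top_of_pos hγ, EReal.top_add_coe]
  constructor
  · intro h
    have hp : φ p ≠ ⊤ := by
      intro hp
      obtain ⟨x, hx⟩ := hφ.proper
      have := h x
      rw [ktop p hp, key x hx, top_le_iff] at this
      exact EReal.coe_ne_top _ this
    refine ⟨hp, fun v hv => ?_⟩
    have := h v
    rw [key p hp, key v hv] at this
    exact EReal.coe_le_coe_iff.mp this
  · rintro ⟨hp, h⟩ v
    by_cases hv : φ v = ⊤
    · rw [ktop v hv]; exact le_top
    · rw [key p hp, key v hv]
      exact EReal.coe_le_coe_iff.mpr (h v hv)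

/-- The quadratic term makes the objective strongly convex: by the parallelogram law and the
midpoint inequality a minimizing sequence is Cauchy. Lower semicontinuity passes to its limit. -/
theorem exists_isProx [CompleteSpace H] (hφ : Gamma0 φ) {γ : ℝ} (hγ : 0 < γ) (u : H) :
    ∃ p, IsProx (scale γ φ) u p := by
  obtain ⟨x₀, c, r, hr, hx₀, hlow⟩ := hφ.exists_lower_bound
  set F : H → ℝ := fun v => γ * (φ v).toReal + 1 / 2 * ‖u - v‖ ^ 2 with hF
  set S : Set ℝ := F '' {v | φ v ≠ ⊤} with hS
  have hSne : S.Nonempty := ⟨F x₀, x₀, hx₀, rfl⟩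
  have hSbdd : BddBelow S := by
    -- The last term is the minimum of `s ↦ s ^ 2 / 2 - (γ / r) * s`, with `s = ‖u - v‖`.
    refine ⟨γ * c - γ / r * ‖u - x₀‖ - 1 / 2 * (γ / r) ^ 2, ?_⟩
    rintro _ ⟨v, hv, rfl⟩
    have h1 : γ * (c - ‖v - x₀‖ / r) ≤ γ * (φ v).toReal := mul_le_mul_of_nonneg_left (hlow v hv) hγ.le
    have h2 : ‖v - x₀‖ ≤ ‖u - v‖ + ‖u - x₀‖ := by
      have : v - x₀ = (u - x₀) - (u - v) := by abel
      rw [this, add_comm]; exact norm_sub_le _ _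
    have h3 : γ * (c - ‖v - x₀‖ / r) = γ * c - γ / r * ‖v - x₀‖ := by field_simp
    have h4 : γ / r * ‖v - x₀‖ ≤ γ / r * (‖u - v‖ + ‖u - x₀‖) :=
      mul_le_mul_of_nonneg_left h2 (by positivity)
    simp only [hF]
    nlinarith [sq_nonneg (‖u - v‖ - γ / r)]
  set M := sInf S
  have hM : ∀ v, φ v ≠ ⊤ → M ≤ F v := fun v hv => csInf_le hSbdd ⟨v, hv, rfl⟩
  have hex : ∀ n : ℕ, ∃ v, φ v ≠ ⊤ ∧ F v < M + 1 / ((n : ℝ) + 1) := by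
    intro n
    obtain ⟨_, ⟨v, hv, rfl⟩, h⟩ := exists_lt_of_csInf_lt hSne
      (show sInf S < M + 1 / ((n : ℝ) + 1) from lt_add_of_pos_right _ (by positivity))
    exact ⟨v, hv, h⟩
  choose v hv hvF using hex
  have hpar : ∀ n k, ‖v n - v k‖ ^ 2 ≤ 4 * (F (v n) + F (v k) - 2 * M) := by
    intro n k
    obtain ⟨h1, h2⟩ := hφ.toReal_convex (hv n) (hv k) (a := 1 / 2) (b := 1 / 2) (by norm_num)
      (by norm_num) (by norm_num)
    have h3 := hM _ h1
    have h4 := parallelogram_law_with_norm ℝ (u - v n) (u - v k)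
    have h5 : ‖u - ((1 / 2 : ℝ) • v n + (1 / 2 : ℝ) • v k)‖ = 1 / 2 * ‖(u - v n) + (u - v k)‖ := by
      rw [show u - ((1 / 2 : ℝ) • v n + (1 / 2 : ℝ) • v k)
        = (1 / 2 : ℝ) • ((u - v n) + (u - v k)) by module, norm_smul]
      norm_num
    have h6 : ‖(u - v n) - (u - v k)‖ = ‖v n - v k‖ := by
      rw [sub_sub_sub_cancel_left, norm_sub_rev]
    rw [h6] at h4
    simp only [hF] at h3 ⊢
    rw [h5] at h3
    nlinarith
  have hFlim : Tendsto (fun n => F (v n)) atTop (𝓝 M) := by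
    refine tendsto_of_tendsto_of_tendsto_of_le_of_le tendsto_const_nhds ?_ (fun n => hM _ (hv n))
      (fun n => (hvF n).le)
    simpa using tendsto_const_nhds.add (tendsto_one_div_add_atTop_nhds_zero_nat (𝕜 := ℝ))
  have hcau : CauchySeq v := by
    rw [Metric.cauchySeq_iff]
    intro δ hδ
    have : ∀ᶠ n in atTop, F (v n) < M + δ ^ 2 / 8 :=
      hFlim.eventually_lt_const (lt_add_of_pos_right _ (by positivity))
    obtain ⟨n₀, hn₀⟩ := eventually_atTop.mp this
    refine ⟨n₀, fun n hn k hk => ?_⟩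
    have h1 := hn₀ n hn
    have h2 := hn₀ k hk
    have h3 := hpar n k
    rw [dist_eq_norm]
    exact lt_of_pow_lt_pow_left₀ 2 hδ.le (by linarith)
  obtain ⟨p, hp⟩ := cauchySeq_tendsto_of_complete hcau
  have hle : φ p ≤ ((γ⁻¹ * (M - 1 / 2 * ‖u - p‖ ^ 2) : ℝ) : EReal) := by
    refine hφ.le_of_tendsto hp (c := fun n => γ⁻¹ * (F (v n) - 1 / 2 * ‖u - v n‖ ^ 2)) ?_ ?_
    · exact ((hFlim.sub (((tendsto_const_nhds.sub hp).norm.pow 2).const_mul _)).const_mul _)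
    · intro n
      rw [← hφ.coe_toReal (hv n), EReal.coe_le_coe_iff]
      simp only [hF]
      field_simp
      linarith
  have hptop : φ p ≠ ⊤ := ne_top_of_le_ne_top (EReal.coe_ne_top _) hle
  refine ⟨p, (isProx_scale_iff hφ hγ u p).mpr ⟨hptop, fun w hw => ?_⟩⟩
  rw [← hφ.coe_toReal hptop, EReal.coe_le_coe_iff] at hle
  have h1 : γ * (φ p).toReal ≤ M - 1 / 2 * ‖u - p‖ ^ 2 := by
    have := mul_le_mul_of_nonneg_left hle hγ.le
    rwa [mul_inv_cancel_left₀ hγ.ne'] at this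
  have := hM w hw
  simp only [hF] at this
  linarith

lemma mem_subdifferential_iff (hφ : Gamma0 φ) {u s : H} :
    s ∈ subdifferential φ u ↔ φ u ≠ ⊤ ∧
      ∀ v, φ v ≠ ⊤ → (φ u).toReal + inner ℝ (v - u) s ≤ (φ v).toReal := by
  constructor
  · intro h
    have hu : φ u ≠ ⊤ := by
      intro hu
      obtain ⟨x, hx⟩ := hφ.proper
      have := h x
      rw [hu, EReal.top_add_coe, top_le_iff] at this
      exact hx this
    refine ⟨hu, fun v hv => ?_⟩
    have := h v
    rw [← hφ.coe_toReal hu, ← hφ.coe_toReal hv, ← EReal.coe_add] at this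
    exact EReal.coe_le_coe_iff.mp this
  · rintro ⟨hu, h⟩ v
    by_cases hv : φ v = ⊤
    · rw [hv]; exact le_top
    · rw [← hφ.coe_toReal hu, ← hφ.coe_toReal hv, ← EReal.coe_add]
      exact EReal.coe_le_coe_iff.mpr (h v hv)

theorem subdifferential_monotone (hφ : Gamma0 φ) {u s v t : H} (hs : s ∈ subdifferential φ u)
    (ht : t ∈ subdifferential φ v) : 0 ≤ (inner ℝ (u - v) (s - t) : ℝ) := by
  obtain ⟨hu, hs⟩ := (mem_subdifferential_iff hφ).mp hs
  obtain ⟨hv, ht⟩ := (mem_subdifferential_iff hφ).mp ht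
  have h1 := hs v hv
  have h2 := ht u hu
  rw [inner_sub_right]
  have h3 : (inner ℝ (v - u) s : ℝ) = - inner ℝ (u - v) s := by rw [← neg_sub, inner_neg_left]
  linarith

/-- Fermat's rule: minimality is compared with the points `(1 - t) • p + t • v`; after division by
`t`, letting `t` tend to `0` removes the quadratic remainder. -/
theorem IsProx.mem_subdifferential (hφ : Gamma0 φ) {γ : ℝ} (hγ : 0 < γ) {u p : H}
    (h : IsProx (scale γ φ) u p) : γ⁻¹ • (u - p) ∈ subdifferential φ p := by
  obtain ⟨hp, h⟩ := (isProx_scale_iff hφ hγ u p).mp h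
  refine (mem_subdifferential_iff hφ).mpr ⟨hp, fun v hv => ?_⟩
  have key : ∀ t : ℝ, 0 < t → t < 1 →
      inner ℝ (u - p) (v - p) ≤ γ * ((φ v).toReal - (φ p).toReal) + t * (1 / 2 * ‖v - p‖ ^ 2) := by
    intro t ht0 ht1
    obtain ⟨h1, h2⟩ := hφ.toReal_convex hp hv (a := 1 - t) (b := t) (by linarith) ht0 (by ring)
    have h3 := h _ h1
    have h4 : u - ((1 - t) • p + t • v) = (u - p) - t • (v - p) := by module
    rw [h4, norm_sub_sq_real (u - p), inner_smul_right, norm_smul, mul_pow, Real.norm_of_nonneg ht0.le] at h3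
    have h5 := mul_le_mul_of_nonneg_left h2 hγ.le
    have h6 : t * inner ℝ (u - p) (v - p) ≤
        t * (γ * ((φ v).toReal - (φ p).toReal) + t * (1 / 2 * ‖v - p‖ ^ 2)) := by nlinarith
    exact le_of_mul_le_mul_left h6 ht0
  have hlim : Tendsto (fun t : ℝ => γ * ((φ v).toReal - (φ p).toReal) + t * (1 / 2 * ‖v - p‖ ^ 2))
      (𝓝[>] 0) (𝓝 (γ * ((φ v).toReal - (φ p).toReal) + 0 * (1 / 2 * ‖v - p‖ ^ 2))) := by
    refine Tendsto.mono_left (Continuous.tendsto ?_ 0) nhdsWithin_le_nhds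
    fun_prop
  have hfin := ge_of_tendsto hlim (by
    filter_upwards [Ioo_mem_nhdsGT (show (0 : ℝ) < 1 by norm_num)] with t ht using key t ht.1 ht.2)
  rw [inner_smul_right, real_inner_comm]
  rw [zero_mul, add_zero, ← inv_mul_le_iff₀ hγ] at hfin
  linarith

theorem prox_mem_subdifferential [CompleteSpace H] (hφ : Gamma0 φ) {γ : ℝ} (hγ : 0 < γ) (u : H) :
    γ⁻¹ • (u - prox (scale γ φ) u) ∈ subdifferential φ (prox (scale γ φ) u) :=
  IsProx.mem_subdifferential hφ hγ (Classical.epsilon_spec (exists_isProx hφ hγ u))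

end Convex

/-! ### Haugazeau's algorithm in a Hilbert space -/

section Haugazeau

variable {X : Type*} [NormedAddCommGroup X] [InnerProductSpace ℝ X]

open Classical in
/-- Haugazeau's update in a single Hilbert space. -/
noncomputable def haugazeauUpdate (x₀ x y : X) : X :=
  let χ : ℝ := inner ℝ (x₀ - x) (x - y)
  let μ : ℝ := ‖x₀ - x‖ ^ 2
  let ν : ℝ := ‖x - y‖ ^ 2
  let ρ := μ * ν - χ ^ 2
  if ρ = 0 ∧ 0 ≤ χ then y
  else if 0 < ρ ∧ ρ ≤ χ * ν then x₀ + (1 + χ / ν) • (y - x)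
  else if 0 < ρ ∧ χ * ν < ρ then x + (ν / ρ) • (χ • (x₀ - x) + μ • (y - x))
  else x

/-- If the two half-spaces have a common point, Haugazeau's update lies in the second one, moves
away from `x₀`, and every common point lies in the half-space it determines with `x₀`. -/
lemma haugazeauUpdate_spec {x₀ x y z₀ : X} (hz₁ : (inner ℝ (z₀ - x) (x₀ - x) : ℝ) ≤ 0)
    (hz₂ : (inner ℝ (z₀ - y) (x - y) : ℝ) ≤ 0) :
    (inner ℝ (haugazeauUpdate x₀ x y - y) (x - y) : ℝ) ≤ 0 ∧
    (inner ℝ (haugazeauUpdate x₀ x y - x) (x₀ - x) : ℝ) ≤ 0 ∧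
    ∀ z : X, (inner ℝ (z - x) (x₀ - x) : ℝ) ≤ 0 → (inner ℝ (z - y) (x - y) : ℝ) ≤ 0 →
      (inner ℝ (z - haugazeauUpdate x₀ x y) (x₀ - haugazeauUpdate x₀ x y) : ℝ) ≤ 0 := by
  obtain ⟨a, ha⟩ : ∃ a, a = x₀ - x := ⟨_, rfl⟩
  obtain ⟨b, hb⟩ : ∃ b, b = x - y := ⟨_, rfl⟩
  obtain ⟨x', hx'⟩ : ∃ x', x' = haugazeauUpdate x₀ x y := ⟨_, rfl⟩
  obtain ⟨δ, hδ⟩ : ∃ δ, δ = x' - x := ⟨_, rfl⟩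
  have e1 : x' - y = δ + b := by rw [hδ, hb]; abel
  have e2 : x₀ - x' = a - δ := by rw [hδ, ha]; abel
  have e3 : ∀ z, z - x' = (z - x) - δ := fun z => by rw [hδ]; abel
  have e4 : ∀ z, z - y = (z - x) + b := fun z => by rw [hb]; abel
  have e5 : y - x = -b := by rw [hb]; abel
  obtain ⟨χ, hχ⟩ : ∃ χ : ℝ, χ = inner ℝ a b := ⟨_, rfl⟩
  obtain ⟨μ, hμ⟩ : ∃ μ : ℝ, μ = ‖a‖ ^ 2 := ⟨_, rfl⟩
  obtain ⟨ν, hν⟩ : ∃ ν : ℝ, ν = ‖b‖ ^ 2 := ⟨_, rfl⟩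
  obtain ⟨ρ, hρ⟩ : ∃ ρ : ℝ, ρ = μ * ν - χ ^ 2 := ⟨_, rfl⟩
  have haa : (inner ℝ a a : ℝ) = μ := by rw [hμ, real_inner_self_eq_norm_sq]
  have hbb : (inner ℝ b b : ℝ) = ν := by rw [hν, real_inner_self_eq_norm_sq]
  have hab : (inner ℝ a b : ℝ) = χ := hχ.symm
  have hba : (inner ℝ b a : ℝ) = χ := by rw [real_inner_comm, hab]
  have hμ0 : 0 ≤ μ := by rw [hμ]; positivity
  have hν0 : 0 ≤ ν := by rw [hν]; positivity
  have hρ0 : 0 ≤ ρ := by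
    have h := real_inner_mul_inner_self_le a b
    rw [hab, haa, hbb] at h
    rw [hρ]; nlinarith
  have hform : x' = if ρ = 0 ∧ 0 ≤ χ then y
      else if 0 < ρ ∧ ρ ≤ χ * ν then x₀ + (1 + χ / ν) • (y - x)
      else if 0 < ρ ∧ χ * ν < ρ then x + (ν / ρ) • (χ • (x₀ - x) + μ • (y - x))
      else x := by
    rw [hx', hρ, hχ, hμ, hν, ha, hb]; rfl
  rw [← hx', e2, e1, ← hδ]
  simp only [← ha, ← hb] at hz₁ hz₂ ⊢
  simp only [e3, e4] at hz₂ ⊢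
  -- The number `ρ` is the Gram determinant of `a` and `b`, so this is the equality case of
  -- Cauchy-Schwarz.
  have hpar : ρ = 0 → ν ≠ 0 → a = (χ / ν) • b := by
    intro h0 hν1
    have : ‖a - (χ / ν) • b‖ ^ 2 = 0 := by
      rw [norm_sub_sq_real, inner_smul_right, norm_smul, mul_pow, ← hμ, ← hν, hab, Real.norm_eq_abs,
        sq_abs]
      field_simp
      nlinarith
    exact sub_eq_zero.mp (norm_eq_zero.mp (pow_eq_zero_iff two_ne_zero |>.mp this))
  rcases hρ0.eq_or_lt with h0 | h0
  · have hb0 : ν = 0 → b = 0 := fun h => by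
      rw [hν] at h; exact norm_eq_zero.mp (pow_eq_zero_iff two_ne_zero |>.mp h)
    -- This excludes the case for which the algorithm prescribes nothing: if `a` were a negative
    -- multiple of `b`, the common point would give both `⟨z₀ - x, b⟩ ≥ 0` and `⟨z₀ - x, b⟩ ≤ -ν <
    -- 0`.
    have hχ0 : 0 ≤ χ := by
      by_contra! hneg
      have hν1 : ν ≠ 0 := by
        intro h
        rw [hχ, hb0 h, inner_zero_right] at hneg
        exact lt_irrefl _ hneg
      have hνpos : 0 < ν := lt_of_le_of_ne hν0 (Ne.symm hν1)
      rw [hpar h0.symm hν1, inner_smul_right] at hz₁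
      rw [inner_add_left, hbb] at hz₂
      have : χ / ν < 0 := div_neg_of_neg_of_pos hneg hνpos
      nlinarith
    rw [if_pos ⟨h0.symm, hχ0⟩] at hform
    have hδb : δ = -b := by rw [hδ, hform, e5]
    rw [hδb]
    refine ⟨by simp, by rw [inner_neg_left, hba]; linarith, fun z h1 h2 => ?_⟩
    rw [sub_neg_eq_add, sub_neg_eq_add]
    by_cases hν1 : ν = 0
    · rw [hb0 hν1]; simpa using h1
    · have : (inner ℝ (z - x + b) (a + b) : ℝ) = (χ / ν + 1) * inner ℝ (z - x + b) b := by
        nth_rewrite 1 [hpar h0.symm hν1]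
        rw [inner_add_right, inner_smul_right]; ring
      rw [this]
      exact mul_nonpos_of_nonneg_of_nonpos (by positivity) h2
  · rw [if_neg (by intro h; exact h0.ne' h.1)] at hform
    rcases le_or_gt ρ (χ * ν) with hc | hc
    · rw [if_pos ⟨h0, hc⟩] at hform
      have hν1 : 0 < ν := lt_of_le_of_ne hν0 (by rintro h; rw [← h] at hc; linarith)
      have hχ0 : 0 < χ := by by_contra! h; nlinarith
      -- Here the update is the projection of `x₀` onto the second half-space alone; the case
      -- condition says that it already lies in the first.
      have hδb : δ = a - (1 + χ / ν) • b := by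
        rw [hδ, hform, e5, ha]; module
      rw [hδb]
      have hq : χ / ν * ν = χ := by field_simp
      refine ⟨?_, ?_, fun z h1 h2 => ?_⟩
      · rw [inner_add_left, inner_sub_left, inner_smul_left, hab, hbb]
        simp only [conj_trivial]
        nlinarith
      · rw [inner_sub_left, inner_smul_left, haa, hba]
        simp only [conj_trivial]
        have : χ * (χ / ν) = χ ^ 2 / ν := by ring
        have h3 : μ - χ - χ ^ 2 / ν ≤ 0 := by
          have : μ - χ - χ ^ 2 / ν = (ρ - χ * ν) / ν := by rw [hρ]; field_simp; ring
          rw [this]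
          exact div_nonpos_of_nonpos_of_nonneg (by linarith) hν1.le
        nlinarith
      · rw [sub_sub_cancel, inner_smul_right]
        refine mul_nonpos_of_nonneg_of_nonpos (by positivity) ?_
        rw [inner_add_left, hbb] at h2
        rw [inner_sub_left (z - x), inner_sub_left a, inner_smul_left, hab, hbb]
        simp only [conj_trivial]
        nlinarith
    · rw [if_neg (by intro h; linarith [h.2]), if_pos ⟨h0, hc⟩] at hform
      -- The combination of `a` and `b` with `⟨δ, a⟩ = 0` and `⟨δ, b⟩ = -ν`: both constraints are
      -- active, and the update lies on both bounding hyperplanes.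
      have hδb : δ = (ν / ρ) • (χ • a - μ • b) := by
        rw [hδ, hform, e5, ha]; module
      have hδa : (inner ℝ δ a : ℝ) = 0 := by
        rw [hδb, inner_smul_left, inner_sub_left, inner_smul_left, inner_smul_left, haa, hba]
        simp only [conj_trivial]; ring
      have hδbb : (inner ℝ δ b : ℝ) = -ν := by
        rw [hδb, inner_smul_left, inner_sub_left, inner_smul_left, inner_smul_left, hab, hbb]
        simp only [conj_trivial]
        have : χ * χ - μ * ν = -ρ := by rw [hρ]; ring
        rw [this]; field_simp
      have hδδ : (inner ℝ δ δ : ℝ) = ν / ρ * (μ * ν) := by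
        nth_rewrite 2 [hδb]
        rw [inner_smul_right, inner_sub_right, inner_smul_right, inner_smul_right, hδa, hδbb]
        ring
      refine ⟨by rw [inner_add_left, hδbb, hbb]; linarith, hδa.le, fun z h1 h2 => ?_⟩
      rw [inner_add_left, hbb] at h2
      have hwδ : (inner ℝ (z - x) δ : ℝ)
          = ν / ρ * (χ * inner ℝ (z - x) a - μ * inner ℝ (z - x) b) := by
        rw [hδb, inner_smul_right, inner_sub_right, inner_smul_right, inner_smul_right]
      have hp : 0 ≤ ν / ρ := by positivity
      have h3 : ν / ρ * (χ * inner ℝ (z - x) a + μ * ν) ≤ inner ℝ (z - x) δ := by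
        rw [hwδ]; refine mul_le_mul_of_nonneg_left ?_ hp; nlinarith
      have h4 : ν / ρ * χ < 1 := by
        rw [div_mul_eq_mul_div, div_lt_one h0]; linarith
      rw [inner_sub_left, inner_sub_right, inner_sub_right, hδa, hδδ]
      nlinarith

/-- Along an ultrafilter each bounded scalar sequence `⟨x n, v⟩` converges; the limits form a
bounded linear functional of `v`, which Riesz represents. Ultrafilters thus play the role of weakly
convergent subsequences. -/
lemma exists_weak_limit [CompleteSpace X] (𝒰 : Ultrafilter ℕ) {x : ℕ → X} {C : ℝ}
    (hC : ∀ n, ‖x n‖ ≤ C) :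
    ∃ x' : X, ∀ v, Tendsto (fun n => (inner ℝ (x n) v : ℝ)) 𝒰 (𝓝 (inner ℝ x' v)) := by
  have hbd : ∀ v n, (inner ℝ (x n) v : ℝ) ∈ Set.Icc (-(C * ‖v‖)) (C * ‖v‖) := fun v n =>
    abs_le.mp ((abs_real_inner_le_norm _ _).trans
      (mul_le_mul_of_nonneg_right (hC n) (norm_nonneg v)))
  have hex : ∀ v, ∃ l : ℝ, l ∈ Set.Icc (-(C * ‖v‖)) (C * ‖v‖) ∧
      Tendsto (fun n => (inner ℝ (x n) v : ℝ)) 𝒰 (𝓝 l) := by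
    intro v
    obtain ⟨l, hl, hlim⟩ := isCompact_Icc.ultrafilter_le_nhds
      (𝒰.map fun n => (inner ℝ (x n) v : ℝ))
      (le_principal_iff.mpr (mem_map.mpr (Eventually.of_forall (hbd v))))
    exact ⟨l, hl, hlim⟩
  choose l hl hlim using hex
  let ℓ : X →ₗ[ℝ] ℝ :=
    { toFun := l
      map_add' := fun v w => tendsto_nhds_unique (hlim (v + w)) (by
        simpa only [inner_add_right] using (hlim v).add (hlim w))
      map_smul' := fun c v => tendsto_nhds_unique (hlim (c • v)) (by
        simpa only [inner_smul_right, smul_eq_mul, RingHom.id_apply] using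
          (hlim v).const_mul c) }
  let ℓc : X →L[ℝ] ℝ := ℓ.mkContinuous C (fun v => abs_le.mpr (hl v))
  refine ⟨(InnerProductSpace.toDual ℝ X).symm ℓc, fun v => ?_⟩
  rw [InnerProductSpace.toDual_symm_apply]
  exact hlim v

/-- Strong convergence of Haugazeau's algorithm, when the weak cluster points of the iterates
belong to the target set. -/
theorem haugazeau_tendsto [CompleteSpace X] {Z : Set X} (hZ : Z.Nonempty) {x y : ℕ → X}
    (hy : ∀ n, ∀ z ∈ Z, (inner ℝ (z - y n) (x n - y n) : ℝ) ≤ 0)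
    (hstep : ∀ n, x (n + 1) = haugazeauUpdate (x 0) (x n) (y n))
    (hweak : Tendsto (fun n => ‖x n - y n‖) atTop (𝓝 0) → (∃ C, ∀ n, ‖x n‖ ≤ C) →
      ∀ 𝒰 : Ultrafilter ℕ, (𝒰 : Filter ℕ) ≤ atTop → ∀ x' : X,
      (∀ v, Tendsto (fun n => (inner ℝ (x n) v : ℝ)) 𝒰 (𝓝 (inner ℝ x' v))) → x' ∈ Z) :
    ∃ z ∈ Z, (∀ w ∈ Z, (inner ℝ (w - z) (x 0 - z) : ℝ) ≤ 0) ∧ Tendsto x atTop (𝓝 z) := by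
  obtain ⟨z₀, hz₀⟩ := hZ
  have hout : ∀ n, ∀ z ∈ Z, (inner ℝ (z - x n) (x 0 - x n) : ℝ) ≤ 0 := by
    intro n
    induction n with
    | zero => intro z _; simp
    | succ n ih =>
      intro z hz
      rw [hstep]
      exact (haugazeauUpdate_spec (ih z hz) (hy n z hz)).2.2 z (ih z hz) (hy n z hz)
  have hA : ∀ n, (inner ℝ (x (n + 1) - y n) (x n - y n) : ℝ) ≤ 0 := fun n => by
    rw [hstep]; exact (haugazeauUpdate_spec (hout n z₀ hz₀) (hy n z₀ hz₀)).1
  have hB : ∀ n, (inner ℝ (x (n + 1) - x n) (x 0 - x n) : ℝ) ≤ 0 := fun n => by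
    rw [hstep]; exact (haugazeauUpdate_spec (hout n z₀ hz₀) (hy n z₀ hz₀)).2.1
  have hdist : ∀ n, ∀ z ∈ Z, ‖x 0 - x n‖ ≤ ‖x 0 - z‖ := by
    intro n z hz
    have h := norm_sub_sq_real (x 0 - x n) (z - x n)
    rw [sub_sub_sub_cancel_right, real_inner_comm] at h
    have := hout n z hz
    refine pow_le_pow_left₀ (norm_nonneg _) (le_refl _) 2 |>.trans ?_ |> fun h' =>
      le_of_sq_le_sq h' (norm_nonneg _)
    nlinarith [sq_nonneg ‖z - x n‖]
  -- Since `x n` is the projection of `x 0` onto the half-space containing `x (n + 1)`, the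
  -- Pythagorean inequality holds. The squared distances to `x 0` are then increasing and bounded,
  -- so the increments tend to zero.
  have hincr : ∀ n, ‖x 0 - x n‖ ^ 2 + ‖x (n + 1) - x n‖ ^ 2 ≤ ‖x 0 - x (n + 1)‖ ^ 2 := by
    intro n
    have h := norm_sub_sq_real (x 0 - x n) (x (n + 1) - x n)
    rw [sub_sub_sub_cancel_right, real_inner_comm] at h
    have := hB n
    nlinarith
  have hmono : Monotone fun n => ‖x 0 - x n‖ ^ 2 :=
    monotone_nat_of_le_succ fun n => by nlinarith [hincr n, sq_nonneg ‖x (n + 1) - x n‖]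
  have hbddA : BddAbove (Set.range fun n => ‖x 0 - x n‖ ^ 2) := by
    refine ⟨‖x 0 - z₀‖ ^ 2, ?_⟩
    rintro _ ⟨n, rfl⟩
    exact pow_le_pow_left₀ (norm_nonneg _) (hdist n z₀ hz₀) 2
  obtain ⟨ℓ, hℓ⟩ : ∃ ℓ, Tendsto (fun n => ‖x 0 - x n‖ ^ 2) atTop (𝓝 ℓ) :=
    ⟨_, tendsto_atTop_ciSup hmono hbddA⟩
  have hres : Tendsto (fun n => ‖x n - y n‖) atTop (𝓝 0) := by
    have h1 : Tendsto (fun n => ‖x 0 - x (n + 1)‖ ^ 2 - ‖x 0 - x n‖ ^ 2) atTop (𝓝 0) := by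
      simpa using ((tendsto_add_atTop_iff_nat 1).mpr hℓ).sub hℓ
    have h2 : Tendsto (fun n => ‖x n - y n‖ ^ 2) atTop (𝓝 0) := by
      refine squeeze_zero (fun n => by positivity) (fun n => ?_) h1
      have h := norm_sub_sq_real (x (n + 1) - y n) (x n - y n)
      rw [sub_sub_sub_cancel_right] at h
      nlinarith [hA n, hincr n, sq_nonneg ‖x (n + 1) - y n‖]
    have h3 := h2.sqrt
    simpa [Real.sqrt_sq] using h3
  have hbdd : ∃ C, ∀ n, ‖x n‖ ≤ C := by
    refine ⟨‖x 0‖ + ‖x 0 - z₀‖, fun n => ?_⟩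
    have : x n = x 0 - (x 0 - x n) := by abel
    rw [this]
    exact (norm_sub_le _ _).trans (by gcongr; exact hdist n z₀ hz₀)
  have hcl : ∀ 𝒰 : Ultrafilter ℕ, (𝒰 : Filter ℕ) ≤ atTop →
      ∃ z ∈ Z, (∀ w ∈ Z, (inner ℝ (w - z) (x 0 - z) : ℝ) ≤ 0) ∧ Tendsto x 𝒰 (𝓝 z) := by
    intro 𝒰 h𝒰
    obtain ⟨C, hC⟩ := hbdd
    obtain ⟨z, hz⟩ := exists_weak_limit 𝒰 hC
    have hzZ := hweak hres ⟨C, hC⟩ 𝒰 h𝒰 z hz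
    -- As `z` is in `Z`, `‖x 0 - x n‖ ≤ ‖x 0 - z‖`. Expanding `‖x n - z‖ ^ 2` about `x 0` bounds it
    -- by an expression affine in `x n`, which tends to zero by weak convergence.
    have hstrong : Tendsto x 𝒰 (𝓝 z) := by
      have h1 : Tendsto (fun n => ‖x n - z‖ ^ 2) 𝒰 (𝓝 0) := by
        have h2 : Tendsto (fun n => 2 * (‖x 0 - z‖ ^ 2 - inner ℝ (x n) (z - x 0)
            + inner ℝ z (z - x 0) - ‖x 0 - z‖ ^ 2)) 𝒰 (𝓝 0) := by
          have := ((((hz (z - x 0)).const_sub (‖x 0 - z‖ ^ 2)).add_const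
            (inner ℝ z (z - x 0))).sub_const (‖x 0 - z‖ ^ 2)).const_mul 2
          simpa using this
        refine squeeze_zero (fun n => by positivity) (fun n => ?_) h2
        have h3 : x n - z = (x 0 - z) - (x 0 - x n) := by abel
        have h4 := norm_sub_sq_real (x 0 - z) (x 0 - x n)
        have h5 : ‖x 0 - x n‖ ^ 2 ≤ ‖x 0 - z‖ ^ 2 :=
          pow_le_pow_left₀ (norm_nonneg _) (hdist n z hzZ) 2
        have h6 : (inner ℝ (x 0 - z) (x 0 - x n) : ℝ)
            = ‖x 0 - z‖ ^ 2 + inner ℝ (x n) (z - x 0) - inner ℝ z (z - x 0) := by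
          rw [show x 0 - x n = (x 0 - z) - (x n - z) by abel, inner_sub_right,
            real_inner_self_eq_norm_sq, ← inner_neg_neg (x 0 - z) (x n - z), neg_sub,
            inner_neg_right, real_inner_comm, inner_sub_left]
          ring
        rw [h3, h4, h6]
        nlinarith
      have h2 := h1.sqrt
      rw [tendsto_iff_norm_sub_tendsto_zero]
      simpa [Real.sqrt_sq] using h2
    refine ⟨z, hzZ, fun w hw => ?_, hstrong⟩
    refine le_of_tendsto ((tendsto_const_nhds.sub hstrong).inner (tendsto_const_nhds.sub hstrong))
      (Eventually.of_forall fun n => hout n w hw)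
  obtain ⟨z, hzZ, hzw, -⟩ := hcl (Ultrafilter.of atTop) (Ultrafilter.of_le _)
  refine ⟨z, hzZ, hzw, ?_⟩
  -- Every ultrafilter finer than `atTop` has a strong limit in `Z` satisfying the variational
  -- inequality. Adding the inequalities of two such limits shows that they coincide, so the whole
  -- sequence converges.
  rw [tendsto_iff_ultrafilter]
  intro 𝒰 h𝒰
  obtain ⟨z', hz'Z, hz'w, hlim⟩ := hcl 𝒰 h𝒰
  have : z' = z := by
    have h1 := hzw z' hz'Z
    have h2 := hz'w z hzZ
    have h3 : (inner ℝ (z' - z) (z' - z) : ℝ)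
        = inner ℝ (z' - z) (x 0 - z) + inner ℝ (z - z') (x 0 - z') := by
      rw [← neg_sub z' z, inner_neg_left, ← sub_eq_add_neg, ← inner_sub_right]
      congr 1; abel
    have h4 : (inner ℝ (z' - z) (z' - z) : ℝ) ≤ 0 := by linarith
    rw [real_inner_self_eq_norm_sq] at h4
    exact sub_eq_zero.mp (norm_eq_zero.mp
      (pow_eq_zero_iff two_ne_zero |>.mp (le_antisymm h4 (sq_nonneg _))))
  exact this ▸ hlim

end Haugazeau

/-! ### The primal-dual cut and convergence for monotone operators -/

section PrimalDualStep

variable {U G : Type*} [NormedAddCommGroup U] [InnerProductSpace ℝ U] [CompleteSpace U]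
  [NormedAddCommGroup G] [InnerProductSpace ℝ G] [CompleteSpace G]

/-- The Kuhn-Tucker set of the inclusion `0 ∈ A u + L* B (L u)`. -/
def operatorKuhnTucker (A : U → Set U) (B : G → Set G) (L : U →L[ℝ] G) : Set (WithLp 2 (U × G)) :=
  {z | -(L.adjoint z.snd) ∈ A z.fst ∧ z.snd ∈ B (L z.fst)}

variable {A : U → Set U} {B : G → Set G} {L : U →L[ℝ] G}

/-- The sum of the two monotonicity inequalities between the computed graph points and those of `z`;
the terms coupling primal and dual variables cancel through the adjoint. The result is the
separating half-space used by the half-step. -/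
lemma le_inner_of_mem_operatorKuhnTucker
    (hA : ∀ p a p' a', a ∈ A p → a' ∈ A p' → 0 ≤ (inner ℝ (p - p') (a - a') : ℝ))
    (hB : ∀ p a p' a', a ∈ B p → a' ∈ B p' → 0 ≤ (inner ℝ (p - p') (a - a') : ℝ))
    {u p : U} {g q : G} {c d : ℝ} (hp : c • (u - p) - L.adjoint g ∈ A p)
    (hq : g + d • (L u - q) ∈ B q) {z : WithLp 2 (U × G)} (hz : z ∈ operatorKuhnTucker A B L) :
    c * ‖u - p‖ ^ 2 + d * ‖L u - q‖ ^ 2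
      ≤ inner ℝ (u - z.fst) (c • (u - p) + d • L.adjoint (L u - q))
        + inner ℝ (g - z.snd) (q - L p) := by
  have h1 := hA _ _ _ _ hp hz.1
  have h2 := hB _ _ _ _ hq hz.2
  simp only [inner_sub_left, inner_sub_right, inner_add_right, inner_smul_right,
    ContinuousLinearMap.adjoint_inner_right, map_sub, inner_neg_right,
    ← real_inner_self_eq_norm_sq] at h1 h2 ⊢
  simp only [real_inner_comm u p, real_inner_comm (L u) q, real_inner_comm z.snd q,
    real_inner_comm z.snd (L p), real_inner_comm g q, real_inner_comm g (L p)] at h1 h2 ⊢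
  linear_combination h1 + h2

/-- The normal vector of the cut is linear in `u - p` and `L u - q`, with coefficients at most `1 /
ε` and `‖L‖`, while the gap dominates `ε` times their squared norms. This prevents the steps from
being small while the gap is large. -/
lemma norm_step_sq_le {u p : U} {q : G} {c d ε : ℝ} (hε : 0 < ε) (hc : c ∈ Set.Icc ε (1 / ε))
    (hd : d ∈ Set.Icc ε (1 / ε)) :
    ‖c • (u - p) + d • L.adjoint (L u - q)‖ ^ 2 + ‖q - L p‖ ^ 2 ≤
      ((2 * (1 / ε) ^ 2 + 2) * (1 + ‖L‖ ^ 2) / ε) *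
        (c * ‖u - p‖ ^ 2 + d * ‖L u - q‖ ^ 2) := by
  have hc0 : 0 ≤ c := hε.le.trans hc.1
  have hd0 : 0 ≤ d := hε.le.trans hd.1
  set a := ‖u - p‖ with ha
  set b := ‖L u - q‖ with hb
  have ha0 : 0 ≤ a := norm_nonneg _
  have hb0 : 0 ≤ b := norm_nonneg _
  set l := ‖L‖ with hl
  have hl0 : 0 ≤ l := norm_nonneg _
  set k := 1 / ε with hk
  have hk0 : 0 ≤ k := by positivity
  have h1 : ‖c • (u - p) + d • L.adjoint (L u - q)‖ ≤ k * a + k * (l * b) := by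
    refine (norm_add_le _ _).trans ?_
    rw [norm_smul, norm_smul, Real.norm_of_nonneg hc0, Real.norm_of_nonneg hd0]
    have h : ‖L.adjoint (L u - q)‖ ≤ l * b := by
      have := L.adjoint.le_opNorm (L u - q)
      rwa [LinearIsometryEquiv.norm_map] at this
    gcongr
    · exact hc.2
    · exact hd.2
  have h2 : ‖q - L p‖ ≤ b + l * a := by
    have : q - L p = L (u - p) - (L u - q) := by rw [map_sub]; abel
    rw [this, add_comm]
    exact (norm_sub_le _ _).trans (by gcongr; exact L.le_opNorm _)
  have h3 : ‖c • (u - p) + d • L.adjoint (L u - q)‖ ^ 2 ≤ (k * a + k * (l * b)) ^ 2 := by gcongr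
  have h4 : ‖q - L p‖ ^ 2 ≤ (b + l * a) ^ 2 := by gcongr
  have h5 : ε * (a ^ 2 + b ^ 2) ≤ c * a ^ 2 + d * b ^ 2 := by
    have := mul_le_mul_of_nonneg_right hc.1 (sq_nonneg a)
    have := mul_le_mul_of_nonneg_right hd.1 (sq_nonneg b)
    nlinarith
  have h6 : a ^ 2 + b ^ 2 ≤ (c * a ^ 2 + d * b ^ 2) / ε := by
    rw [le_div_iff₀ hε]; linarith
  have h7 : (k * a + k * (l * b)) ^ 2 + (b + l * a) ^ 2
      ≤ (2 * k ^ 2 + 2) * (1 + l ^ 2) * (a ^ 2 + b ^ 2) := by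
    have e1 : (a + l * b) ^ 2 ≤ (1 + l ^ 2) * (a ^ 2 + b ^ 2) := by nlinarith [sq_nonneg (l * a - b)]
    have e2 : (b + l * a) ^ 2 ≤ (1 + l ^ 2) * (a ^ 2 + b ^ 2) := by nlinarith [sq_nonneg (l * b - a)]
    have e3 : k ^ 2 * (a + l * b) ^ 2 ≤ k ^ 2 * ((1 + l ^ 2) * (a ^ 2 + b ^ 2)) := by gcongr
    have e4 : 0 ≤ (1 + l ^ 2) * (a ^ 2 + b ^ 2) := by positivity
    have e5 : 0 ≤ k ^ 2 * ((1 + l ^ 2) * (a ^ 2 + b ^ 2)) := by positivity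
    nlinarith
  calc _ ≤ (2 * k ^ 2 + 2) * (1 + l ^ 2) * (a ^ 2 + b ^ 2) := by linarith
    _ ≤ (2 * k ^ 2 + 2) * (1 + l ^ 2) * ((c * a ^ 2 + d * b ^ 2) / ε) := by gcongr
    _ = _ := by ring

lemma tendsto_inner_zero {V : Type*} [NormedAddCommGroup V] [InnerProductSpace ℝ V] {f : Filter ℕ}
    {w r : ℕ → V} {C : ℝ} (hw : ∀ n, ‖w n‖ ≤ C) (hr : Tendsto (fun n => ‖r n‖) f (𝓝 0)) :
    Tendsto (fun n => (inner ℝ (w n) (r n) : ℝ)) f (𝓝 0) := by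
  refine squeeze_zero_norm (a := fun n => C * ‖r n‖) (fun n => ?_) (by simpa using hr.const_mul C)
  exact (norm_inner_le_norm _ _).trans (mul_le_mul_of_nonneg_right (hw n) (norm_nonneg _))

lemma tendsto_inner_const_zero {V : Type*} [NormedAddCommGroup V] [InnerProductSpace ℝ V]
    {f : Filter ℕ} (v : V) {r : ℕ → V} (hr : Tendsto (fun n => ‖r n‖) f (𝓝 0)) :
    Tendsto (fun n => (inner ℝ v (r n) : ℝ)) f (𝓝 0) :=
  tendsto_inner_zero (fun _ => le_rfl) hr

/-- Demiclosedness of the Kuhn-Tucker operator. -/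
lemma mem_operatorKuhnTucker_of_weak_limit
    (hA : ∀ p a p' a', a ∈ A p → a' ∈ A p' → 0 ≤ (inner ℝ (p - p') (a - a') : ℝ))
    (hB : ∀ p a p' a', a ∈ B p → a' ∈ B p' → 0 ≤ (inner ℝ (p - p') (a - a') : ℝ))
    (hA' : ∀ x, ∃ p, x - p ∈ A p) (hB' : ∀ x, ∃ p, x - p ∈ B p)
    {f : Filter ℕ} [f.NeBot] {p a : ℕ → U} {q b : ℕ → G}
    (hp : ∀ n, a n ∈ A (p n)) (hq : ∀ n, b n ∈ B (q n)) {u : U} {g : G}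
    (hpu : ∀ v, Tendsto (fun n => (inner ℝ (p n) v : ℝ)) f (𝓝 (inner ℝ u v)))
    (hbg : ∀ v, Tendsto (fun n => (inner ℝ (b n) v : ℝ)) f (𝓝 (inner ℝ g v)))
    (hs : Tendsto (fun n => ‖a n + L.adjoint (b n)‖) f (𝓝 0))
    (ht : Tendsto (fun n => ‖q n - L (p n)‖) f (𝓝 0))
    {C : ℝ} (hpC : ∀ n, ‖p n‖ ≤ C) (hbC : ∀ n, ‖b n‖ ≤ C) :
    WithLp.toLp 2 (u, g) ∈ operatorKuhnTucker A B L := by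
  -- Minty's trick: with these resolvent points as test elements, the limiting inequality reads `0 ≤
  -- -‖u - p'‖ ^ 2 - ‖L u - q'‖ ^ 2`.
  obtain ⟨p', hp'⟩ := hA' (u - L.adjoint g)
  obtain ⟨q', hq'⟩ := hB' (L u + g)
  set a' := u - L.adjoint g - p'
  set b' := L u + g - q'
  set s : ℕ → U := fun n => a n + L.adjoint (b n) with hsdef
  set t : ℕ → G := fun n => q n - L (p n) with htdef
  -- Written with `s` and `t`, the sum `⟨p, a⟩ + ⟨q, b⟩` becomes `⟨p, s⟩ + ⟨b, t⟩`, since `⟨p, L*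
  -- b⟩` and `⟨L p, b⟩` cancel. No product of two merely weakly convergent sequences is left.
  have lims : Tendsto (fun n => (inner ℝ (p n) (s n) : ℝ) + inner ℝ (b n) (t n)
      - inner ℝ (p n) a' - (inner ℝ p' (s n) - inner ℝ (b n) (L p')) + inner ℝ p' a'
      - (inner ℝ (p n) (L.adjoint b') + inner ℝ b' (t n)) - inner ℝ (b n) q' + inner ℝ q' b') f
      (𝓝 (0 + 0 - inner ℝ u a' - (0 - inner ℝ g (L p')) + inner ℝ p' a'
        - (inner ℝ u (L.adjoint b') + 0) - inner ℝ g q' + inner ℝ q' b')) :=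
    ((((((tendsto_inner_zero hpC hs).add (tendsto_inner_zero hbC ht)).sub (hpu a')).sub
      ((tendsto_inner_const_zero p' hs).sub (hbg (L p')))).add_const _).sub
      ((hpu (L.adjoint b')).add (tendsto_inner_const_zero b' ht))).sub (hbg q') |>.add_const _
  have hge := ge_of_tendsto lims (Eventually.of_forall fun n => show (0 : ℝ) ≤ _ by
    have h1 := hA _ _ _ _ (hp n) hp'
    have h2 := hB _ _ _ _ (hq n) hq'
    have e1 : a n = s n - L.adjoint (b n) := by simp [hsdef]
    have e2 : q n = t n + L (p n) := by simp [htdef]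
    rw [e1] at h1
    rw [e2] at h2
    simp only [inner_sub_left, inner_sub_right, inner_add_left,
      ContinuousLinearMap.adjoint_inner_right, map_sub] at h1 h2 ⊢
    simp only [real_inner_comm (b n)] at h1 h2 ⊢
    linarith [real_inner_comm (t n) b'])
  have hsum : ‖u - p'‖ ^ 2 + ‖L u - q'‖ ^ 2 ≤ 0 := by
    simp only [a', b', inner_sub_left, inner_sub_right, inner_add_right,
      ContinuousLinearMap.adjoint_inner_right, map_sub, map_add,
      ← real_inner_self_eq_norm_sq] at hge ⊢
    linarith [real_inner_comm g (L p'), real_inner_comm g q', real_inner_comm u p',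
      real_inner_comm (L u) q', real_inner_comm g (L u)]
  have h1 : u - p' = 0 := by
    rw [← norm_eq_zero, ← pow_eq_zero_iff two_ne_zero]
    nlinarith [sq_nonneg ‖u - p'‖, sq_nonneg ‖L u - q'‖]
  have h2 : L u - q' = 0 := by
    rw [← norm_eq_zero, ← pow_eq_zero_iff two_ne_zero]
    nlinarith [sq_nonneg ‖u - p'‖, sq_nonneg ‖L u - q'‖]
  have h3 : p' = u := (sub_eq_zero.mp h1).symm
  have h4 : q' = L u := (sub_eq_zero.mp h2).symm
  constructor
  · have : a' = -(L.adjoint g) := by simp [a', h3]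
    change -(L.adjoint g) ∈ A u
    rw [← this, ← h3]; exact hp'
  · have : b' = g := by simp [b', h4]
    change g ∈ B (L u)
    rw [← this, ← h4]; exact hq'

/-- Strong convergence of the best approximation primal-dual algorithm for `0 ∈ A u + L* B (L u)`,
where `A` and `B` are maximally monotone. -/
theorem primalDual_tendsto
    (hA : ∀ p a p' a', a ∈ A p → a' ∈ A p' → 0 ≤ (inner ℝ (p - p') (a - a') : ℝ))
    (hB : ∀ p a p' a', a ∈ B p → a' ∈ B p' → 0 ≤ (inner ℝ (p - p') (a - a') : ℝ))
    (hA' : ∀ x, ∃ p, x - p ∈ A p) (hB' : ∀ x, ∃ p, x - p ∈ B p)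
    (hZ : (operatorKuhnTucker A B L).Nonempty) {ε : ℝ} (hε : 0 < ε) {c d lam : ℕ → ℝ}
    (hc : ∀ n, c n ∈ Set.Icc ε (1 / ε)) (hd : ∀ n, d n ∈ Set.Icc ε (1 / ε))
    (hlam : ∀ n, lam n ∈ Set.Icc ε 1) {x r : ℕ → WithLp 2 (U × G)} {p : ℕ → U} {q : ℕ → G}
    {θ : ℕ → ℝ}
    (hp : ∀ n, c n • ((x n).fst - p n) - L.adjoint (x n).snd ∈ A (p n))
    (hq : ∀ n, (x n).snd + d n • (L (x n).fst - q n) ∈ B (q n))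
    (hr : ∀ n, r n = WithLp.toLp 2 (c n • ((x n).fst - p n) + d n • L.adjoint (L (x n).fst - q n),
      q n - L (p n)))
    (hθ : ∀ n, θ n = if ‖r n‖ ^ 2 = 0 then 0 else
      lam n * (c n * ‖(x n).fst - p n‖ ^ 2 + d n * ‖L (x n).fst - q n‖ ^ 2) / ‖r n‖ ^ 2)
    (hstep : ∀ n, x (n + 1) = haugazeauUpdate (x 0) (x n) (x n - θ n • r n)) :
    ∃ z ∈ operatorKuhnTucker A B L,
      (∀ w ∈ operatorKuhnTucker A B L, (inner ℝ (w - z) (x 0 - z) : ℝ) ≤ 0) ∧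
      Tendsto x atTop (𝓝 z) := by
  set Δ : ℕ → ℝ := fun n => c n * ‖(x n).fst - p n‖ ^ 2 + d n * ‖L (x n).fst - q n‖ ^ 2 with hΔ
  have hc0 : ∀ n, 0 < c n := fun n => hε.trans_le (hc n).1
  have hd0 : ∀ n, 0 < d n := fun n => hε.trans_le (hd n).1
  have hΔ0 : ∀ n, 0 ≤ Δ n := fun n => by
    have := hc0 n
    have := hd0 n
    positivity
  have hcut : ∀ n, ∀ z ∈ operatorKuhnTucker A B L, Δ n ≤ inner ℝ (x n - z) (r n) := by
    intro n z hz
    have h := le_inner_of_mem_operatorKuhnTucker hA hB (hp n) (hq n) hz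
    rw [hr n, WithLp.prod_inner_apply]
    exact h
  set K := (2 * (1 / ε) ^ 2 + 2) * (1 + ‖L‖ ^ 2) / ε with hK
  have hK0 : 0 < K := by positivity
  have hrK : ∀ n, ‖r n‖ ^ 2 ≤ K * Δ n := by
    intro n
    have h := norm_step_sq_le (L := L) (u := (x n).fst) (p := p n) (q := q n) hε (hc n) (hd n)
    rw [hr n, WithLp.prod_norm_sq_eq_of_L2]
    exact h
  -- When `r n ≠ 0`, the squared step is `lam ^ 2 * Δ ^ 2 / ‖r‖ ^ 2`, and `‖r‖ ^ 2 ≤ K * Δ`, `ε ≤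
  -- lam`. When `r n = 0`, the default `θ n = 0` is harmless: the cut at any solution gives `Δ n ≤
  -- 0`.
  have hΔle : ∀ n, Δ n ≤ K / ε ^ 2 * ‖θ n • r n‖ ^ 2 := by
    intro n
    rw [norm_smul, mul_pow, Real.norm_eq_abs, sq_abs]
    by_cases h0 : ‖r n‖ ^ 2 = 0
    · obtain ⟨z, hz⟩ := hZ
      have h1 := hcut n z hz
      rw [norm_eq_zero.mp (pow_eq_zero_iff two_ne_zero |>.mp h0), inner_zero_right] at h1
      exact h1.trans (by positivity)
    · have hpos : 0 < ‖r n‖ ^ 2 := lt_of_le_of_ne (sq_nonneg _) (Ne.symm h0)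
      have h1 := hrK n
      have hΔpos : 0 < Δ n := by by_contra! h; nlinarith
      rw [hθ n, if_neg h0]
      change Δ n ≤ K / ε ^ 2 * ((lam n * Δ n / ‖r n‖ ^ 2) ^ 2 * ‖r n‖ ^ 2)
      have e : K / ε ^ 2 * ((lam n * Δ n / ‖r n‖ ^ 2) ^ 2 * ‖r n‖ ^ 2)
          = (lam n / ε) ^ 2 * (K * Δ n / ‖r n‖ ^ 2) * Δ n := by field_simp
      rw [e]
      have h2 : 1 ≤ (lam n / ε) ^ 2 := one_le_pow₀ (by rw [one_le_div hε]; exact (hlam n).1)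
      have h3 : 1 ≤ K * Δ n / ‖r n‖ ^ 2 := by rw [one_le_div hpos]; exact h1
      have h4 : 1 ≤ (lam n / ε) ^ 2 * (K * Δ n / ‖r n‖ ^ 2) := one_le_mul_of_one_le_of_one_le h2 h3
      nlinarith
  refine haugazeau_tendsto hZ (y := fun n => x n - θ n • r n) ?_ hstep ?_
  · intro n z hz
    change (inner ℝ (z - (x n - θ n • r n)) (x n - (x n - θ n • r n)) : ℝ) ≤ 0
    rw [sub_sub_cancel, show z - (x n - θ n • r n) = θ n • r n - (x n - z) by abel,
      inner_smul_right, inner_sub_left, inner_smul_left, real_inner_self_eq_norm_sq]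
    simp only [conj_trivial]
    have h1 := hcut n z hz
    have hθ0 : 0 ≤ θ n := by
      rw [hθ n]; split_ifs
      · exact le_rfl
      · have := (hε.trans_le (hlam n).1)
        have := hΔ0 n
        simp only [hΔ] at this
        positivity
    refine mul_nonpos_of_nonneg_of_nonpos hθ0 ?_
    by_cases h0 : ‖r n‖ ^ 2 = 0
    · rw [h0]; linarith [hΔ0 n]
    -- The upper bound `lam n ≤ 1` enters here: an under-relaxed step does not cross the cut, so the
    -- half-space it defines still contains every solution.
    · have h2 : θ n * ‖r n‖ ^ 2 = lam n * Δ n := by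
        rw [hθ n, if_neg h0, div_mul_cancel₀ _ h0]
      rw [h2]
      nlinarith [(hlam n).2, hΔ0 n]
  · rintro hres ⟨C, hC⟩ 𝒰 h𝒰 x' hx'
    have hres' : Tendsto (fun n => ‖θ n • r n‖) atTop (𝓝 0) := by simpa using hres
    have hΔlim : Tendsto Δ atTop (𝓝 0) :=
      squeeze_zero hΔ0 hΔle (by simpa using (hres'.pow 2).const_mul (K / ε ^ 2))
    have sqlim : ∀ (w : ℕ → ℝ) (k : ℝ), (∀ n, 0 ≤ w n) → (∀ n, w n ^ 2 ≤ k * Δ n) →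
        Tendsto w atTop (𝓝 0) := by
      intro w k hw h
      have h1 : Tendsto (fun n => w n ^ 2) atTop (𝓝 0) :=
        squeeze_zero (fun n => sq_nonneg _) h (by simpa using hΔlim.const_mul k)
      simpa [Real.sqrt_sq, hw] using h1.sqrt
    have hup : Tendsto (fun n => ‖(x n).fst - p n‖) atTop (𝓝 0) := by
      refine sqlim _ (1 / ε) (fun n => norm_nonneg _) (fun n => ?_)
      rw [one_div_mul_eq_div, le_div_iff₀ hε]
      have h1 := mul_le_mul_of_nonneg_right (hc n).1 (sq_nonneg ‖(x n).fst - p n‖)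
      have h2 := mul_nonneg (hd0 n).le (sq_nonneg ‖L (x n).fst - q n‖)
      simp only [hΔ]; nlinarith
    have hlq : Tendsto (fun n => ‖L (x n).fst - q n‖) atTop (𝓝 0) := by
      refine sqlim _ (1 / ε) (fun n => norm_nonneg _) (fun n => ?_)
      rw [one_div_mul_eq_div, le_div_iff₀ hε]
      have h1 := mul_le_mul_of_nonneg_right (hd n).1 (sq_nonneg ‖L (x n).fst - q n‖)
      have h2 := mul_nonneg (hc0 n).le (sq_nonneg ‖(x n).fst - p n‖)
      simp only [hΔ]; nlinarith
    have hrlim : Tendsto (fun n => ‖r n‖) atTop (𝓝 0) :=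
      sqlim _ K (fun n => norm_nonneg _) hrK
    have hdlq : Tendsto (fun n => ‖d n • (L (x n).fst - q n)‖) atTop (𝓝 0) := by
      refine squeeze_zero (fun n => norm_nonneg _) (fun n => ?_)
        (by simpa only [mul_zero] using hlq.const_mul (1 / ε))
      rw [norm_smul, Real.norm_of_nonneg (hd0 n).le]
      exact mul_le_mul_of_nonneg_right (hd n).2 (norm_nonneg _)
    obtain ⟨C₁, hC₁⟩ := hup.bddAbove_range
    obtain ⟨C₂, hC₂⟩ := hdlq.bddAbove_range
    have hfst : ∀ n, ‖(x n).fst‖ ≤ C := fun n => (WithLp.norm_fst_le _ _).trans (hC n)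
    have hsnd : ∀ n, ‖(x n).snd‖ ≤ C := fun n => (WithLp.norm_snd_le _ _).trans (hC n)
    have hpC : ∀ n, ‖p n‖ ≤ max (C + C₁) (C + C₂) := fun n => by
      refine le_max_of_le_left ?_
      rw [show p n = (x n).fst - ((x n).fst - p n) by abel]
      exact (norm_sub_le _ _).trans (add_le_add (hfst n) (hC₁ ⟨n, rfl⟩))
    have hbC : ∀ n, ‖(x n).snd + d n • (L (x n).fst - q n)‖ ≤ max (C + C₁) (C + C₂) := fun n =>
      le_max_of_le_right ((norm_add_le _ _).trans (add_le_add (hsnd n) (hC₂ ⟨n, rfl⟩)))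
    have hmem := mem_operatorKuhnTucker_of_weak_limit (L := L) (f := (𝒰 : Filter ℕ))
      (u := x'.fst) (g := x'.snd) hA hB hA' hB' hp hq ?_ ?_ ?_ ?_ hpC hbC
    · exact hmem
    · intro v
      have h1 := hx' (WithLp.toLp 2 (v, 0))
      simp only [WithLp.prod_inner_apply, inner_zero_right, add_zero] at h1
      have h2 := h1.sub (tendsto_inner_const_zero v (hup.mono_left h𝒰))
      rw [sub_zero] at h2
      refine h2.congr fun n => ?_
      change (inner ℝ (x n).fst v : ℝ) - _ = _
      rw [inner_sub_right, real_inner_comm v, real_inner_comm v (p n)]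
      exact sub_sub_cancel _ _
    · intro v
      have h1 := hx' (WithLp.toLp 2 (0, v))
      simp only [WithLp.prod_inner_apply, inner_zero_right, zero_add] at h1
      have h2 := h1.add (tendsto_inner_const_zero v (hdlq.mono_left h𝒰))
      rw [add_zero] at h2
      refine h2.congr fun n => ?_
      change (inner ℝ (x n).snd v : ℝ) + _ = _
      rw [inner_add_left, real_inner_comm v (d n • _)]
    · refine squeeze_zero (fun n => norm_nonneg _) (fun n => ?_) (hrlim.mono_left h𝒰)
      have : c n • ((x n).fst - p n) - L.adjoint (x n).snd
          + L.adjoint ((x n).snd + d n • (L (x n).fst - q n)) = (r n).fst := by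
        rw [hr n, map_add, map_smul]
        change _ = c n • ((x n).fst - p n) + d n • L.adjoint (L (x n).fst - q n)
        abel
      rw [this]
      exact WithLp.norm_fst_le _ _
    · refine squeeze_zero (fun n => norm_nonneg _) (fun n => ?_) (hrlim.mono_left h𝒰)
      have : q n - L (p n) = (r n).snd := by rw [hr n]; rfl
      rw [this]
      exact WithLp.norm_snd_le _ _

end PrimalDualStep

/-! ### Completeness of `H¹` and uniqueness of weak gradients -/

section Sobolev

variable {N : ℕ} {D : Set (E N)}

lemma continuous_gradient {φ : E N → ℝ} (hφ : ContDiff ℝ ∞ φ) : Continuous (gradient φ) :=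
  (InnerProductSpace.toDual ℝ (E N)).symm.continuous.comp (hφ.continuous_fderiv (by simp))

lemma hasCompactSupport_gradient {φ : E N → ℝ} (hc : HasCompactSupport φ) :
    HasCompactSupport (gradient φ) :=
  (hc.fderiv (𝕜 := ℝ)).comp_left (g := (InnerProductSpace.toDual ℝ (E N)).symm) (map_zero _)

/-- In this scalar form each side is the pairing of `u` or `G` with a fixed `L²` function, so the
condition is visibly closed. -/
lemma isWeakGradient_iff (u : L2 D) (G : L2vec D) :
    IsWeakGradient D u G ↔ ∀ φ : E N → ℝ, ContDiff ℝ ∞ φ → HasCompactSupport φ → tsupport φ ⊆ D →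
      ∀ c : E N, ∫ x in D, u x * inner ℝ c (gradient φ x) = - ∫ x in D, φ x * inner ℝ c (G x) := by
  have key : ∀ φ : E N → ℝ, ContDiff ℝ ∞ φ → HasCompactSupport φ → ∀ c : E N,
      (inner ℝ c (∫ x in D, u x • gradient φ x) : ℝ) = ∫ x in D, u x * inner ℝ c (gradient φ x) ∧
      (inner ℝ c (∫ x in D, φ x • G x) : ℝ) = ∫ x in D, φ x * inner ℝ c (G x) := by
    intro φ hφ hc c
    rw [← integral_inner (integrable_smul_gradient u hφ hc),
      ← integral_inner (integrable_smul_field G hφ hc)]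
    simp only [inner_smul_right, and_self]
  constructor
  · intro h φ hφ hc hs c
    rw [← (key φ hφ hc c).1, ← (key φ hφ hc c).2, h φ hφ hc hs, inner_neg_right]
  · intro h φ hφ hc hs
    refine ext_inner_left ℝ fun c => ?_
    rw [inner_neg_right, (key φ hφ hc c).1, (key φ hφ hc c).2]
    exact h φ hφ hc hs c

lemma isClosed_H1 : IsClosed (H1 D : Set (WithLp 2 (L2 D × L2vec D))) := by
  have hset : (H1 D : Set (WithLp 2 (L2 D × L2vec D))) = ⋂ (φ : E N → ℝ) (_ : ContDiff ℝ ∞ φ)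
      (_ : HasCompactSupport φ) (_ : tsupport φ ⊆ D) (c : E N),
      {w | ∫ x in D, w.fst x * inner ℝ c (gradient φ x)
        = - ∫ x in D, φ x * inner ℝ c (w.snd x)} := by
    ext w
    simp only [Set.mem_iInter, Set.mem_ofPred_eq]
    exact isWeakGradient_iff w.fst w.snd
  rw [hset]
  refine isClosed_iInter fun φ => isClosed_iInter fun hφ => isClosed_iInter fun hc =>
    isClosed_iInter fun _ => isClosed_iInter fun c => ?_
  have m1 : MemLp (fun x => (inner ℝ c (gradient φ x) : ℝ)) 2 (volume.restrict D) :=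
    (continuous_const.inner (continuous_gradient hφ)).memLp_of_hasCompactSupport
      ((hasCompactSupport_gradient hc).comp_left (inner_zero_right c))
  have m2 : MemLp (fun x => φ x • c) 2 (volume.restrict D) :=
    (hφ.continuous.smul continuous_const).memLp_of_hasCompactSupport hc.smul_right
  have e1 : ∀ w : WithLp 2 (L2 D × L2vec D), ∫ x in D, w.fst x * inner ℝ c (gradient φ x)
      = inner ℝ (m1.toLp _) w.fst := by
    intro w
    rw [L2.inner_def]
    refine integral_congr_ae ?_
    filter_upwards [m1.coeFn_toLp] with x hx
    rw [hx]; simp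
  have e2 : ∀ w : WithLp 2 (L2 D × L2vec D), ∫ x in D, φ x * inner ℝ c (w.snd x)
      = inner ℝ (m2.toLp _) w.snd := by
    intro w
    rw [L2.inner_def]
    refine integral_congr_ae ?_
    filter_upwards [m2.coeFn_toLp] with x hx
    rw [hx, inner_smul_left]; simp
  simp only [e1, e2]
  refine isClosed_eq ?_ ?_
  · exact continuous_const.inner (WithLp.fstL 2 ℝ (L2 D) (L2vec D)).continuous
  · exact (continuous_const.inner (WithLp.sndL 2 ℝ (L2 D) (L2vec D)).continuous).neg

instance : CompleteSpace (H1 D) := isClosed_H1.completeSpace_coe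

/-- The weak gradient is unique. -/
lemma weakGradient_unique (hD : IsOpen D) {w w' : H1 D}
    (h : w.1.fst =ᵐ[volume.restrict D] w'.1.fst) : w = w' := by
  obtain ⟨z, hz⟩ : ∃ z, z = w - w' := ⟨_, rfl⟩
  have hz1 : z.1.fst = 0 := by
    rw [hz]; exact sub_eq_zero.mpr (Lp.ext h)
  have hloc : LocallyIntegrableOn (z.1.snd : E N → E N) D volume :=
    locallyIntegrableOn_of_locallyIntegrable_restrict <|
      (Lp.memLp z.1.snd).locallyIntegrable (by norm_num)
  have hae := hD.ae_eq_zero_of_integral_contDiff_smul_eq_zero hloc fun φ hφ hc hs => by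
    have h1 := z.2 φ hφ hc hs
    have h2 : ∫ x in D, z.1.fst x • gradient φ x = 0 := by
      refine integral_eq_zero_of_ae ?_
      rw [hz1]
      filter_upwards [Lp.coeFn_zero ℝ 2 (volume.restrict D)] with x hx
      rw [hx]; simp
    rw [h2, zero_eq_neg] at h1
    rw [← h1, setIntegral_eq_integral_of_forall_compl_eq_zero]
    intro x hx
    rw [image_eq_zero_of_notMem_tsupport (fun h => hx (hs h)), zero_smul]
  have hz2 : z.1.snd = 0 := by
    refine Lp.ext ?_
    filter_upwards [(ae_restrict_iff' hD.measurableSet).mpr hae,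
      Lp.coeFn_zero (E N) 2 (volume.restrict D)] with x h1 h2
    rw [h1, h2]; rfl
  have : z = 0 := Subtype.ext (WithLp.ofLp_injective 2 (Prod.ext hz1 hz2))
  rw [hz] at this
  exact sub_eq_zero.mp this

lemma memLp_of_continuousOn_closure (hD : IsOpen D) (hb : Bornology.IsBounded D) {F : Type*}
    [NormedAddCommGroup F] {f : E N → F} (hf : ContinuousOn f (closure D)) :
    MemLp f 2 (volume.restrict D) := by
  obtain ⟨C, hC⟩ := hb.isCompact_closure.exists_bound_of_continuousOn hf
  have : IsFiniteMeasure (volume.restrict D) := ⟨by simpa using hb.measure_lt_top⟩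
  exact MemLp.of_bound ((hf.mono subset_closure).aestronglyMeasurable hD.measurableSet) C
    ((ae_restrict_iff' hD.measurableSet).mpr
      (Eventually.of_forall fun x hx => hC x (subset_closure hx)))

/-- Multiplication by `φ` or its gradient, supported in a compact subset of `D`, makes the
integrands continuous on the whole space. Integration by parts there needs the differentiability of
`v` only on the support of `φ`, hence no regularity of the boundary. -/
lemma isWeakGradient_of_hasGradientAt (hD : IsOpen D) {v : E N → ℝ} {G : E N → E N}
    (hv : ∀ x ∈ D, HasGradientAt v (G x) x) (hG : ContinuousOn G D) :
    IsWeakGradient D v G := by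
  intro φ hφ hc hs
  have hvc : ContinuousOn v D := fun x hx => (hv x hx).continuousAt.continuousWithinAt
  have hcont : ∀ {F : Type} [NormedAddCommGroup F] [NormedSpace ℝ F] (a : E N → ℝ) (b : E N → F),
      Continuous a → tsupport a ⊆ tsupport φ → ContinuousOn b D →
      Continuous (fun x => a x • b x) := by
    intro F _ _ a b ha hsa hb
    refine continuous_iff_continuousAt.mpr fun x => ?_
    by_cases hx : x ∈ D
    · exact ha.continuousAt.smul (hb.continuousAt (hD.mem_nhds hx))
    · have : (fun x => a x • b x) =ᶠ[𝓝 x] fun _ => 0 := by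
        filter_upwards [(isClosed_tsupport a).isOpen_compl.mem_nhds
          (fun h => hx (hs (hsa h)))] with y hy
        rw [image_eq_zero_of_notMem_tsupport hy, zero_smul]
      exact continuousAt_const.congr this.symm
  have hsg : tsupport (gradient φ) ⊆ tsupport φ :=
    closure_minimal (fun x hx => by
      by_contra h
      refine hx ?_
      have : φ =ᶠ[𝓝 x] fun _ => 0 := by
        filter_upwards [(isClosed_tsupport φ).isOpen_compl.mem_nhds h] with y hy
        exact image_eq_zero_of_notMem_tsupport hy
      rw [this.gradient_eq]
      exact gradient_fun_const x 0) (isClosed_tsupport φ)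
  have hg0 : ∀ x ∉ D, gradient φ x = 0 := fun x hx =>
    image_eq_zero_of_notMem_tsupport fun h => hx (hs (hsg h))
  have hφ0 : ∀ x ∉ D, φ x = 0 := fun x hx =>
    image_eq_zero_of_notMem_tsupport fun h => hx (hs h)
  have i1 : Integrable (fun x => v x • gradient φ x) := by
    have hcc : Continuous fun x => v x • gradient φ x := by
      refine continuous_iff_continuousAt.mpr fun x => ?_
      by_cases hx : x ∈ D
      · exact (hvc.continuousAt (hD.mem_nhds hx)).smul (continuous_gradient hφ).continuousAt
      · have : (fun x => v x • gradient φ x) =ᶠ[𝓝 x] fun _ => 0 := by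
          filter_upwards [(isClosed_tsupport (gradient φ)).isOpen_compl.mem_nhds
            (fun h => hx (hs (hsg h)))] with y hy
          rw [image_eq_zero_of_notMem_tsupport hy, smul_zero]
        exact continuousAt_const.congr this.symm
    have hs' : HasCompactSupport (v • gradient φ) :=
      HasCompactSupport.smul_left (hasCompactSupport_gradient hc)
    exact hcc.integrable_of_hasCompactSupport hs'
  have i2 : Integrable (fun x => φ x • G x) :=
    (hcont φ G hφ.continuous subset_rfl hG).integrable_of_hasCompactSupport
      (show HasCompactSupport (φ • G) from HasCompactSupport.smul_right hc)
  have i3 : Integrable (fun x => v x * φ x) := by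
    refine ((hcont φ v hφ.continuous subset_rfl hvc).integrable_of_hasCompactSupport
      (show HasCompactSupport (φ • v) from HasCompactSupport.smul_right hc)).congr
      (Eventually.of_forall fun x => ?_)
    exact mul_comm _ _
  rw [setIntegral_eq_integral_of_forall_compl_eq_zero (fun x hx => by rw [hg0 x hx, smul_zero]),
    setIntegral_eq_integral_of_forall_compl_eq_zero (fun x hx => by rw [hφ0 x hx, zero_smul])]
  refine ext_inner_left ℝ fun c => ?_
  rw [inner_neg_right, ← integral_inner i1, ← integral_inner i2]
  have h := integral_bilinear_hasFDerivAt_right_eq_neg_left_of_integrable (μ := volume)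
    (B := ContinuousLinearMap.mul ℝ ℝ) (f := v) (g := φ) (v := c)
    (f' := fun x => InnerProductSpace.toDual ℝ (E N) (G x)) (g' := fderiv ℝ φ) ?_ ?_ i3
    (fun x hx => (hv x (hs hx)).hasFDerivAt)
    (fun x _ => (hφ.differentiable (by simp) x).hasFDerivAt)
  · simp only [ContinuousLinearMap.mul_apply', InnerProductSpace.toDual_apply_apply] at h
    simp only [inner_smul_right]
    rw [show (fun x => v x * (inner ℝ c (gradient φ x) : ℝ)) = fun x => v x * fderiv ℝ φ x c by
      funext x; rw [real_inner_comm, inner_gradient_left], h]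
    congr 1
    refine integral_congr_ae (Eventually.of_forall fun x => ?_)
    change inner ℝ (G x) c * φ x = φ x * inner ℝ c (G x)
    rw [real_inner_comm, mul_comm]
  · refine (i2.const_inner c).congr (Eventually.of_forall fun x => ?_)
    change inner ℝ c (φ x • G x) = inner ℝ (G x) c * φ x
    rw [inner_smul_right, real_inner_comm, mul_comm]
  · refine (i1.const_inner c).congr (Eventually.of_forall fun x => ?_)
    change inner ℝ c (v x • gradient φ x) = v x * fderiv ℝ φ x c
    rw [inner_smul_right, real_inner_comm, inner_gradient_left]

end Sobolev

/-! ### Averages of translates, by Fubini and continuity of translation in `L²` -/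

section Averaging

variable {N : ℕ} {V : Type*} [NormedAddCommGroup V] [InnerProductSpace ℝ V]

/-- The shear `(y, h) ↦ (y, y - h)` preserves the product measure and reduces the claim to the
product of `‖g‖` and `‖f‖` in separate variables. -/
lemma integrable_inner_shift {f g : E N → V} (hf : Integrable f) (hg : Integrable g) :
    Integrable (fun p : E N × E N => (inner ℝ (f (p.1 - p.2)) (g p.1) : ℝ))
      (volume.prod volume) := by
  have hmp : MeasurePreserving (fun p : E N × E N => (p.1, p.1 - p.2))
      (volume.prod volume) (volume.prod volume) :=
    (MeasurePreserving.id volume).skew_product (g := fun y h => y - h)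
      (measurable_fst.sub measurable_snd)
      (Eventually.of_forall fun y => Measure.map_sub_left_eq_self volume y)
  have h1 : Integrable (fun p : E N × E N => ‖g p.1‖ * ‖f p.2‖) (volume.prod volume) :=
    hg.norm.mul_prod hf.norm
  have h2 := hmp.integrable_comp_of_integrable h1
  refine h2.mono ?_ (Eventually.of_forall fun p => ?_)
  · have hf' : AEStronglyMeasurable (fun p : E N × E N => f p.2) (volume.prod volume) :=
      hf.1.comp_snd
    have hg' : AEStronglyMeasurable (fun p : E N × E N => g p.1) (volume.prod volume) :=
      hg.1.comp_fst
    exact (hf'.comp_measurePreserving hmp).inner hg'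
  · have := norm_inner_le_norm (𝕜 := ℝ) (f (p.1 - p.2)) (g p.1)
    simp only [Function.comp_apply, norm_mul, norm_norm]
    linarith

lemma integral_inner_average [CompleteSpace V] {f g : E N → V} (hf : Integrable f)
    (hg : Integrable g) {k : E N → ℝ} (hk : Continuous k) (hc : HasCompactSupport k) :
    Integrable (fun h => k h * ∫ y, (inner ℝ (f (y - h)) (g y) : ℝ)) ∧
    ∫ y, (inner ℝ (∫ h, k h • f (y - h)) (g y) : ℝ)
      = ∫ h, k h * ∫ y, (inner ℝ (f (y - h)) (g y) : ℝ) := by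
  obtain ⟨C, hC⟩ := hc.exists_bound_of_continuous hk
  have h1 : Integrable (fun p : E N × E N => k p.2 * (inner ℝ (f (p.1 - p.2)) (g p.1) : ℝ))
      (volume.prod volume) :=
    (integrable_inner_shift hf hg).bdd_mul (c := C)
      (hk.comp continuous_snd).aestronglyMeasurable (Eventually.of_forall fun p => hC p.2)
  have h2 : ∀ y, (inner ℝ (∫ h, k h • f (y - h)) (g y) : ℝ)
      = ∫ h, k h * (inner ℝ (f (y - h)) (g y) : ℝ) := by
    intro y
    have hi : Integrable (fun h => k h • f (y - h)) :=
      (hf.comp_sub_left y).bdd_smul C hk.aestronglyMeasurable (Eventually.of_forall hC)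
    rw [real_inner_comm, ← integral_inner hi]
    refine integral_congr_ae (Eventually.of_forall fun h => ?_)
    change inner ℝ (g y) (k h • f (y - h)) = _
    rw [inner_smul_right, real_inner_comm]
  constructor
  · refine h1.integral_prod_right.congr (Eventually.of_forall fun h => ?_)
    exact integral_const_mul (k h) _
  · simp only [h2]
    rw [integral_integral_swap h1]
    refine integral_congr_ae (Eventually.of_forall fun h => ?_)
    exact integral_const_mul (k h) _

/-- Translation acts continuously on `L²`. Only this weak form of convergence is needed, because
density is proved through orthogonal complements. -/
lemma tendsto_inner_shift {f g : E N → V} (hf : MemLp f 2) (hg : MemLp g 2) :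
    Tendsto (fun h => ∫ y, (inner ℝ (f (y - h)) (g y) : ℝ)) (𝓝 0)
      (𝓝 (∫ y, (inner ℝ (f y) (g y) : ℝ))) := by
  have hmp : ∀ h : E N, MeasurePreserving (fun y => y - h) (volume : Measure (E N)) volume :=
    fun h => measurePreserving_sub_right volume h
  let τ : C(E N, C(E N, E N)) :=
    (ContinuousMap.mk (fun p : E N × E N => p.2 - p.1) (by fun_prop)).curry
  have hτ : ∀ h, MeasurePreserving (τ h) (volume : Measure (E N)) volume := hmp
  have hcont : Continuous fun h => Lp.compMeasurePreserving (τ h) (hτ h) (hf.toLp f) :=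
    Continuous.compMeasurePreservingLp continuous_const τ.continuous hτ (by norm_num)
  have heq : ∀ h, (inner ℝ (Lp.compMeasurePreserving (τ h) (hτ h) (hf.toLp f)) (hg.toLp g) : ℝ)
      = ∫ y, (inner ℝ (f (y - h)) (g y) : ℝ) := by
    intro h
    rw [L2.inner_def]
    refine integral_congr_ae ?_
    filter_upwards [Lp.coeFn_compMeasurePreserving (hf.toLp f) (hτ h), hg.coeFn_toLp,
      (hτ h).quasiMeasurePreserving.ae_eq_comp hf.coeFn_toLp] with y h1 h2 h3
    rw [h1, h2, h3]
    rfl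
  have h0 := (Continuous.inner (𝕜 := ℝ) hcont (continuous_const (y := hg.toLp g))).tendsto (0 : E N)
  simp only [heq, sub_zero] at h0
  exact h0

end Averaging

/-! ### The space `C¹(D̄)` inside `H¹(D)` and localization by cutoffs -/

section C1

variable {N : ℕ} {D : Set (E N)}

/-- The space `C¹(D̄)`. -/
def C1Space (D : Set (E N)) : Submodule ℝ (E N → ℝ) where
  carrier := {v | C1Closure D v}
  zero_mem' := ⟨continuousOn_const, 0, continuousOn_const, fun x _ => hasGradientAt_const x 0⟩
  add_mem' := by
    rintro v w ⟨hv, G, hG, hvG⟩ ⟨hw, G', hG', hwG⟩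
    refine ⟨hv.add hw, G + G', hG.add hG', fun x hx => ?_⟩
    rw [hasGradientAt_iff_hasFDerivAt, Pi.add_apply, map_add]
    exact (hvG x hx).hasFDerivAt.add (hwG x hx).hasFDerivAt
  smul_mem' := by
    rintro c v ⟨hv, G, hG, hvG⟩
    refine ⟨hv.const_smul c, c • G, hG.const_smul c, fun x hx => ?_⟩
    rw [hasGradientAt_iff_hasFDerivAt, Pi.smul_apply, map_smul]
    exact (hvG x hx).hasFDerivAt.const_smul c

lemma C1Closure.memLp (hD : IsOpen D) (hb : Bornology.IsBounded D) {v : E N → ℝ}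
    (hv : C1Closure D v) : MemLp v 2 (volume.restrict D) :=
  memLp_of_continuousOn_closure hD hb hv.1

lemma C1Closure.memLp_gradient (hD : IsOpen D) (hb : Bornology.IsBounded D) {v : E N → ℝ}
    (hv : C1Closure D v) : MemLp (gradient v) 2 (volume.restrict D) := by
  obtain ⟨-, G, hG, hvG⟩ := hv
  refine (memLp_of_continuousOn_closure hD hb hG).ae_eq ?_
  filter_upwards [ae_restrict_mem hD.measurableSet] with x hx
  exact (hvG x hx).gradient.symm

lemma IsWeakGradient.congr {u u' : E N → ℝ} {G G' : E N → E N} (h : IsWeakGradient D u G)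
    (hu : u =ᵐ[volume.restrict D] u') (hG : G =ᵐ[volume.restrict D] G') :
    IsWeakGradient D u' G' := by
  intro φ hφ hc hs
  have h1 : ∫ x in D, u' x • gradient φ x = ∫ x in D, u x • gradient φ x :=
    integral_congr_ae (by filter_upwards [hu] with x hx; rw [hx])
  have h2 : ∫ x in D, φ x • G' x = ∫ x in D, φ x • G x :=
    integral_congr_ae (by filter_upwards [hG] with x hx; rw [hx])
  rw [h1, h2, h φ hφ hc hs]

lemma C1Closure.isWeakGradient (hD : IsOpen D) {v : E N → ℝ} (hv : C1Closure D v) :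
    IsWeakGradient D v (gradient v) := by
  obtain ⟨-, G, hG, hvG⟩ := hv
  refine (isWeakGradient_of_hasGradientAt hD hvG (hG.mono subset_closure)).congr
    (ae_eq_refl v) ?_
  filter_upwards [ae_restrict_mem hD.measurableSet] with x hx
  exact (hvG x hx).gradient.symm

/-- The inclusion of `C¹(D̄)` in `H¹(D)`. -/
noncomputable def C1Space.toH1 (hD : IsOpen D) (hb : Bornology.IsBounded D) : C1Space D →ₗ[ℝ] H1 D where
  toFun v := ⟨WithLp.toLp 2 ((C1Closure.memLp hD hb v.2).toLp v.1,
      (C1Closure.memLp_gradient hD hb v.2).toLp (gradient v.1)),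
    (C1Closure.isWeakGradient hD v.2).congr (C1Closure.memLp hD hb v.2).coeFn_toLp.symm
      (C1Closure.memLp_gradient hD hb v.2).coeFn_toLp.symm⟩
  map_add' v w := by
    refine weakGradient_unique hD ?_
    refine (C1Closure.memLp hD hb (v + w).2).coeFn_toLp.trans ?_
    refine EventuallyEq.trans ?_ (Lp.coeFn_add _ _).symm
    exact ((C1Closure.memLp hD hb v.2).coeFn_toLp.add (C1Closure.memLp hD hb w.2).coeFn_toLp).symm
  map_smul' c v := by
    refine weakGradient_unique hD ?_
    refine (C1Closure.memLp hD hb (c • v).2).coeFn_toLp.trans ?_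
    refine EventuallyEq.trans ?_ (Lp.coeFn_smul _ _).symm
    exact ((C1Closure.memLp hD hb v.2).coeFn_toLp.const_smul c).symm

lemma C1Space.toH1_fst (hD : IsOpen D) (hb : Bornology.IsBounded D) (v : C1Space D) :
    (C1Space.toH1 hD hb v).1.fst =ᵐ[volume.restrict D] v.1 :=
  (C1Closure.memLp hD hb v.2).coeFn_toLp

lemma C1Space.toH1_snd (hD : IsOpen D) (hb : Bornology.IsBounded D) (v : C1Space D) :
    (C1Space.toH1 hD hb v).1.snd =ᵐ[volume.restrict D] gradient v.1 :=
  (C1Closure.memLp_gradient hD hb v.2).coeFn_toLp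

lemma ContDiff.c1Closure {v : E N → ℝ} (hv : ContDiff ℝ ∞ v) : C1Closure D v :=
  ⟨hv.continuous.continuousOn, gradient v, (continuous_gradient hv).continuousOn,
    fun x _ => (hv.differentiable (by simp) x).hasGradientAt⟩

lemma gradient_mul {φ χ : E N → ℝ} {x : E N} (hφ : DifferentiableAt ℝ φ x)
    (hχ : DifferentiableAt ℝ χ x) :
    gradient (fun y => φ y * χ y) x = φ x • gradient χ x + χ x • gradient φ x := by
  refine HasGradientAt.gradient ?_
  rw [hasGradientAt_iff_hasFDerivAt, map_add, map_smul, map_smul, toDual_gradient, toDual_gradient]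
  exact hφ.hasFDerivAt.mul hχ.hasFDerivAt

/-- The product of a function in `H¹(D)` with a test function. -/
lemma H1.exists_mul {χ : E N → ℝ} (hχ : ContDiff ℝ ∞ χ) (hχc : HasCompactSupport χ) (w : H1 D) :
    ∃ w' : H1 D, w'.1.fst =ᵐ[volume.restrict D] (fun x => χ x * w.1.fst x) ∧
      w'.1.snd =ᵐ[volume.restrict D]
        fun x => χ x • w.1.snd x + w.1.fst x • gradient χ x := by
  have hχt : MemLp χ ⊤ (volume.restrict D) := hχ.continuous.memLp_of_hasCompactSupport hχc
  have hgt : MemLp (gradient χ) ⊤ (volume.restrict D) :=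
    (continuous_gradient hχ).memLp_of_hasCompactSupport (hasCompactSupport_gradient hχc)
  have m1 : MemLp (fun x => χ x * w.1.fst x) 2 (volume.restrict D) :=
    (Lp.memLp w.1.fst).mul hχt
  have m2 : MemLp (fun x => χ x • w.1.snd x) 2 (volume.restrict D) :=
    (Lp.memLp w.1.snd).smul hχt
  have m3 : MemLp (fun x => w.1.fst x • gradient χ x) 2 (volume.restrict D) :=
    hgt.smul (Lp.memLp w.1.fst)
  refine ⟨⟨WithLp.toLp 2 (m1.toLp _, (m2.add m3).toLp _), ?_⟩, m1.coeFn_toLp,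
    (m2.add m3).coeFn_toLp⟩
  refine IsWeakGradient.congr ?_ m1.coeFn_toLp.symm (m2.add m3).coeFn_toLp.symm
  intro φ hφ hc hs
  -- Testing the weak gradient of `w` with `φ * χ` and expanding the gradient of this product gives
  -- the product rule for `χ * w`.
  have h := w.2 (fun x => φ x * χ x) (hφ.mul hχ) hc.mul_right ((tsupport_mul_subset_left).trans hs)
  have hφt : MemLp φ 2 (volume.restrict D) := hφ.continuous.memLp_of_hasCompactSupport hc
  have hgφ : MemLp (gradient φ) 2 (volume.restrict D) :=
    (continuous_gradient hφ).memLp_of_hasCompactSupport (hasCompactSupport_gradient hc)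
  have i1 : Integrable (fun x => (χ x * w.1.fst x) • gradient φ x) (volume.restrict D) :=
    memLp_one_iff_integrable.mp (hgφ.smul m1)
  have i2 : Integrable (fun x => φ x • (χ x • w.1.snd x)) (volume.restrict D) :=
    memLp_one_iff_integrable.mp (m2.smul hφt)
  have i3 : Integrable (fun x => φ x • (w.1.fst x • gradient χ x)) (volume.restrict D) :=
    memLp_one_iff_integrable.mp (m3.smul hφt)
  have e1 : ∫ x in D, w.1.fst x • gradient (fun x => φ x * χ x) x
      = (∫ x in D, φ x • (w.1.fst x • gradient χ x))
        + ∫ x in D, (χ x * w.1.fst x) • gradient φ x := by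
    rw [← integral_add i3 i1]
    refine integral_congr_ae (Eventually.of_forall fun x => ?_)
    change w.1.fst x • gradient (fun x => φ x * χ x) x = _
    rw [gradient_mul (hφ.differentiable (by simp) x) (hχ.differentiable (by simp) x)]
    module
  have e2 : ∫ x in D, (φ x * χ x) • w.1.snd x = ∫ x in D, φ x • (χ x • w.1.snd x) := by
    simp only [mul_smul]
  have e3 : ∫ x in D, φ x • ((fun x => χ x • w.1.snd x) + fun x => w.1.fst x • gradient χ x) x
      = (∫ x in D, φ x • (χ x • w.1.snd x)) + ∫ x in D, φ x • (w.1.fst x • gradient χ x) := by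
    rw [← integral_add i2 i3]
    simp only [Pi.add_apply, smul_add]
  rw [e3, ← e2]
  rw [e1] at h
  rw [eq_sub_of_add_eq' h]
  abel

end C1

/-! ### Directional mollification at the boundary -/

section Density

variable {N : ℕ} {D : Set (E N)}

lemma gradient_eq_zero_of_notMem_tsupport {φ : E N → ℝ} {x : E N} (h : x ∉ tsupport φ) :
    gradient φ x = 0 := by
  have : φ =ᶠ[𝓝 x] fun _ => 0 := by
    filter_upwards [(isClosed_tsupport φ).isOpen_compl.mem_nhds h] with y hy
    exact image_eq_zero_of_notMem_tsupport hy
  rw [this.gradient_eq]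
  exact gradient_fun_const x 0

/-- The mollification of the extension by zero of a function in `H¹(D)`. -/
lemma gradient_mollify {f : E N → ℝ} {F : E N → E N} (hf : Integrable f) (hF : Integrable F)
    {k : E N → ℝ} (hk : ContDiff ℝ ∞ k) (hc : HasCompactSupport k) {y : E N}
    (hweak : ∀ c : E N, ∫ z, f z * inner ℝ c (gradient (fun z => k (y - z)) z)
      = - ∫ z, k (y - z) * inner ℝ c (F z)) :
    gradient (fun y => ∫ h, k h • f (y - h)) y = ∫ h, k h • F (y - h) := by
  have hv : (fun y => ∫ h, k h • f (y - h))
      = convolution f k (ContinuousLinearMap.mul ℝ ℝ) volume := by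
    funext y
    rw [convolution_def, ← integral_sub_left_eq_self _ volume y]
    refine integral_congr_ae (Eventually.of_forall fun h => ?_)
    change k (y - h) * f (y - (y - h)) = f h * k (y - h)
    rw [sub_sub_cancel, mul_comm]
  have hd := hc.hasFDerivAt_convolution_right (ContinuousLinearMap.mul ℝ ℝ)
    hf.locallyIntegrable (hk.of_le (by simp)) y
  rw [← hv] at hd
  obtain ⟨C, hC⟩ := hc.exists_bound_of_continuous hk.continuous
  have hi : Integrable (fun z => k (y - z) • F z) :=
    hF.bdd_smul C (hk.continuous.comp (continuous_const.sub continuous_id)).aestronglyMeasurable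
      (Eventually.of_forall fun z => hC _)
  refine ext_inner_left ℝ fun c => ?_
  have e1 : ∫ h, k h • F (y - h) = ∫ z, k (y - z) • F z := by
    rw [← integral_sub_left_eq_self _ volume y]
    simp only [sub_sub_cancel]
  rw [real_inner_comm, inner_gradient_left, hd.fderiv, e1, ← integral_inner hi,
    convolution_precompR_apply _ hf.locallyIntegrable (hc.fderiv (𝕜 := ℝ))
      (hk.continuous_fderiv (by simp)), convolution_def]
  simp only [inner_smul_right]
  rw [← neg_neg (∫ z, k (y - z) * (inner ℝ c (F z) : ℝ)), ← hweak c, ← integral_neg]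
  refine integral_congr_ae (Eventually.of_forall fun z => ?_)
  have e2 : HasFDerivAt (fun z => k (y - z)) (-(fderiv ℝ k (y - z))) z := by
    have := (hk.differentiable (by simp) (y - z)).hasFDerivAt.comp z
      ((hasFDerivAt_const y z).sub (hasFDerivAt_id z))
    refine this.congr_fderiv ?_
    ext c
    simp
  change f z * fderiv ℝ k (y - z) c = - (f z * inner ℝ c (gradient (fun z => k (y - z)) z))
  rw [real_inner_comm, inner_gradient_left, e2.fderiv]
  simp

lemma setIntegral_inner_eq {V : Type*} [NormedAddCommGroup V] [InnerProductSpace ℝ V]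
    (hD : MeasurableSet D) {a a' g : E N → V} (h : a =ᵐ[volume.restrict D] a') :
    ∫ y in D, (inner ℝ (a y) (g y) : ℝ) = ∫ y, (inner ℝ (a' y) (D.indicator g y) : ℝ) := by
  rw [← setIntegral_eq_integral_of_forall_compl_eq_zero (s := D)
    (f := fun y => (inner ℝ (a' y) (D.indicator g y) : ℝ))
    (fun y hy => by rw [Set.indicator_of_notMem hy, inner_zero_right])]
  refine integral_congr_ae ?_
  filter_upwards [h, ae_restrict_mem hD] with y h1 h2
  rw [h1, Set.indicator_of_mem h2]

lemma H1.inner_eq_integral (w z : H1 D) :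
    (inner ℝ w z : ℝ) = (∫ y in D, (inner ℝ (w.1.fst y) (z.1.fst y) : ℝ))
      + ∫ y in D, (inner ℝ (w.1.snd y) (z.1.snd y) : ℝ) := by
  rw [← L2.inner_def, ← L2.inner_def]
  rfl

lemma C1Space.inner_toH1 (hD : IsOpen D) (hb : Bornology.IsBounded D) (v : C1Space D)
    {F : E N → E N} (hF : gradient v.1 =ᵐ[volume.restrict D] F) (z : H1 D) :
    (inner ℝ (C1Space.toH1 hD hb v) z : ℝ)
      = (∫ y, (inner ℝ (v.1 y) (D.indicator z.1.fst y) : ℝ))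
        + ∫ y, (inner ℝ (F y) (D.indicator z.1.snd y) : ℝ) := by
  rw [H1.inner_eq_integral, setIntegral_inner_eq hD.measurableSet (C1Space.toH1_fst hD hb v),
    setIntegral_inner_eq hD.measurableSet ((C1Space.toH1_snd hD hb v).trans hF)]

/-- Near the boundary a centered mollifier would see the jump of the extension by zero. A kernel
centered at `-(t • e)` instead samples `f` in a ball around `y + t • e`, inside `D` by the cone
condition, so the mollification is smooth and its gradient on `D` is the mollification of `F`. The
hypothesis `hz` makes the average of the translated pairings vanish, and these pairings tend to the
wanted one as `t` tends to `0`. -/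
lemma integral_inner_eq_zero_of_interior_cone {x e : E N}
    {r c t₀ : ℝ} (hc : 0 < c) (ht₀ : 0 < t₀)
    (hcone : ∀ y ∈ D, y ∈ Metric.ball x r → ∀ t, 0 < t → t < t₀ →
      Metric.closedBall (y + t • e) (c * t) ⊆ D)
    {S : Set (E N)} (hS : IsCompact S) (hSx : S ⊆ Metric.ball x r)
    {f g : E N → ℝ} {F G : E N → E N} (f2 : MemLp f 2) (F2 : MemLp F 2) (g2 : MemLp g 2)
    (G2 : MemLp G 2) (f1 : Integrable f) (F1 : Integrable F) (g1 : Integrable g)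
    (G1 : Integrable G)
    (hweak : ∀ φ : E N → ℝ, ContDiff ℝ ∞ φ → HasCompactSupport φ →
      (tsupport φ ⊆ D ∨ Disjoint (tsupport φ) S) → ∀ c : E N,
      ∫ y, f y * inner ℝ c (gradient φ y) = - ∫ y, φ y * inner ℝ c (F y))
    (hz : ∀ (v : E N → ℝ) (F' : E N → E N), ContDiff ℝ ∞ v → (∀ y ∈ D, gradient v y = F' y) →
      (∫ y, (inner ℝ (v y) (g y) : ℝ)) + ∫ y, (inner ℝ (F' y) (G y) : ℝ) = 0) :
    (∫ y, (inner ℝ (f y) (g y) : ℝ)) + ∫ y, (inner ℝ (F y) (G y) : ℝ) = 0 := by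
  obtain ⟨A, hAdef⟩ : ∃ A : ℝ, A = (∫ y, (inner ℝ (f y) (g y) : ℝ))
    + ∫ y, (inner ℝ (F y) (G y) : ℝ) := ⟨_, rfl⟩
  rw [← hAdef]
  obtain ⟨β, hβ⟩ : ∃ β : E N → ℝ, β = fun h => (∫ y, (inner ℝ (f (y - h)) (g y) : ℝ))
    + ∫ y, (inner ℝ (F (y - h)) (G y) : ℝ) := ⟨_, rfl⟩
  have hβlim : Tendsto β (𝓝 0) (𝓝 A) := by
    rw [hβ, hAdef]
    exact (tendsto_inner_shift f2 g2).add (tendsto_inner_shift F2 G2)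
  obtain ⟨δ, hδ, hδS⟩ := hS.exists_thickening_subset_open Metric.isOpen_ball hSx
  have hec : 0 < ‖e‖ + c := by positivity
  rw [← abs_nonpos_iff]
  refine le_of_forall_pos_le_add fun ε hε => ?_
  obtain ⟨η, hη, hball⟩ := Metric.eventually_nhds_iff.mp
    (hβlim.eventually (Metric.closedBall_mem_nhds _ hε))
  -- The kernel lives in the ball of radius `(‖e‖ + c) * t` about `0`. Below `δ`, points outside the
  -- ball about `x` never sample `S`; below `η`, the pairings differ from `A` by at most `ε`.
  obtain ⟨t, ht0, ht⟩ : ∃ t, 0 < t ∧ t < min t₀ (min δ η / (‖e‖ + c)) :=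
    exists_between (by positivity)
  have ht1 : t < t₀ := ht.trans_le (min_le_left _ _)
  have ht2 : (‖e‖ + c) * t < min δ η := by
    have := ht.trans_le (min_le_right _ _)
    rwa [lt_div_iff₀ hec, mul_comm] at this
  let b : ContDiffBump (-(t • e)) := ⟨c * t / 2, c * t, by positivity, by
    have : 0 < c * t := by positivity
    linarith⟩
  obtain ⟨k, hk⟩ : ∃ k : E N → ℝ, k = b.normed volume := ⟨_, rfl⟩
  have hkd : ContDiff ℝ ∞ k := hk ▸ b.contDiff_normed
  have hkc : HasCompactSupport k := hk ▸ b.hasCompactSupport_normed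
  have hk0 : ∀ h, 0 ≤ k h := fun h => hk ▸ b.nonneg_normed h
  have hkt : tsupport k = Metric.closedBall (-(t • e)) (c * t) := hk ▸ b.tsupport_normed_eq
  obtain ⟨v, hv⟩ : ∃ v : E N → ℝ, v = fun y => ∫ h, k h • f (y - h) := ⟨_, rfl⟩
  have hvd : ContDiff ℝ ∞ v := by
    have : v = convolution k f (ContinuousLinearMap.mul ℝ ℝ) volume := hv
    rw [this]
    exact hkc.contDiff_convolution_left _ hkd f1.locallyIntegrable
  have hvg : ∀ y ∈ D, gradient v y = ∫ h, k h • F (y - h) := by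
    intro y hy
    have hts : tsupport (fun z => k (y - z)) ⊆ Metric.closedBall (y + t • e) (c * t) := by
      refine closure_minimal (fun z hz => ?_) Metric.isClosed_closedBall
      have h1 : y - z ∈ tsupport k := subset_tsupport k hz
      rw [hkt, mem_closedBall_iff_norm] at h1
      rw [mem_closedBall_iff_norm, norm_sub_rev]
      have h2 : y + t • e - z = y - z - -(t • e) := by abel
      rw [h2]
      exact h1
    rw [hv]
    refine gradient_mollify f1 F1 hkd hkc (hweak _ ?_ ?_ ?_)
    · exact hkd.comp (contDiff_const.sub contDiff_id)
    · exact HasCompactSupport.of_support_subset_isCompact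
        (isCompact_closedBall (y + t • e) (c * t)) ((subset_tsupport _).trans hts)
    · by_cases hyb : y ∈ Metric.ball x r
      · exact Or.inl (hts.trans (hcone y hy hyb t ht0 ht1))
      · refine Or.inr (Set.disjoint_left.mpr fun s hs hsS => hyb (hδS ?_))
        rw [Metric.mem_thickening_iff]
        refine ⟨s, hsS, ?_⟩
        have h1 := hts hs
        rw [mem_closedBall_iff_norm] at h1
        rw [dist_comm, dist_eq_norm]
        calc ‖s - y‖ = ‖(s - (y + t • e)) + t • e‖ := by congr 1; abel
          _ ≤ c * t + t * ‖e‖ := by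
            refine (norm_add_le _ _).trans (add_le_add h1 ?_)
            rw [norm_smul, Real.norm_of_nonneg ht0.le]
          _ < δ := by
            have := ht2.trans_le (min_le_left _ _)
            linarith
  have hA := integral_inner_average f1 g1 hkd.continuous hkc
  have hB := integral_inner_average F1 G1 hkd.continuous hkc
  have hβk : ∀ h, k h * β h = k h * (∫ y, (inner ℝ (f (y - h)) (g y) : ℝ))
      + k h * ∫ y, (inner ℝ (F (y - h)) (G y) : ℝ) := fun h => by
    rw [hβ, mul_add]
  have hzero : ∫ h, k h * β h = 0 := by
    simp only [hβk]
    rw [integral_add hA.1 hB.1, ← hA.2, ← hB.2]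
    exact hz _ _ (hv ▸ hvd) (hv ▸ hvg)
  have hki : Integrable k := hk ▸ b.integrable_normed
  have hk1 : ∫ h, k h = 1 := hk ▸ b.integral_normed
  have hkβ : Integrable fun h => k h * β h := by
    simp only [hβk]
    exact hA.1.add hB.1
  have e2 : A = ∫ h, k h * (A - β h) := by
    simp only [mul_sub]
    rw [integral_sub (hki.mul_const _) hkβ, hzero, integral_mul_const, hk1]
    ring
  rw [e2, zero_add]
  have h3 := norm_integral_le_of_norm_le (μ := volume) (f := fun h => k h * (A - β h))
    (g := fun h => k h * ε) (hki.mul_const ε) (Eventually.of_forall fun h => by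
      by_cases hh : k h = 0
      · simp [hh]
      · rw [norm_mul, Real.norm_of_nonneg (hk0 h)]
        refine mul_le_mul_of_nonneg_left ?_ (hk0 h)
        have h4 : h ∈ tsupport k := subset_tsupport k hh
        rw [hkt, mem_closedBall_iff_norm] at h4
        have h5 : dist h 0 < η := by
          rw [dist_zero_right]
          calc ‖h‖ = ‖(h - -(t • e)) + -(t • e)‖ := by congr 1; abel
            _ ≤ c * t + t * ‖e‖ := by
              refine (norm_add_le _ _).trans (add_le_add h4 ?_)
              rw [norm_neg, norm_smul, Real.norm_of_nonneg ht0.le]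
            _ < η := by
              have := ht2.trans_le (min_le_right _ _)
              linarith
        have h6 := hball h5
        rw [← dist_eq_norm, dist_comm]
        exact h6)
  rwa [integral_mul_const, hk1, one_mul, Real.norm_eq_abs] at h3

/-- Applies the preceding lemma to extensions by zero. Boundedness of `D` makes them integrable, and
cutting off with the compact set `S` makes the weak gradient identity trivial for test functions
supported away from `S`. -/
lemma inner_eq_zero_of_interior_cone (hD : IsOpen D) (hb : Bornology.IsBounded D) {x e : E N}
    {r c t₀ : ℝ} (hc : 0 < c) (ht₀ : 0 < t₀)
    (hcone : ∀ y ∈ D, y ∈ Metric.ball x r → ∀ t, 0 < t → t < t₀ →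
      Metric.closedBall (y + t • e) (c * t) ⊆ D)
    {S : Set (E N)} (hS : IsCompact S) (hSx : S ⊆ Metric.ball x r) {w z : H1 D}
    (hw₁ : ∀ᵐ y ∂volume.restrict D, y ∉ S → w.1.fst y = 0)
    (hw₂ : ∀ᵐ y ∂volume.restrict D, y ∉ S → w.1.snd y = 0)
    (hz : ∀ v : C1Space D, (inner ℝ (C1Space.toH1 hD hb v) z : ℝ) = 0) :
    (inner ℝ w z : ℝ) = 0 := by
  have hmD := hD.measurableSet
  have hmS := hmD.inter hS.measurableSet
  have hle : volume.restrict (D ∩ S) ≤ volume.restrict D :=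
    Measure.restrict_mono Set.inter_subset_left le_rfl
  have : IsFiniteMeasure (volume.restrict D) := ⟨by simpa using hb.measure_lt_top⟩
  have : IsFiniteMeasure (volume.restrict (D ∩ S)) := isFiniteMeasure_of_le _ hle
  obtain ⟨f, hf⟩ : ∃ f : E N → ℝ, f = (D ∩ S).indicator w.1.fst := ⟨_, rfl⟩
  obtain ⟨F, hF⟩ : ∃ F : E N → E N, F = (D ∩ S).indicator w.1.snd := ⟨_, rfl⟩
  obtain ⟨g, hg⟩ : ∃ g : E N → ℝ, g = D.indicator z.1.fst := ⟨_, rfl⟩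
  obtain ⟨G, hG⟩ : ∃ G : E N → E N, G = D.indicator z.1.snd := ⟨_, rfl⟩
  have f2 : MemLp f 2 := hf ▸ (memLp_indicator_iff_restrict hmS).mpr ((Lp.memLp w.1.fst).mono_measure hle)
  have F2 : MemLp F 2 := hF ▸ (memLp_indicator_iff_restrict hmS).mpr ((Lp.memLp w.1.snd).mono_measure hle)
  have g2 : MemLp g 2 := hg ▸ (memLp_indicator_iff_restrict hmD).mpr (Lp.memLp z.1.fst)
  have G2 : MemLp G 2 := hG ▸ (memLp_indicator_iff_restrict hmD).mpr (Lp.memLp z.1.snd)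
  have f1 : Integrable f := hf ▸ (integrable_indicator_iff hmS).mpr
    (((Lp.memLp w.1.fst).mono_measure hle).integrable (by norm_num))
  have F1 : Integrable F := hF ▸ (integrable_indicator_iff hmS).mpr
    (((Lp.memLp w.1.snd).mono_measure hle).integrable (by norm_num))
  have g1 : Integrable g := hg ▸ (integrable_indicator_iff hmD).mpr
    ((Lp.memLp z.1.fst).integrable (by norm_num))
  have G1 : Integrable G := hG ▸ (integrable_indicator_iff hmD).mpr
    ((Lp.memLp z.1.snd).integrable (by norm_num))
  have hfw : w.1.fst =ᵐ[volume.restrict D] f := by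
    filter_upwards [hw₁, ae_restrict_mem hmD] with y h1 h2
    by_cases hy : y ∈ S
    · rw [hf, Set.indicator_of_mem (Set.mem_inter h2 hy)]
    · rw [hf, Set.indicator_of_notMem (fun h => hy h.2), h1 hy]
  have hFw : w.1.snd =ᵐ[volume.restrict D] F := by
    filter_upwards [hw₂, ae_restrict_mem hmD] with y h1 h2
    by_cases hy : y ∈ S
    · rw [hF, Set.indicator_of_mem (Set.mem_inter h2 hy)]
    · rw [hF, Set.indicator_of_notMem (fun h => hy h.2), h1 hy]
  have f0 : ∀ y, y ∉ D → f y = 0 := fun y hy => hf ▸ Set.indicator_of_notMem (fun h => hy h.1) _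
  have F0 : ∀ y, y ∉ D → F y = 0 := fun y hy => hF ▸ Set.indicator_of_notMem (fun h => hy h.1) _
  have fS : ∀ y, y ∉ S → f y = 0 := fun y hy => hf ▸ Set.indicator_of_notMem (fun h => hy h.2) _
  have FS : ∀ y, y ∉ S → F y = 0 := fun y hy => hF ▸ Set.indicator_of_notMem (fun h => hy h.2) _
  have g0 : ∀ y, y ∉ D → g y = 0 := fun y hy => hg ▸ Set.indicator_of_notMem hy _
  have G0 : ∀ y, y ∉ D → G y = 0 := fun y hy => hG ▸ Set.indicator_of_notMem hy _
  have hweak : ∀ φ : E N → ℝ, ContDiff ℝ ∞ φ → HasCompactSupport φ →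
      (tsupport φ ⊆ D ∨ Disjoint (tsupport φ) S) → ∀ c : E N,
      ∫ y, f y * inner ℝ c (gradient φ y) = - ∫ y, φ y * inner ℝ c (F y) := by
    rintro φ hφ hφc (hs | hs) c
    · have h := (isWeakGradient_iff w.1.fst w.1.snd).mp w.2 φ hφ hφc hs c
      rw [← setIntegral_eq_integral_of_forall_compl_eq_zero (s := D)
          (fun y hy => by rw [f0 y hy, zero_mul]),
        ← setIntegral_eq_integral_of_forall_compl_eq_zero (s := D)
          (f := fun y => φ y * inner ℝ c (F y))
          (fun y hy => by rw [F0 y hy, inner_zero_right, mul_zero])]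
      have e1 : ∫ y in D, f y * inner ℝ c (gradient φ y)
          = ∫ y in D, w.1.fst y * inner ℝ c (gradient φ y) :=
        integral_congr_ae (by filter_upwards [hfw] with y hy; rw [hy])
      have e2 : ∫ y in D, φ y * inner ℝ c (F y) = ∫ y in D, φ y * inner ℝ c (w.1.snd y) :=
        integral_congr_ae (by filter_upwards [hFw] with y hy; rw [hy])
      rw [e1, e2, h]
    · have e1 : ∀ y, f y * inner ℝ c (gradient φ y) = 0 := fun y => by
        by_cases hy : y ∈ S
        · rw [gradient_eq_zero_of_notMem_tsupport (fun h => Set.disjoint_left.mp hs h hy),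
            inner_zero_right, mul_zero]
        · rw [fS y hy, zero_mul]
      have e2 : ∀ y, φ y * inner ℝ c (F y) = 0 := fun y => by
        by_cases hy : y ∈ S
        · rw [image_eq_zero_of_notMem_tsupport (fun h => Set.disjoint_left.mp hs h hy), zero_mul]
        · rw [FS y hy, inner_zero_right, mul_zero]
      simp only [e1, e2, integral_zero, neg_zero]
  rw [H1.inner_eq_integral, setIntegral_inner_eq hmD hfw, setIntegral_inner_eq hmD hFw]
  subst hf hF hg hG
  refine integral_inner_eq_zero_of_interior_cone hc ht₀ hcone hS hSx f2 F2 g2 G2 f1 F1 g1 G1 hweak ?_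
  intro v F' hv hF'
  have h := hz ⟨v, ContDiff.c1Closure hv⟩
  rwa [C1Space.inner_toH1 hD hb (F := F')] at h
  filter_upwards [ae_restrict_mem hmD] with y hy using hF' y hy

end Density

/-! ### Interior cones and density of `C¹(D̄)` in `H¹(D)` -/

section DenseC1

variable {N : ℕ} {D : Set (E N)}

lemma norm_sub_inner_smul_le {e : E N} (he : ‖e‖ = 1) (h : E N) :
    ‖h - (inner ℝ e h : ℝ) • e‖ ≤ ‖h‖ := by
  have h1 : ‖h - (inner ℝ e h : ℝ) • e‖ ^ 2 = ‖h‖ ^ 2 - (inner ℝ e h : ℝ) ^ 2 := by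
    rw [norm_sub_sq_real, norm_smul, he, inner_smul_right, real_inner_comm, Real.norm_eq_abs,
      mul_one, sq_abs]
    ring
  refine le_of_sq_le_sq ?_ (norm_nonneg _)
  nlinarith [sq_nonneg (inner ℝ e h : ℝ)]

/-- The uniform interior cone property near a point of the closure. -/
lemma HasLipschitzBoundary.exists_interior_cone (hD : IsOpen D) (hL : HasLipschitzBoundary D)
    {x : E N} (hx : x ∈ closure D) :
    ∃ (e : E N) (r c t₀ : ℝ), 0 < r ∧ 0 < c ∧ 0 < t₀ ∧
      ∀ y ∈ D, y ∈ Metric.ball x r → ∀ t, 0 < t → t < t₀ →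
        Metric.closedBall (y + t • e) (c * t) ⊆ D := by
  by_cases hxD : x ∈ D
  · obtain ⟨R, hR, hRD⟩ := Metric.isOpen_iff.mp hD x hxD
    refine ⟨0, R / 2, 1, R / 2, by positivity, one_pos, by positivity,
      fun y _ hy t ht ht0 z hz => hRD ?_⟩
    rw [smul_zero, add_zero, Metric.mem_closedBall, one_mul] at hz
    rw [Metric.mem_ball] at hy ⊢
    linarith [dist_triangle z y x]
  · obtain ⟨e, he, g, ⟨K, hK⟩, U, hU, hUD⟩ := hL x ⟨hx, by rwa [hD.interior_eq]⟩
    obtain ⟨R, hR, hRU⟩ := Metric.mem_nhds_iff.mp hU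
    -- A perturbation `h` changes the height by at most `‖h‖` and the graph by at most `K * ‖h‖`, so
    -- `(K + 1) * ‖h‖ < t` is needed; the denominator `K + 2` makes this strict.
    have hc : (0 : ℝ) < 1 / (K + 2) := by positivity
    have hc1 : 1 / ((K : ℝ) + 2) ≤ 1 := by
      rw [div_le_one (by positivity)]
      linarith [K.2]
    refine ⟨e, R / 2, 1 / (K + 2), R / 4, by positivity, hc, by positivity,
      fun y hyD hy t ht ht0 z hz => ?_⟩
    rw [Metric.mem_ball] at hy
    rw [mem_closedBall_iff_norm] at hz
    obtain ⟨h, rfl⟩ : ∃ h, z = y + t • e + h := ⟨z - (y + t • e), by abel⟩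
    rw [add_sub_cancel_left] at hz
    have hht : ‖h‖ ≤ t := hz.trans (by nlinarith)
    have hyU := hRU (show y ∈ Metric.ball x R by rw [Metric.mem_ball]; linarith)
    have hzU := hRU (show y + t • e + h ∈ Metric.ball x R by
      rw [Metric.mem_ball]
      have h1 : dist (y + t • e + h) y ≤ t + t := by
        rw [dist_eq_norm, show y + t • e + h - y = t • e + h by abel]
        refine (norm_add_le _ _).trans (add_le_add ?_ hht)
        rw [norm_smul, he, Real.norm_of_nonneg ht.le, mul_one]
      linarith [dist_triangle (y + t • e + h) y x])
    rw [hUD _ hzU]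
    have h1 := (hUD _ hyU).mp hyD
    have h2 : (inner ℝ e (y + t • e + h) : ℝ) = inner ℝ e y + t + inner ℝ e h := by
      rw [inner_add_right, inner_add_right, inner_smul_right, real_inner_self_eq_norm_sq, he]
      ring
    have h3 := hK.dist_le_mul (y + t • e + h - (inner ℝ e (y + t • e + h) : ℝ) • e)
      (y - (inner ℝ e y : ℝ) • e)
    rw [dist_eq_norm, dist_eq_norm, Real.norm_eq_abs, h2,
      show y + t • e + h - ((inner ℝ e y : ℝ) + t + inner ℝ e h) • e - (y - (inner ℝ e y : ℝ) • e)
        = h - (inner ℝ e h : ℝ) • e by module] at h3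
    have h4 := abs_le.mp (abs_real_inner_le_norm e h)
    rw [he, one_mul] at h4
    have h5 := mul_le_mul_of_nonneg_left (norm_sub_inner_smul_le he h) K.2
    have h6 : ((K : ℝ) + 1) * ‖h‖ < t := by
      refine (mul_le_mul_of_nonneg_left hz (by positivity)).trans_lt ?_
      rw [← mul_assoc, mul_one_div]
      refine mul_lt_of_lt_one_left ht ?_
      rw [div_lt_one (by positivity)]
      linarith
    rw [h2]
    have h7 := (le_abs_self _).trans (h3.trans h5)
    change _ ≤ (K : ℝ) * ‖h‖ at h7
    linarith

/-- Compactness reduces to finitely many sets, to which a smooth partition of unity is subordinate.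
Boundedness of the sets gives the compact supports. -/
lemma exists_smooth_partition (hb : Bornology.IsBounded D) {V : E N → Set (E N)}
    (hV : ∀ x ∈ closure D, IsOpen (V x) ∧ Bornology.IsBounded (V x) ∧ x ∈ V x) :
    ∃ (t : Finset (E N)) (χ : E N → E N → ℝ), (∀ x ∈ t, x ∈ closure D ∧ ContDiff ℝ ∞ (χ x) ∧
      HasCompactSupport (χ x) ∧ tsupport (χ x) ⊆ V x) ∧ ∀ y ∈ closure D, ∑ x ∈ t, χ x y = 1 := by
  have hcD : IsCompact (closure D) := hb.isCompact_closure
  obtain ⟨t, htD⟩ := hcD.elim_nhds_subcover' (fun x _ => V x)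
    (fun x hx => (hV x hx).1.mem_nhds (hV x hx).2.2)
  obtain ⟨f, hf⟩ := SmoothPartitionOfUnity.exists_isSubordinate (modelWithCornersSelf ℝ (E N))
    isClosed_closure (fun i : t => V i.1.1) (fun i => (hV _ i.1.2).1) (by
      intro y hy
      have h := htD hy
      simp only [Set.mem_iUnion] at h ⊢
      obtain ⟨i, hi, hyi⟩ := h
      exact ⟨⟨i, hi⟩, hyi⟩)
  classical
  refine ⟨t.image Subtype.val,
    fun x y => if h : ∃ hx : x ∈ closure D, (⟨x, hx⟩ : closure D) ∈ t then f ⟨_, h.2⟩ y else 0,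
    fun x hx => ?_, fun y hy => ?_⟩
  · obtain ⟨x, hxt, rfl⟩ := Finset.mem_image.mp hx
    have h : ∃ hx : x.1 ∈ closure D, (⟨x.1, hx⟩ : closure D) ∈ t := ⟨x.2, hxt⟩
    simp only [dif_pos h]
    refine ⟨x.2, (f ⟨x, hxt⟩).contMDiff.contDiff, ?_, hf ⟨x, hxt⟩⟩
    exact Metric.isCompact_of_isClosed_isBounded (isClosed_tsupport _)
      ((hV _ x.2).2.1.subset (hf ⟨x, hxt⟩))
  · rw [Finset.sum_image (fun a _ b _ h => Subtype.ext h), ← f.sum_eq_one hy, finsum_eq_sum_of_fintype,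
      ← Finset.sum_attach]
    refine Finset.sum_congr rfl fun x _ => ?_
    exact dif_pos ⟨x.1.2, x.2⟩

lemma H1.coeFn_add_fst (a b : H1 D) :
    (a + b).1.fst =ᵐ[volume.restrict D] fun y => a.1.fst y + b.1.fst y :=
  Lp.coeFn_add a.1.fst b.1.fst

lemma H1.coeFn_sum_fst {t : Finset (E N)} {χ : E N → E N → ℝ} {w : H1 D} {w' : E N → H1 D}
    (h : ∀ x ∈ t, (w' x).1.fst =ᵐ[volume.restrict D] fun y => χ x y * w.1.fst y) :
    (∑ x ∈ t, w' x).1.fst =ᵐ[volume.restrict D] fun y => (∑ x ∈ t, χ x y) * w.1.fst y := by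
  classical
  induction t using Finset.induction_on with
  | empty =>
    filter_upwards [Lp.coeFn_zero ℝ 2 (volume.restrict D)] with y hy
    simpa using hy
  | insert a s ha ih =>
    have h3 := ih fun x hx => h x (Finset.mem_insert_of_mem hx)
    have h4 := h a (Finset.mem_insert_self _ _)
    rw [Finset.sum_insert ha]
    filter_upwards [h3, h4, H1.coeFn_add_fst (w' a) (∑ x ∈ s, w' x)] with y e1 e2 e3
    rw [Finset.sum_insert ha, add_mul, ← e1, ← e2]
    exact e3

/-- The functions in `C¹(D̄)` are dense in `H¹(D)`. -/
lemma C1Space.denseRange_toH1 (hD : IsOpen D) (hb : Bornology.IsBounded D)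
    (hL : HasLipschitzBoundary D) : DenseRange (C1Space.toH1 hD hb) := by
  choose! e r c t₀ hr hc ht₀ hcone using fun x (hx : x ∈ closure D) =>
    hL.exists_interior_cone hD hx
  obtain ⟨t, χ, hχ, hsum⟩ := exists_smooth_partition hb (V := fun x => Metric.ball x (r x))
    (fun x hx => ⟨Metric.isOpen_ball, Metric.isBounded_ball, Metric.mem_ball_self (hr x hx)⟩)
  -- Density is triviality of the orthogonal complement. The partition splits `w` into pieces, each
  -- supported where a single cone direction works.
  have key : ∀ z : H1 D, (∀ v : C1Space D, (inner ℝ (C1Space.toH1 hD hb v) z : ℝ) = 0) →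
      ∀ w : H1 D, (inner ℝ w z : ℝ) = 0 := by
    intro z hz w
    have h1 : ∀ x, ∃ w' : H1 D, x ∈ t → (inner ℝ w' z : ℝ) = 0 ∧
        w'.1.fst =ᵐ[volume.restrict D] fun y => χ x y * w.1.fst y := by
      intro x
      by_cases hx : x ∈ t
      · obtain ⟨hxD, hχ1, hχ2, hχ3⟩ := hχ x hx
        obtain ⟨w', h1, h2⟩ := H1.exists_mul hχ1 hχ2 w
        refine ⟨w', fun _ => ⟨?_, h1⟩⟩
        refine inner_eq_zero_of_interior_cone hD hb (hc x hxD) (ht₀ x hxD) (hcone x hxD)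
          hχ2 hχ3 ?_ ?_ hz
        · filter_upwards [h1] with y hy hyS
          rw [hy, image_eq_zero_of_notMem_tsupport hyS, zero_mul]
        · filter_upwards [h2] with y hy hyS
          rw [hy, image_eq_zero_of_notMem_tsupport hyS, gradient_eq_zero_of_notMem_tsupport hyS,
            zero_smul, smul_zero, add_zero]
      · exact ⟨0, fun h => absurd h hx⟩
    choose w' hw' using h1
    have h2 := H1.coeFn_sum_fst fun x hx => (hw' x hx).2
    have h3 : w = ∑ x ∈ t, w' x := by
      refine weakGradient_unique hD ?_
      filter_upwards [h2, ae_restrict_mem hD.measurableSet] with y hy hyD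
      rw [hy, hsum y (subset_closure hyD), one_mul]
    rw [h3, sum_inner]
    exact Finset.sum_eq_zero fun x hx => (hw' x hx).1
  have h : (LinearMap.range (C1Space.toH1 hD hb)).topologicalClosure = ⊤ := by
    rw [Submodule.topologicalClosure_eq_top_iff, Submodule.eq_bot_iff]
    intro z hz
    exact inner_self_eq_zero (𝕜 := ℝ) |>.mp
      (key z (fun v => (Submodule.mem_orthogonal _ z).mp hz _ ⟨v, rfl⟩) z)
  have h' := Submodule.dense_iff_topologicalClosure_eq_top.mpr h
  rwa [LinearMap.coe_range] at h'

end DenseC1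

/-! ### Boundary charts of Lipschitz domains -/

section Chart

variable {N : ℕ}

/-- An isometry of `ℝ^(N-1) × ℝ` onto `ℝ^N` that maps the last axis to a given line. -/
lemma exists_isometry_of_direction (e : E N) (he : ‖e‖ = 1) :
    ∃ Λ : WithLp 2 (E (N - 1) × ℝ) ≃ₗᵢ[ℝ] E N, Λ (WithLp.toLp 2 (0, 1)) = e := by
  have hN : N - 1 + 1 = N := by
    rcases N with _ | n
    · rw [Subsingleton.elim e 0, norm_zero] at he
      exact absurd he zero_ne_one
    · rfl
  have hr : Module.finrank ℝ (WithLp 2 (E (N - 1) × ℝ)) = N := by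
    rw [(WithLp.linearEquiv 2 ℝ (E (N - 1) × ℝ)).finrank_eq]
    simp [hN]
  let Λ₀ : WithLp 2 (E (N - 1) × ℝ) ≃ₗᵢ[ℝ] E N :=
    ((stdOrthonormalBasis ℝ (WithLp 2 (E (N - 1) × ℝ))).reindex (finCongr hr)).repr
  -- For two vectors of equal norm, the reflection in the hyperplane orthogonal to their difference
  -- maps one to the other; this turns any isometry into one with the prescribed axis.
  refine ⟨Λ₀.trans (Submodule.reflection
    (Submodule.span ℝ {Λ₀ (WithLp.toLp 2 (0, 1)) - e})ᗮ), ?_⟩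
  refine Submodule.reflection_sub ?_
  rw [Λ₀.norm_map, he, WithLp.prod_norm_eq_of_L2]
  simp

/-- A chart which flattens the boundary of `D` near `x₀`: `D` is the set where the last coordinate
is positive. -/
structure BoundaryChart (D : Set (E N)) (x₀ : E N) where
  toHomeo : E (N - 1) × ℝ ≃ₜ E N
  dir : E N
  measurePreserving : MeasurePreserving toHomeo (volume.prod volume) volume
  map_eq : ∀ x s, toHomeo (x, s) = toHomeo (x, 0) + s • dir
  norm_dir : ‖dir‖ = 1
  lip : NNReal
  lipschitz : LipschitzWith lip fun x => toHomeo (x, 0)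
  antilipschitz : AntilipschitzWith 1 fun x => toHomeo (x, 0)
  center : E (N - 1)
  map_center : toHomeo (center, 0) = x₀
  rad : ℝ
  rad_pos : 0 < rad
  inside : ∀ x ∈ Metric.ball center rad, ∀ s ∈ Set.Ioo 0 rad, toHomeo (x, s) ∈ D
  outside : ∀ x ∈ Metric.ball center rad, ∀ s ∈ Set.Ioc (-rad) 0, toHomeo (x, s) ∉ D

lemma measurePreserving_toLp_shear {γ : E (N - 1) → ℝ} (hγ : Measurable γ) :
    MeasurePreserving (fun p : E (N - 1) × ℝ => WithLp.toLp 2 (p.1, p.2 + γ p.1))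
      (volume.prod volume) volume := by
  refine (WithLp.volume_preserving_toLp (E (N - 1)) ℝ).comp ?_
  exact (MeasurePreserving.id volume).skew_product (g := fun x s => s + γ x)
    (measurable_snd.add (hγ.comp measurable_fst))
    (Eventually.of_forall fun x => (measurePreserving_add_right volume (γ x)).map_eq)

/-- The graph coordinates of a Lipschitz function. -/
noncomputable def graphHomeo (Λ : WithLp 2 (E (N - 1) × ℝ) ≃ₗᵢ[ℝ] E N) (γ : E (N - 1) → ℝ)
    (hγ : Continuous γ) : E (N - 1) × ℝ ≃ₜ E N where
  toFun p := Λ (WithLp.toLp 2 (p.1, p.2 + γ p.1))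
  invFun y := ((Λ.symm y).fst, (Λ.symm y).snd - γ (Λ.symm y).fst)
  left_inv p := by simp
  right_inv y := by
    simp only [sub_add_cancel]
    exact Λ.apply_symm_apply y
  continuous_toFun := by fun_prop
  continuous_invFun := by fun_prop

/-- The chart is a rotation composed with a vertical shear by the Lipschitz function: it preserves
volume although it is only Lipschitz, and the last coordinate is the height above the graph. The set
`O` allows arbitrarily small charts. -/
lemma HasLipschitzBoundary.exists_chart {D : Set (E N)} (hD : IsOpen D)
    (hL : HasLipschitzBoundary D) {x₀ : E N} (hx : x₀ ∈ frontier D) {O : Set (E N)}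
    (hO : O ∈ 𝓝 x₀) : ∃ c : BoundaryChart D x₀, ∀ x ∈ Metric.ball c.center c.rad,
      ∀ s ∈ Set.Ioo (-c.rad) c.rad, c.toHomeo (x, s) ∈ O := by
  obtain ⟨e, he, g, ⟨C, hg⟩, U, hU, hUD⟩ := hL x₀ hx
  obtain ⟨Λ, hΛ⟩ := exists_isometry_of_direction e he
  obtain ⟨γ, hγ⟩ : ∃ γ : E (N - 1) → ℝ, γ = fun x => g (Λ (WithLp.toLp 2 (x, 0))) := ⟨_, rfl⟩
  have hsplit : ∀ (x : E (N - 1)) (s : ℝ),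
      Λ (WithLp.toLp 2 (x, s)) = Λ (WithLp.toLp 2 (x, 0)) + s • e := fun x s => by
    rw [← hΛ, ← map_smul, ← map_add]
    congr 1
    rw [← WithLp.toLp_smul, ← WithLp.toLp_add]
    simp
  have hnorm : ∀ (x : E (N - 1)) (s : ℝ), ‖Λ (WithLp.toLp 2 (x, s))‖ ^ 2 = ‖x‖ ^ 2 + s ^ 2 :=
    fun x s => by
      rw [Λ.norm_map, WithLp.prod_norm_sq_eq_of_L2]
      simp
  have hdiff : ∀ (x x' : E (N - 1)) (s s' : ℝ),
      ‖Λ (WithLp.toLp 2 (x, s)) - Λ (WithLp.toLp 2 (x', s'))‖ ^ 2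
        = ‖x - x'‖ ^ 2 + (s - s') ^ 2 := fun x x' s s' => by
    rw [← hnorm, ← map_sub, ← WithLp.toLp_sub]
    rfl
  have hγL : LipschitzWith C γ := by
    refine LipschitzWith.of_dist_le_mul fun x x' => ?_
    rw [hγ]
    refine (hg.dist_le_mul _ _).trans_eq ?_
    congr 1
    rw [dist_eq_norm, dist_eq_norm, ← sq_eq_sq₀ (norm_nonneg _) (norm_nonneg _), hdiff]
    simp
  obtain ⟨Ψ, hΨ⟩ : ∃ Ψ, Ψ = graphHomeo Λ γ hγL.continuous := ⟨_, rfl⟩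
  have hΨa : ∀ x s, Ψ (x, s) = Λ (WithLp.toLp 2 (x, s + γ x)) := fun x s => by rw [hΨ]; rfl
  have hinner : ∀ x s, (inner ℝ e (Λ (WithLp.toLp 2 (x, s))) : ℝ) = s := fun x s => by
    rw [← hΛ, Λ.inner_map_map, WithLp.prod_inner_apply]
    simp
  have hmem : ∀ x s, Ψ (x, s) ∈ U → (Ψ (x, s) ∈ D ↔ 0 < s) := fun x s h => by
    rw [hUD _ h, hΨa, hinner, hsplit x (s + γ x), add_sub_cancel_right, hγ]
    exact lt_add_iff_pos_left _
  obtain ⟨w, s₀, hw⟩ : ∃ w s₀, Ψ (w, s₀) = x₀ :=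
    ⟨(Ψ.symm x₀).1, (Ψ.symm x₀).2, Ψ.apply_symm_apply x₀⟩
  -- A positive height would put the boundary point in the open set `D`; a negative one would give
  -- it a neighborhood that misses `D`.
  have hs0 : s₀ = 0 := by
    have h1 : ¬ 0 < s₀ := fun h => by
      have := (hmem w s₀ (hw ▸ mem_of_mem_nhds hU)).mpr h
      rw [hw] at this
      exact (hD.interior_eq ▸ hx.2) this
    refine le_antisymm (not_lt.mp h1) (not_lt.mp fun h => ?_)
    have h2 : Continuous fun y => (Ψ.symm y).2 := continuous_snd.comp Ψ.symm.continuous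
    have h3 : (Ψ.symm x₀).2 < 0 := by rw [← hw, Ψ.symm_apply_apply]; exact h
    obtain ⟨y, hy1, hy2⟩ := mem_closure_iff_nhds.mp hx.1 _
      (Filter.inter_mem hU ((isOpen_lt h2 continuous_const).mem_nhds h3))
    obtain ⟨⟨x, s⟩, rfl⟩ := Ψ.surjective y
    have h4 := (hmem x s hy1.1).mp hy2
    have h5 : (Ψ.symm (Ψ (x, s))).2 < 0 := hy1.2
    rw [Ψ.symm_apply_apply] at h5
    exact lt_asymm h4 h5
  subst hs0
  have hV : Ψ ⁻¹' (U ∩ O) ∈ 𝓝 (w, (0 : ℝ)) :=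
    Ψ.continuous.continuousAt.preimage_mem_nhds (hw ▸ Filter.inter_mem hU hO)
  obtain ⟨ρ, hρ, hball⟩ := Metric.mem_nhds_iff.mp hV
  rw [← ball_prod_same, Real.ball_eq_Ioo, zero_sub, zero_add] at hball
  refine ⟨{ toHomeo := Ψ
            dir := e
            measurePreserving := ?_
            map_eq := ?_
            norm_dir := he
            lip := 1 + C
            lipschitz := ?_
            antilipschitz := ?_
            center := w
            map_center := hw
            rad := ρ
            rad_pos := hρ
            inside := ?_
            outside := ?_ }, fun x hx s hs => (hball (Set.mk_mem_prod hx hs)).2⟩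
  · rw [hΨ]
    exact Λ.measurePreserving.comp (measurePreserving_toLp_shear hγL.continuous.measurable)
  · intro x s
    rw [hΨa, hΨa, hsplit, hsplit x (0 + γ x)]
    module
  · refine LipschitzWith.of_dist_le_mul fun x x' => ?_
    rw [hΨa, hΨa, dist_eq_norm, dist_eq_norm]
    have h1 := hγL.dist_le_mul x x'
    rw [dist_eq_norm, dist_eq_norm, Real.norm_eq_abs] at h1
    refine abs_le_of_sq_le_sq' ?_ (by positivity) |>.2
    rw [hdiff]
    simp only [zero_add, NNReal.coe_add, NNReal.coe_one]
    have h2 := sq_le_sq' (by linarith [abs_nonneg (γ x - γ x'), norm_nonneg (x - x')]) h1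
    rw [sq_abs] at h2
    nlinarith [norm_nonneg (x - x'), C.2, mul_nonneg C.2 (sq_nonneg ‖x - x'‖)]
  · refine AntilipschitzWith.of_le_mul_dist fun x x' => ?_
    rw [hΨa, hΨa, dist_eq_norm, dist_eq_norm, NNReal.coe_one, one_mul]
    refine abs_le_of_sq_le_sq' ?_ (by positivity) |>.2
    rw [hdiff]
    nlinarith [sq_nonneg (0 + γ x - (0 + γ x'))]
  · intro x hx s hs
    exact (hmem x s (hball (Set.mk_mem_prod hx ⟨by linarith [hs.1], hs.2⟩)).1).mpr hs.1
  · intro x hx s hs h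
    have := (hmem x s (hball (Set.mk_mem_prod hx ⟨hs.1, by linarith [hs.2]⟩)).1).mp h
    linarith [hs.2]

end Chart

/-! ### Increments along segments, by the fundamental theorem of calculus and Cauchy-Schwarz -/

section LineEstimate

lemma sq_lintegral_le {α : Type*} [MeasurableSpace α] {μ : Measure α} {f : α → ENNReal}
    (hf : AEMeasurable f μ) : (∫⁻ x, f x ∂μ) ^ 2 ≤ μ Set.univ * ∫⁻ x, f x ^ 2 ∂μ := by
  have h := ENNReal.lintegral_mul_le_Lp_mul_Lq μ Real.HolderConjugate.two_two hf
    (aemeasurable_const (b := (1 : ENNReal)))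
  simp only [Pi.mul_apply, mul_one, lintegral_const, ENNReal.rpow_two, one_pow, one_mul] at h
  calc (∫⁻ x, f x ∂μ) ^ 2 ≤ ((∫⁻ x, f x ^ 2 ∂μ) ^ (1 / 2 : ℝ) * μ Set.univ ^ (1 / 2 : ℝ)) ^ 2 := by
        gcongr
    _ = μ Set.univ * ∫⁻ x, f x ^ 2 ∂μ := by
        rw [mul_pow, ← ENNReal.rpow_two, ← ENNReal.rpow_two, ← ENNReal.rpow_mul,
          ← ENNReal.rpow_mul]
        norm_num
        rw [mul_comm]

lemma enorm_sq_le_two_mul {V : Type*} [SeminormedAddCommGroup V] (x y : V) :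
    ‖x‖ₑ ^ 2 ≤ 2 * ‖y‖ₑ ^ 2 + 2 * ‖x - y‖ₑ ^ 2 := by
  have h : ‖x‖ ^ 2 ≤ 2 * ‖y‖ ^ 2 + 2 * ‖x - y‖ ^ 2 := by
    have h1 : ‖x‖ ≤ ‖y‖ + ‖x - y‖ := by
      simpa using norm_add_le y (x - y)
    nlinarith [sq_nonneg (‖y‖ - ‖x - y‖), norm_nonneg x, norm_nonneg y, norm_nonneg (x - y)]
  have h2 := ENNReal.ofReal_le_ofReal h
  rw [ENNReal.ofReal_add (by positivity) (by positivity), ENNReal.ofReal_mul (by norm_num),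
    ENNReal.ofReal_mul (by norm_num), ENNReal.ofReal_pow (norm_nonneg _),
    ENNReal.ofReal_pow (norm_nonneg _), ENNReal.ofReal_pow (norm_nonneg _), ofReal_norm,
    ofReal_norm, ofReal_norm] at h2
  simpa using h2

variable {N : ℕ} {D : Set (E N)}

lemma C1Closure.continuousOn_gradient {v : E N → ℝ} (hv : C1Closure D v) :
    ContinuousOn (gradient v) D := by
  obtain ⟨-, G, hG, hvG⟩ := hv
  exact (hG.mono subset_closure).congr fun x hx => (hvG x hx).gradient

/-- Only the open segment must lie in `D`: `v` and its gradient extend continuously to the closure.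
The endpoints may thus be boundary points, as the trace inequality requires. -/
lemma C1Closure.enorm_sub_sq_le_of_le {v : E N → ℝ} (hv : C1Closure D v) {z e : E N} {h : ℝ}
    (hz : ∀ s ∈ Set.Ioo 0 h, z + s • e ∈ D) {a b : ℝ} (ha : 0 ≤ a) (hab : a ≤ b) (hb : b ≤ h) :
    ‖v (z + b • e) - v (z + a • e)‖ₑ ^ 2
      ≤ ENNReal.ofReal h * ‖e‖ₑ ^ 2 * ∫⁻ s in Set.Ioo 0 h, ‖gradient v (z + s • e)‖ₑ ^ 2 := by
  rcases hab.eq_or_lt with rfl | hlt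
  · simp
  obtain ⟨hvc, G, hG, hvG⟩ := hv
  have hline : Continuous fun s : ℝ => z + s • e := by fun_prop
  have hcl : ∀ s ∈ Set.Icc 0 h, z + s • e ∈ closure D := by
    intro s hs
    rw [← closure_Ioo (ha.trans_lt (hlt.trans_le hb)).ne] at hs
    exact map_mem_closure (f := fun s : ℝ => z + s • e) hline hs hz
  have hsub : Set.Icc a b ⊆ Set.Icc 0 h := Set.Icc_subset_Icc ha hb
  have hf' : ContinuousOn (fun s => (inner ℝ (G (z + s • e)) e : ℝ)) (Set.Icc a b) :=
    (hG.comp hline.continuousOn fun s hs => hcl s (hsub hs)).inner continuousOn_const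
  have hftc := intervalIntegral.integral_eq_sub_of_hasDerivAt_of_le hab
    (f := fun s => v (z + s • e)) (f' := fun s => (inner ℝ (G (z + s • e)) e : ℝ))
    (hvc.comp hline.continuousOn fun s hs => hcl s (hsub hs))
    (fun s hs => by
      have h1 := (hvG _ (hz s ⟨ha.trans_lt hs.1, hs.2.trans_le hb⟩)).hasFDerivAt
      have h2 : HasDerivAt (fun s : ℝ => z + s • e) e s := by
        simpa using ((hasDerivAt_id s).smul_const e).const_add z
      have h3 : HasDerivAt (fun s : ℝ => v (z + s • e))
          (InnerProductSpace.toDual ℝ (E N) (G (z + s • e)) e) s := h1.comp_hasDerivAt s h2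
      simpa using h3)
    (ContinuousOn.intervalIntegrable (by rwa [Set.uIcc_of_le hab]))
  rw [← hftc, intervalIntegral.integral_of_le hab, integral_Ioc_eq_integral_Ioo]
  have hm : AEMeasurable (fun s => ‖(inner ℝ (G (z + s • e)) e : ℝ)‖ₑ)
      (volume.restrict (Set.Ioo a b)) :=
    ((hf'.mono Set.Ioo_subset_Icc_self).aestronglyMeasurable measurableSet_Ioo).enorm
  calc ‖∫ s in Set.Ioo a b, (inner ℝ (G (z + s • e)) e : ℝ)‖ₑ ^ 2
      ≤ (∫⁻ s in Set.Ioo a b, ‖(inner ℝ (G (z + s • e)) e : ℝ)‖ₑ) ^ 2 := by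
        gcongr
        exact enorm_integral_le_lintegral_enorm _
    _ ≤ (volume.restrict (Set.Ioo a b)) Set.univ
          * ∫⁻ s in Set.Ioo a b, ‖(inner ℝ (G (z + s • e)) e : ℝ)‖ₑ ^ 2 := sq_lintegral_le hm
    _ ≤ ENNReal.ofReal h * ∫⁻ s in Set.Ioo 0 h, ‖e‖ₑ ^ 2 * ‖gradient v (z + s • e)‖ₑ ^ 2 := by
        gcongr ?_ * ?_
        · rw [Measure.restrict_apply_univ, Real.volume_Ioo]
          exact ENNReal.ofReal_le_ofReal (by linarith)
        · refine (setLIntegral_mono' measurableSet_Ioo fun s hs => ?_).trans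
            (lintegral_mono_set (Set.Ioo_subset_Ioo ha hb))
          rw [(hvG _ (hz s ⟨ha.trans_lt hs.1, hs.2.trans_le hb⟩)).gradient, ← mul_pow, mul_comm]
          gcongr
          rw [← ofReal_norm, ← ofReal_norm, ← ofReal_norm, ← ENNReal.ofReal_mul (norm_nonneg _)]
          exact ENNReal.ofReal_le_ofReal (norm_inner_le_norm _ _)
    _ = _ := by
        rw [lintegral_const_mul' _ _ (by simp), mul_assoc]

lemma C1Closure.enorm_sub_sq_le {v : E N → ℝ} (hv : C1Closure D v) {z e : E N} {h : ℝ}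
    (hz : ∀ s ∈ Set.Ioo 0 h, z + s • e ∈ D) {a b : ℝ} (ha : a ∈ Set.Icc 0 h)
    (hb : b ∈ Set.Icc 0 h) :
    ‖v (z + a • e) - v (z + b • e)‖ₑ ^ 2
      ≤ ENNReal.ofReal h * ‖e‖ₑ ^ 2 * ∫⁻ s in Set.Ioo 0 h, ‖gradient v (z + s • e)‖ₑ ^ 2 := by
  rcases le_total a b with hab | hab
  · rw [← enorm_neg, neg_sub]
    exact hv.enorm_sub_sq_le_of_le hz ha.1 hab hb.2
  · exact hv.enorm_sub_sq_le_of_le hz hb.1 hab ha.2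

/-- Comparison of a function on a set with its values on a translate. -/
lemma C1Closure.lintegral_translate_le {v : E N → ℝ} (hv : C1Closure D v)
    {w : E N} {A : Set (E N)} (hA : MeasurableSet A)
    (hAD : ∀ y ∈ A, ∀ s ∈ Set.Icc (0 : ℝ) 1, y + s • w ∈ D) :
    ∫⁻ y in A, ‖v y‖ₑ ^ 2 ≤ 2 * (∫⁻ y in (fun y => y + w) '' A, ‖v y‖ₑ ^ 2)
      + 2 * ‖w‖ₑ ^ 2 * ∫⁻ y in D, ‖gradient v y‖ₑ ^ 2 := by
  have hshift : ∀ (s : ℝ) (F : E N → ENNReal), ∫⁻ y in A, F (y + s • w)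
      = ∫⁻ y in (fun y => y + s • w) '' A, F y := fun s F =>
    (measurePreserving_add_right volume (s • w)).setLIntegral_comp_emb
      (measurableEmbedding_addRight (s • w)) F A
  have hcont : ContinuousOn (fun p : E N × ℝ => ‖gradient v (p.1 + p.2 • w)‖ₑ ^ 2)
      (A ×ˢ Set.Ioo 0 1) := by
    have h1 : ContinuousOn (fun p : E N × ℝ => gradient v (p.1 + p.2 • w)) (A ×ˢ Set.Ioo 0 1) :=
      hv.continuousOn_gradient.comp (by fun_prop)
        fun p hp => hAD _ hp.1 _ (Set.Ioo_subset_Icc_self hp.2)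
    exact (ENNReal.continuous_pow 2).comp_continuousOn (continuous_enorm.comp_continuousOn h1)
  have hmeas : AEMeasurable (Function.uncurry fun (y : E N) (s : ℝ) =>
      ‖gradient v (y + s • w)‖ₑ ^ 2)
      ((volume.restrict A).prod (volume.restrict (Set.Ioo (0 : ℝ) 1))) := by
    rw [Measure.prod_restrict]
    exact hcont.aemeasurable (hA.prod measurableSet_Ioo)
  have hpt : ∀ y ∈ A, ‖v y‖ₑ ^ 2 ≤ 2 * ‖v (y + (1 : ℝ) • w)‖ₑ ^ 2
      + 2 * ‖w‖ₑ ^ 2 * ∫⁻ s in Set.Ioo (0 : ℝ) 1, ‖gradient v (y + s • w)‖ₑ ^ 2 := by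
    intro y hy
    have h := hv.enorm_sub_sq_le (h := 1) (z := y) (e := w) (a := 0) (b := 1)
      (fun s hs => hAD y hy s (Set.Ioo_subset_Icc_self hs)) (by simp) (by simp)
    rw [zero_smul, add_zero, ENNReal.ofReal_one, one_mul] at h
    refine (enorm_sq_le_two_mul (v y) (v (y + (1 : ℝ) • w))).trans ?_
    rw [mul_assoc]
    gcongr
  have hmv : AEMeasurable (fun y => 2 * ‖v (y + (1 : ℝ) • w)‖ₑ ^ 2) (volume.restrict A) := by
    have h1 : ContinuousOn (fun y : E N => v (y + (1 : ℝ) • w)) A :=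
      hv.1.comp (by fun_prop) fun y hy => subset_closure (hAD y hy 1 (by simp))
    exact ((h1.aestronglyMeasurable hA).enorm.pow_const 2).const_mul 2
  calc ∫⁻ y in A, ‖v y‖ₑ ^ 2
      ≤ ∫⁻ y in A, (2 * ‖v (y + (1 : ℝ) • w)‖ₑ ^ 2
          + 2 * ‖w‖ₑ ^ 2 * ∫⁻ s in Set.Ioo (0 : ℝ) 1, ‖gradient v (y + s • w)‖ₑ ^ 2) :=
        setLIntegral_mono' hA hpt
    _ = 2 * (∫⁻ y in A, ‖v (y + (1 : ℝ) • w)‖ₑ ^ 2) + 2 * ‖w‖ₑ ^ 2 *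
          ∫⁻ y in A, ∫⁻ s in Set.Ioo (0 : ℝ) 1, ‖gradient v (y + s • w)‖ₑ ^ 2 := by
        rw [lintegral_add_left' hmv, lintegral_const_mul' _ _ (by simp),
          lintegral_const_mul' _ _ (ENNReal.mul_ne_top (by simp) (by simp))]
    _ ≤ _ := by
        rw [hshift 1 fun y => ‖v y‖ₑ ^ 2, one_smul, lintegral_lintegral_swap hmeas]
        gcongr
        calc ∫⁻ s in Set.Ioo (0 : ℝ) 1, ∫⁻ y in A, ‖gradient v (y + s • w)‖ₑ ^ 2
            ≤ ∫⁻ _ in Set.Ioo (0 : ℝ) 1, ∫⁻ y in D, ‖gradient v y‖ₑ ^ 2 := by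
              refine setLIntegral_mono' measurableSet_Ioo fun s hs => ?_
              rw [hshift s fun y => ‖gradient v y‖ₑ ^ 2]
              refine lintegral_mono_set ?_
              rintro _ ⟨y, hy, rfl⟩
              exact hAD y hy s (Set.Ioo_subset_Icc_self hs)
          _ = _ := by simp

end LineEstimate

/-! ### Boundary values against interior values in a chart -/

namespace BoundaryChart

variable {N : ℕ} {D : Set (E N)} {x₀ : E N} (c : BoundaryChart D x₀)

/-- The parametrization of the boundary. -/
def graph (x : E (N - 1)) : E N := c.toHomeo (x, 0)

/-- The parameter domain. -/
abbrev dom : Set (E (N - 1)) := Metric.ball c.center c.rad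

/-- The boundary piece covered by the chart. -/
def piece : Set (E N) := c.graph '' c.dom

/-- The part of `D` covered by the chart. -/
def collar : Set (E N) := c.toHomeo '' (c.dom ×ˢ Set.Ioo 0 c.rad)

/-- The neighborhood covered by the chart. -/
def nhd : Set (E N) := c.toHomeo '' (c.dom ×ˢ Set.Ioo (-c.rad) c.rad)

lemma continuous_graph : Continuous c.graph := c.lipschitz.continuous

lemma measurableEmbedding_graph : MeasurableEmbedding c.graph :=
  (c.antilipschitz.isClosedEmbedding c.lipschitz.uniformContinuous).measurableEmbedding

lemma isOpen_nhd : IsOpen c.nhd :=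
  c.toHomeo.isOpenMap _ (Metric.isOpen_ball.prod isOpen_Ioo)

lemma mem_nhd : x₀ ∈ c.nhd :=
  ⟨(c.center, 0), ⟨Metric.mem_ball_self c.rad_pos, by simp [c.rad_pos]⟩, c.map_center⟩

lemma collar_subset : c.collar ⊆ D := by
  rintro _ ⟨⟨x, s⟩, ⟨hx, hs⟩, rfl⟩
  exact c.inside x hx s hs

lemma nhd_inter_subset : c.nhd ∩ D ⊆ c.collar := by
  rintro _ ⟨⟨⟨x, s⟩, ⟨hx, hs⟩, rfl⟩, hD⟩
  refine ⟨(x, s), ⟨hx, ?_, hs.2⟩, rfl⟩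
  by_contra h
  exact c.outside x hx s ⟨hs.1, not_lt.mp h⟩ hD

/-- The open lower half of the chart is an open set disjoint from `D`. -/
lemma notMem_closure {x : E (N - 1)} (hx : x ∈ c.dom) {s : ℝ} (hs : s ∈ Set.Ioo (-c.rad) 0) :
    c.toHomeo (x, s) ∉ closure D := by
  intro h
  have ho : IsOpen (c.toHomeo '' (c.dom ×ˢ Set.Ioo (-c.rad) 0)) :=
    c.toHomeo.isOpenMap _ (Metric.isOpen_ball.prod isOpen_Ioo)
  obtain ⟨_, ⟨⟨x', s'⟩, ⟨hx', hs'⟩, rfl⟩, hD⟩ := mem_closure_iff.mp h _ ho ⟨(x, s), ⟨hx, hs⟩, rfl⟩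
  exact c.outside x' hx' s' ⟨hs'.1, hs'.2.le⟩ hD

lemma graph_mem_frontier (hD : IsOpen D) {x : E (N - 1)} (hx : x ∈ c.dom) :
    c.graph x ∈ frontier D := by
  refine ⟨?_, ?_⟩
  · have h1 : Continuous fun s : ℝ => c.toHomeo (x, s) := by fun_prop
    have h2 : (0 : ℝ) ∈ closure (Set.Ioo 0 c.rad) := by
      rw [closure_Ioo c.rad_pos.ne]
      exact ⟨le_rfl, c.rad_pos.le⟩
    exact map_mem_closure (f := fun s : ℝ => c.toHomeo (x, s)) h1 h2
      fun s hs => c.inside x hx s hs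
  · rw [hD.interior_eq]
    exact c.outside x hx 0 ⟨by linarith [c.rad_pos], le_rfl⟩

lemma piece_subset (hD : IsOpen D) : c.piece ⊆ frontier D := by
  rintro _ ⟨x, hx, rfl⟩
  exact c.graph_mem_frontier hD hx

lemma nhd_inter_frontier_subset (hD : IsOpen D) : c.nhd ∩ frontier D ⊆ c.piece := by
  rintro _ ⟨⟨⟨x, s⟩, ⟨hx, hs⟩, rfl⟩, hf⟩
  have h0 : s = 0 := by
    refine le_antisymm (not_lt.mp fun h => ?_) (not_lt.mp fun h => ?_)
    · exact (hD.interior_eq ▸ hf.2) (c.inside x hx s ⟨h, hs.2⟩)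
    · exact c.notMem_closure hx ⟨hs.1, h⟩ hf.1
  subst h0
  exact ⟨x, hx, rfl⟩

lemma piece_subset_nhd : c.piece ⊆ c.nhd := by
  rintro _ ⟨x, hx, rfl⟩
  exact ⟨(x, 0), ⟨hx, by simp [c.rad_pos]⟩, rfl⟩

/-- On the parameter space the normalized Hausdorff measure is Lebesgue measure, so Lipschitz and
antilipschitz bounds on `graph` compare surface with parameter measure. Two-sided constants suffice;
no area formula is used. -/
lemma surface_image_le (A : Set (E (N - 1))) :
    surface N (c.graph '' A) ≤ (c.lip : ENNReal) ^ (N - 1) * volume A := by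
  have h := c.lipschitz.hausdorffMeasure_image_le (d := ((N - 1 : ℕ) : ℝ)) (by positivity) A
  rw [ENNReal.rpow_natCast] at h
  rw [surface, ← EuclideanSpace.euclideanHausdorffMeasure_eq_volume]
  simp only [Measure.euclideanHausdorffMeasure_def, Measure.smul_apply]
  rw [mul_smul_comm]
  exact smul_le_smul_left _ h

lemma volume_le_surface_image (A : Set (E (N - 1))) :
    volume A ≤ surface N (c.graph '' A) := by
  have h := c.antilipschitz.le_hausdorffMeasure_image (d := ((N - 1 : ℕ) : ℝ)) (by positivity) A
  rw [ENNReal.coe_one, ENNReal.one_rpow, one_mul] at h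
  rw [surface, ← EuclideanSpace.euclideanHausdorffMeasure_eq_volume]
  simp only [Measure.euclideanHausdorffMeasure_def, Measure.smul_apply]
  exact smul_le_smul_left _ h

lemma lintegral_piece_le (F : E N → ENNReal) :
    ∫⁻ y in c.piece, F y ∂(surface N)
      ≤ (c.lip : ENNReal) ^ (N - 1) * ∫⁻ x in c.dom, F (c.graph x) := by
  have h : (surface N).restrict c.piece
      ≤ (c.lip : ENNReal) ^ (N - 1) • (volume.restrict c.dom).map c.graph := by
    refine Measure.le_iff.mpr fun B hB => ?_
    rw [Measure.smul_apply, Measure.restrict_apply hB,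
      Measure.map_apply c.continuous_graph.measurable hB,
      Measure.restrict_apply (c.continuous_graph.measurable hB), piece, ← Set.image_preimage_inter]
    exact c.surface_image_le _
  refine (lintegral_mono' h le_rfl).trans_eq ?_
  rw [lintegral_smul_measure, c.measurableEmbedding_graph.lintegral_map, smul_eq_mul]

lemma lintegral_graph_le (F : E N → ENNReal) :
    ∫⁻ x in c.dom, F (c.graph x) ≤ ∫⁻ y in c.piece, F y ∂(surface N) := by
  have h : (volume.restrict c.dom).map c.graph ≤ (surface N).restrict c.piece := by
    refine Measure.le_iff.mpr fun B hB => ?_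
    rw [Measure.restrict_apply hB,
      Measure.map_apply c.continuous_graph.measurable hB,
      Measure.restrict_apply (c.continuous_graph.measurable hB), piece, ← Set.image_preimage_inter]
    exact c.volume_le_surface_image _
  rw [← c.measurableEmbedding_graph.lintegral_map]
  exact lintegral_mono' h le_rfl

lemma lintegral_collar {F : E N → ENNReal} (hF : ContinuousOn F D) :
    ∫⁻ y in c.collar, F y
      = ∫⁻ x in c.dom, ∫⁻ s in Set.Ioo 0 c.rad, F (c.toHomeo (x, s)) := by
  have hm : AEMeasurable (fun p => F (c.toHomeo p))
      ((volume.restrict c.dom).prod (volume.restrict (Set.Ioo 0 c.rad))) := by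
    rw [Measure.prod_restrict]
    refine ContinuousOn.aemeasurable (hF.comp c.toHomeo.continuous.continuousOn ?_)
      (Metric.isOpen_ball.measurableSet.prod measurableSet_Ioo)
    rintro ⟨x, s⟩ ⟨hx, hs⟩
    exact c.inside x hx s hs
  rw [collar, ← c.measurePreserving.setLIntegral_comp_emb c.toHomeo.measurableEmbedding,
    ← Measure.prod_restrict, lintegral_prod _ hm]

lemma enorm_sq_le {v : E N → ℝ} (hv : C1Closure D v) {x : E (N - 1)} (hx : x ∈ c.dom) {a b : ℝ}
    (ha : a ∈ Set.Icc 0 c.rad) (hb : b ∈ Set.Icc 0 c.rad) :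
    ‖v (c.toHomeo (x, a))‖ₑ ^ 2 ≤ 2 * ‖v (c.toHomeo (x, b))‖ₑ ^ 2
      + 2 * (ENNReal.ofReal c.rad
        * ∫⁻ s in Set.Ioo 0 c.rad, ‖gradient v (c.toHomeo (x, s))‖ₑ ^ 2) := by
  have h := hv.enorm_sub_sq_le (z := c.toHomeo (x, 0)) (e := c.dir) (h := c.rad)
    (fun s hs => c.map_eq x s ▸ c.inside x hx s hs) ha hb
  have he : ‖c.dir‖ₑ = 1 := by rw [← ofReal_norm, c.norm_dir, ENNReal.ofReal_one]
  simp only [← c.map_eq, he, one_pow, mul_one] at h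
  exact (enorm_sq_le_two_mul _ _).trans (by gcongr)

lemma continuousOn_enorm_sq {v : E N → ℝ} (hv : C1Closure D v) :
    ContinuousOn (fun y => ‖v y‖ₑ ^ 2) D :=
  (ENNReal.continuous_pow 2).comp_continuousOn
    (continuous_enorm.comp_continuousOn (hv.1.mono subset_closure))

lemma continuousOn_enorm_gradient_sq {v : E N → ℝ} (hv : C1Closure D v) :
    ContinuousOn (fun y => ‖gradient v y‖ₑ ^ 2) D :=
  (ENNReal.continuous_pow 2).comp_continuousOn
    (continuous_enorm.comp_continuousOn hv.continuousOn_gradient)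

/-- Near the boundary, a function is controlled by its boundary values and its gradient. -/
lemma lintegral_collar_le {v : E N → ℝ} (hv : C1Closure D v) :
    ∫⁻ y in c.collar, ‖v y‖ₑ ^ 2
      ≤ 2 * ENNReal.ofReal c.rad * (∫⁻ y in c.piece, ‖v y‖ₑ ^ 2 ∂(surface N))
        + 2 * ENNReal.ofReal c.rad ^ 2 * ∫⁻ y in D, ‖gradient v y‖ₑ ^ 2 := by
  have h1 := c.lintegral_collar (continuousOn_enorm_sq hv)
  have h2 := c.lintegral_collar (continuousOn_enorm_gradient_sq hv)
  have hmg : AEMeasurable (fun x => 2 * ENNReal.ofReal c.rad * ‖v (c.graph x)‖ₑ ^ 2)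
      (volume.restrict c.dom) := by
    refine AEMeasurable.const_mul (AEMeasurable.pow_const (AEStronglyMeasurable.enorm ?_) 2) _
    refine ContinuousOn.aestronglyMeasurable ?_ Metric.isOpen_ball.measurableSet
    refine hv.1.comp c.continuous_graph.continuousOn fun x hx => ?_
    have h3 : Continuous fun s : ℝ => c.toHomeo (x, s) := by fun_prop
    have h4 : (0 : ℝ) ∈ closure (Set.Ioo 0 c.rad) := by
      rw [closure_Ioo c.rad_pos.ne]
      exact ⟨le_rfl, c.rad_pos.le⟩
    exact map_mem_closure (f := fun s : ℝ => c.toHomeo (x, s)) h3 h4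
      fun s hs => c.inside x hx s hs
  rw [h1]
  calc ∫⁻ x in c.dom, ∫⁻ s in Set.Ioo 0 c.rad, ‖v (c.toHomeo (x, s))‖ₑ ^ 2
      ≤ ∫⁻ x in c.dom, (2 * ENNReal.ofReal c.rad * ‖v (c.graph x)‖ₑ ^ 2
          + 2 * ENNReal.ofReal c.rad ^ 2
            * ∫⁻ s in Set.Ioo 0 c.rad, ‖gradient v (c.toHomeo (x, s))‖ₑ ^ 2) := by
        refine setLIntegral_mono' Metric.isOpen_ball.measurableSet fun x hx => ?_
        refine (setLIntegral_mono' measurableSet_Ioo fun s hs =>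
          c.enorm_sq_le hv hx (Set.Ioo_subset_Icc_self hs) (b := 0)
            ⟨le_rfl, c.rad_pos.le⟩).trans_eq ?_
        rw [setLIntegral_const, Real.volume_Ioo, sub_zero]
        simp only [graph]
        ring
    _ = 2 * ENNReal.ofReal c.rad * (∫⁻ x in c.dom, ‖v (c.graph x)‖ₑ ^ 2)
          + 2 * ENNReal.ofReal c.rad ^ 2 * ∫⁻ x in c.dom,
            ∫⁻ s in Set.Ioo 0 c.rad, ‖gradient v (c.toHomeo (x, s))‖ₑ ^ 2 := by
        rw [lintegral_add_left' hmg, lintegral_const_mul' _ _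
          (ENNReal.mul_ne_top (by simp) (by simp)), lintegral_const_mul' _ _
          (ENNReal.mul_ne_top (by simp) (by simp))]
    _ ≤ _ := by
        rw [← h2]
        gcongr
        · exact c.lintegral_graph_le fun y => ‖v y‖ₑ ^ 2
        · exact c.collar_subset

/-- The local form of the trace inequality. -/
lemma lintegral_piece_sq_le {v : E N → ℝ} (hv : C1Closure D v) :
    ENNReal.ofReal c.rad * (∫⁻ y in c.piece, ‖v y‖ₑ ^ 2 ∂(surface N))
      ≤ (c.lip : ENNReal) ^ (N - 1) * (2 * (∫⁻ y in D, ‖v y‖ₑ ^ 2)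
        + 2 * ENNReal.ofReal c.rad ^ 2 * ∫⁻ y in D, ‖gradient v y‖ₑ ^ 2) := by
  have h1 := c.lintegral_collar (continuousOn_enorm_sq hv)
  have h2 := c.lintegral_collar (continuousOn_enorm_gradient_sq hv)
  have hms : ∀ x ∈ c.dom, AEMeasurable (fun s => 2 * ‖v (c.toHomeo (x, s))‖ₑ ^ 2)
      (volume.restrict (Set.Ioo 0 c.rad)) := by
    intro x hx
    refine AEMeasurable.const_mul (ContinuousOn.aemeasurable ?_ measurableSet_Ioo) _
    exact (continuousOn_enorm_sq hv).comp
      (by fun_prop : Continuous fun s : ℝ => c.toHomeo (x, s)).continuousOn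
      fun s hs => c.inside x hx s hs
  have hmx : AEMeasurable (fun x => 2 * ∫⁻ s in Set.Ioo 0 c.rad, ‖v (c.toHomeo (x, s))‖ₑ ^ 2)
      (volume.restrict c.dom) := by
    refine AEMeasurable.const_mul ?_ _
    have hm : AEMeasurable (fun p => ‖v (c.toHomeo p)‖ₑ ^ 2)
        ((volume.restrict c.dom).prod (volume.restrict (Set.Ioo 0 c.rad))) := by
      rw [Measure.prod_restrict]
      refine ContinuousOn.aemeasurable ((continuousOn_enorm_sq hv).comp
        c.toHomeo.continuous.continuousOn ?_)
        (Metric.isOpen_ball.measurableSet.prod measurableSet_Ioo)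
      rintro ⟨x, s⟩ ⟨hx, hs⟩
      exact c.inside x hx s hs
    exact hm.lintegral_prod_right'
  calc ENNReal.ofReal c.rad * (∫⁻ y in c.piece, ‖v y‖ₑ ^ 2 ∂(surface N))
      ≤ ENNReal.ofReal c.rad * ((c.lip : ENNReal) ^ (N - 1)
          * ∫⁻ x in c.dom, ‖v (c.graph x)‖ₑ ^ 2) := by
        gcongr
        exact c.lintegral_piece_le fun y => ‖v y‖ₑ ^ 2
    -- The factor `rad` is spent as an integral over the transverse interval, so that each boundary
    -- value can be compared with all interior values on its fiber.
    _ = (c.lip : ENNReal) ^ (N - 1)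
          * ∫⁻ x in c.dom, ∫⁻ _ in Set.Ioo 0 c.rad, ‖v (c.graph x)‖ₑ ^ 2 := by
        simp only [setLIntegral_const, Real.volume_Ioo, sub_zero]
        rw [lintegral_mul_const' _ _ (by simp)]
        ring
    _ ≤ (c.lip : ENNReal) ^ (N - 1) * ∫⁻ x in c.dom,
          (2 * (∫⁻ s in Set.Ioo 0 c.rad, ‖v (c.toHomeo (x, s))‖ₑ ^ 2)
          + 2 * ENNReal.ofReal c.rad ^ 2
            * ∫⁻ s in Set.Ioo 0 c.rad, ‖gradient v (c.toHomeo (x, s))‖ₑ ^ 2) := by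
        refine mul_le_mul' le_rfl ?_
        refine setLIntegral_mono' Metric.isOpen_ball.measurableSet fun x hx => ?_
        refine (setLIntegral_mono' measurableSet_Ioo fun s hs =>
          c.enorm_sq_le hv hx (a := 0) ⟨le_rfl, c.rad_pos.le⟩
            (Set.Ioo_subset_Icc_self hs)).trans_eq ?_
        rw [lintegral_add_left' (hms x hx), setLIntegral_const, Real.volume_Ioo, sub_zero,
          lintegral_const_mul' _ _ (by simp)]
        ring
    _ ≤ _ := by
        rw [lintegral_add_left' hmx, lintegral_const_mul' _ _ (by simp), lintegral_const_mul' _ _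
          (ENNReal.mul_ne_top (by simp) (by simp)), ← h1, ← h2]
        gcongr
        · exact c.collar_subset
        · exact c.collar_subset

end BoundaryChart

/-! ### Squared `L²` norms as lower integrals -/

section L2Norm

variable {α V : Type*} [MeasurableSpace α] {μ : Measure α} [NormedAddCommGroup V]

lemma eLpNorm_two_sq (f : α → V) : eLpNorm f 2 μ ^ 2 = ∫⁻ x, ‖f x‖ₑ ^ 2 ∂μ := by
  have h := eLpNorm_nnreal_pow_eq_lintegral (f := f) (μ := μ) (p := 2) (by norm_num)
  simp only [NNReal.coe_ofNat, ENNReal.rpow_two] at h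
  exact_mod_cast h

lemma Lp_enorm_sq (f : Lp V 2 μ) : ‖f‖ₑ ^ 2 = ∫⁻ x, ‖f x‖ₑ ^ 2 ∂μ := by
  rw [Lp.enorm_def, eLpNorm_two_sq]

lemma memLp_two_of_lintegral_lt_top {f : α → V} (hf : AEStronglyMeasurable f μ)
    (h : ∫⁻ x, ‖f x‖ₑ ^ 2 ∂μ < ⊤) : MemLp f 2 μ := by
  refine ⟨hf, ?_⟩
  rw [← eLpNorm_two_sq] at h
  exact ((ENNReal.pow_lt_top_iff (n := 2)).mp h).resolve_right (by norm_num)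

lemma norm_le_of_enorm_sq_le {V W : Type*} [SeminormedAddCommGroup V] [SeminormedAddCommGroup W]
    {C : ENNReal} (hC : C ≠ ⊤) {v : V} {w : W} (h : ‖v‖ₑ ^ 2 ≤ C * ‖w‖ₑ ^ 2) :
    ‖v‖ ≤ Real.sqrt C.toReal * ‖w‖ := by
  have h2 := ENNReal.toReal_mono (ENNReal.mul_ne_top hC (by simp)) h
  rw [ENNReal.toReal_mul, ENNReal.toReal_pow, ENNReal.toReal_pow, toReal_enorm,
    toReal_enorm] at h2
  refine abs_le_of_sq_le_sq' ?_ (by positivity) |>.2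
  rwa [mul_pow, Real.sq_sqrt ENNReal.toReal_nonneg]

/-- The integral is a squared norm after the bounded restriction operator. This continuity lets
integral inequalities pass from `C¹` functions to `H¹`. -/
lemma continuous_setLIntegral_enorm_sq [NormedSpace ℝ V] {A : Set α} :
    Continuous fun f : Lp V 2 μ => ∫⁻ x in A, ‖f x‖ₑ ^ 2 ∂μ := by
  have h : (fun f : Lp V 2 μ => ∫⁻ x in A, ‖f x‖ₑ ^ 2 ∂μ)
      = fun f => ‖LpToLpRestrictCLM α V ℝ μ 2 A f‖ₑ ^ 2 := by
    funext f
    rw [Lp_enorm_sq]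
    refine lintegral_congr_ae ?_
    filter_upwards [LpToLpRestrictCLM_coeFn ℝ A f] with x hx
    rw [hx]
  rw [h]
  exact (ENNReal.continuous_pow 2).comp
    (continuous_enorm.comp (LpToLpRestrictCLM α V ℝ μ 2 A).continuous)

end L2Norm

/-! ### The trace inequality and the trace operator -/

section Trace

variable {N : ℕ} {D : Set (E N)}

lemma H1.enorm_sq (w : H1 D) :
    ‖w‖ₑ ^ 2 = (∫⁻ y in D, ‖w.1.fst y‖ₑ ^ 2) + ∫⁻ y in D, ‖w.1.snd y‖ₑ ^ 2 := by
  rw [← Lp_enorm_sq, ← Lp_enorm_sq, ← ofReal_norm, ← ofReal_norm, ← ofReal_norm,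
    ← ENNReal.ofReal_pow (norm_nonneg _), ← ENNReal.ofReal_pow (norm_nonneg _),
    ← ENNReal.ofReal_pow (norm_nonneg _), ← ENNReal.ofReal_add (by positivity) (by positivity)]
  congr 1
  exact WithLp.prod_norm_sq_eq_of_L2 w.1

lemma C1Space.lintegral_toH1_fst (hD : IsOpen D) (hb : Bornology.IsBounded D) (v : C1Space D)
    {A : Set (E N)} (hA : A ⊆ D) :
    ∫⁻ y in A, ‖(C1Space.toH1 hD hb v).1.fst y‖ₑ ^ 2 = ∫⁻ y in A, ‖v.1 y‖ₑ ^ 2 := by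
  refine lintegral_congr_ae ?_
  filter_upwards [ae_mono (Measure.restrict_mono hA le_rfl) (C1Space.toH1_fst hD hb v)] with y hy
  rw [hy]

lemma C1Space.lintegral_toH1_snd (hD : IsOpen D) (hb : Bornology.IsBounded D) (v : C1Space D) :
    ∫⁻ y in D, ‖(C1Space.toH1 hD hb v).1.snd y‖ₑ ^ 2 = ∫⁻ y in D, ‖gradient v.1 y‖ₑ ^ 2 := by
  refine lintegral_congr_ae ?_
  filter_upwards [C1Space.toH1_snd hD hb v] with y hy
  rw [hy]

lemma C1Space.enorm_toH1_sq (hD : IsOpen D) (hb : Bornology.IsBounded D) (v : C1Space D) :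
    ‖C1Space.toH1 hD hb v‖ₑ ^ 2
      = (∫⁻ y in D, ‖v.1 y‖ₑ ^ 2) + ∫⁻ y in D, ‖gradient v.1 y‖ₑ ^ 2 := by
  rw [H1.enorm_sq, C1Space.lintegral_toH1_fst hD hb v subset_rfl, C1Space.lintegral_toH1_snd]

/-- The trace inequality. -/
lemma exists_trace_bound (hD : IsOpen D) (hb : Bornology.IsBounded D)
    (hL : HasLipschitzBoundary D) : ∃ C : ENNReal, C ≠ ⊤ ∧ ∀ v : E N → ℝ, C1Closure D v →
      ∫⁻ y in frontier D, ‖v y‖ₑ ^ 2 ∂(surface N)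
        ≤ C * ((∫⁻ y in D, ‖v y‖ₑ ^ 2) + ∫⁻ y in D, ‖gradient v y‖ₑ ^ 2) := by
  have hcf : IsCompact (frontier D) := hb.isCompact_closure.of_isClosed_subset isClosed_frontier
    frontier_subset_closure
  -- Such bounds pass to subsets and finite unions, so compactness of the boundary reduces the claim
  -- to one chart.
  refine hcf.induction_on (p := fun S => ∃ C : ENNReal, C ≠ ⊤ ∧ ∀ v : E N → ℝ, C1Closure D v →
      ∫⁻ y in S, ‖v y‖ₑ ^ 2 ∂(surface N)
        ≤ C * ((∫⁻ y in D, ‖v y‖ₑ ^ 2) + ∫⁻ y in D, ‖gradient v y‖ₑ ^ 2)) ?_ ?_ ?_ ?_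
  · exact ⟨0, by simp, fun v _ => by simp⟩
  · rintro s t hst ⟨C, hC, h⟩
    exact ⟨C, hC, fun v hv => (lintegral_mono_set hst).trans (h v hv)⟩
  · rintro s t ⟨C, hC, h⟩ ⟨C', hC', h'⟩
    refine ⟨C + C', ENNReal.add_ne_top.mpr ⟨hC, hC'⟩, fun v hv => ?_⟩
    rw [add_mul]
    exact (lintegral_union_le _ _ _).trans (add_le_add (h v hv) (h' v hv))
  · intro x hx
    obtain ⟨c, -⟩ := hL.exists_chart hD hx univ_mem
    refine ⟨c.piece, mem_of_superset (inter_mem_nhdsWithin _ (c.isOpen_nhd.mem_nhds c.mem_nhd))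
      (by rw [Set.inter_comm]; exact c.nhd_inter_frontier_subset hD), ?_⟩
    have hr : ENNReal.ofReal c.rad ≠ 0 := by simpa using c.rad_pos
    refine ⟨(ENNReal.ofReal c.rad)⁻¹ * ((c.lip : ENNReal) ^ (N - 1)
      * (2 + 2 * ENNReal.ofReal c.rad ^ 2)), ?_, fun v hv => ?_⟩
    · exact ENNReal.mul_ne_top (ENNReal.inv_ne_top.mpr hr) (ENNReal.mul_ne_top (by simp)
        (ENNReal.add_ne_top.mpr ⟨by simp, ENNReal.mul_ne_top (by simp) (by simp)⟩))
    · have h := c.lintegral_piece_sq_le hv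
      rw [mul_assoc, ← ENNReal.mul_le_iff_le_inv hr ENNReal.ofReal_ne_top, mul_assoc]
      refine h.trans (mul_le_mul' le_rfl ?_)
      rw [mul_add, add_mul, add_mul]
      exact add_le_add (self_le_add_right _ _) (self_le_add_left _ _)

/-- The restriction of the functions in `C¹(D̄)` to the boundary. -/
noncomputable def C1Space.boundary
    (h : ∀ v : C1Space D, MemLp v.1 2 ((surface N).restrict (frontier D))) :
    C1Space D →ₗ[ℝ] L2surf (frontier D) where
  toFun v := (h v).toLp v.1
  map_add' v w := (h v).toLp_add (h w)
  map_smul' a v := (h v).toLp_const_smul a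

/-- The trace inequality bounds boundary restriction on `C¹` functions by the `H¹` norm; density
gives the extension. Existence alone ensures that the chosen `trace` has its defining property. -/
lemma exists_isTrace (hD : IsOpen D) (hb : Bornology.IsBounded D)
    (hL : HasLipschitzBoundary D) : ∃ T, IsTrace D T := by
  obtain ⟨C, hC, hbd⟩ := exists_trace_bound hD hb hL
  have hfin : ∀ v : C1Space D, ∫⁻ y in frontier D, ‖v.1 y‖ₑ ^ 2 ∂(surface N) < ⊤ := fun v => by
    refine (hbd v.1 v.2).trans_lt ?_
    rw [← C1Space.enorm_toH1_sq hD hb v]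
    exact ENNReal.mul_lt_top hC.lt_top (by simp)
  have hmem : ∀ v : C1Space D, MemLp v.1 2 ((surface N).restrict (frontier D)) := fun v =>
    memLp_two_of_lintegral_lt_top ((v.2.1.mono frontier_subset_closure).aestronglyMeasurable
      isClosed_frontier.measurableSet) (hfin v)
  have hnorm : ∃ C : ℝ, ∀ v, ‖C1Space.boundary hmem v‖ ≤ C * ‖C1Space.toH1 hD hb v‖ := by
    refine ⟨Real.sqrt C.toReal, fun v => norm_le_of_enorm_sq_le hC ?_⟩
    rw [C1Space.enorm_toH1_sq hD hb v, Lp_enorm_sq]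
    refine le_trans (le_of_eq (lintegral_congr_ae ?_)) (hbd v.1 v.2)
    filter_upwards [(hmem v).coeFn_toLp] with y hy
    rw [← hy]
    rfl
  have hdense := C1Space.denseRange_toH1 hD hb hL
  refine ⟨(C1Space.boundary hmem).extendOfNorm (C1Space.toH1 hD hb), fun v hv w hw => ?_⟩
  have h1 : w = C1Space.toH1 hD hb ⟨v, hv⟩ :=
    weakGradient_unique hD (hw.trans (C1Space.toH1_fst hD hb ⟨v, hv⟩).symm)
  rw [h1, LinearMap.extendOfNorm_eq hdense hnorm]
  exact (hmem ⟨v, hv⟩).coeFn_toLp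

lemma isTrace_trace (hD : IsOpen D) (hb : Bornology.IsBounded D)
    (hL : HasLipschitzBoundary D) : IsTrace D (trace D) :=
  Classical.epsilon_spec (exists_isTrace hD hb hL)

lemma H1.continuous_fst : Continuous fun w : H1 D => w.1.fst :=
  (WithLp.prod_continuous_ofLp 2 _ _).fst.comp continuous_subtype_val

lemma H1.continuous_snd : Continuous fun w : H1 D => w.1.snd :=
  (WithLp.prod_continuous_ofLp 2 _ _).snd.comp continuous_subtype_val

lemma H1.continuous_lintegral_fst {S : Set (E N)} (hS : S ⊆ D) :
    Continuous fun w : H1 D => ∫⁻ y in S, ‖w.1.fst y‖ₑ ^ 2 := by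
  have h1 := (continuous_setLIntegral_enorm_sq (μ := volume.restrict D) (V := ℝ) (A := S)).comp
    H1.continuous_fst
  rw [Measure.restrict_restrict_of_subset hS] at h1
  exact h1

lemma H1.continuous_lintegral_snd :
    Continuous fun w : H1 D => ∫⁻ y in D, ‖w.1.snd y‖ₑ ^ 2 := by
  have h1 := (continuous_setLIntegral_enorm_sq (μ := volume.restrict D) (V := E N)
    (A := D)).comp H1.continuous_snd
  rw [Measure.restrict_restrict_of_subset subset_rfl] at h1
  exact h1

lemma continuous_lintegral_trace {Γ : Set (E N)} (hΓ : Γ ⊆ frontier D) :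
    Continuous fun w : H1 D => ∫⁻ y in Γ, ‖trace D w y‖ₑ ^ 2 ∂(surface N) := by
  have h1 := (continuous_setLIntegral_enorm_sq (μ := (surface N).restrict (frontier D))
    (V := ℝ) (A := Γ)).comp (trace D).continuous
  rw [Measure.restrict_restrict_of_subset hΓ] at h1
  exact h1

lemma C1Space.lintegral_trace_toH1 (hD : IsOpen D) (hb : Bornology.IsBounded D)
    (hL : HasLipschitzBoundary D) {Γ : Set (E N)} (hΓ : Γ ⊆ frontier D) (v : C1Space D) :
    ∫⁻ y in Γ, ‖trace D (C1Space.toH1 hD hb v) y‖ₑ ^ 2 ∂(surface N)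
      = ∫⁻ y in Γ, ‖v.1 y‖ₑ ^ 2 ∂(surface N) := by
  refine lintegral_congr_ae ?_
  filter_upwards [ae_mono (Measure.restrict_mono hΓ le_rfl)
    (isTrace_trace hD hb hL v.1 v.2 _ (C1Space.toH1_fst hD hb v))] with y hy
  rw [hy]

/-- An estimate of Poincaré type extends from `C¹(D̄)` to `H¹(D)`. -/
lemma H1.lintegral_le_of_C1 (hD : IsOpen D) (hb : Bornology.IsBounded D)
    (hL : HasLipschitzBoundary D) {A B Γ : Set (E N)} (hA : A ⊆ D) (hB : B ⊆ D)
    (hΓ : Γ ⊆ frontier D) {a b g : ENNReal} (ha : a ≠ ⊤) (hb' : b ≠ ⊤) (hg : g ≠ ⊤)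
    (h : ∀ v, C1Closure D v → ∫⁻ y in A, ‖v y‖ₑ ^ 2
      ≤ a * (∫⁻ y in Γ, ‖v y‖ₑ ^ 2 ∂(surface N)) + b * (∫⁻ y in B, ‖v y‖ₑ ^ 2)
        + g * ∫⁻ y in D, ‖gradient v y‖ₑ ^ 2) (w : H1 D) :
    ∫⁻ y in A, ‖w.1.fst y‖ₑ ^ 2
      ≤ a * (∫⁻ y in Γ, ‖trace D w y‖ₑ ^ 2 ∂(surface N)) + b * (∫⁻ y in B, ‖w.1.fst y‖ₑ ^ 2)
        + g * ∫⁻ y in D, ‖w.1.snd y‖ₑ ^ 2 := by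
  refine (C1Space.denseRange_toH1 hD hb hL).induction_on w (isClosed_le
    (H1.continuous_lintegral_fst hA)
    ((((ENNReal.continuous_const_mul ha).comp (continuous_lintegral_trace hΓ)).add
      ((ENNReal.continuous_const_mul hb').comp (H1.continuous_lintegral_fst hB))).add
      ((ENNReal.continuous_const_mul hg).comp H1.continuous_lintegral_snd))) fun v => ?_
  rw [C1Space.lintegral_toH1_fst hD hb v hA, C1Space.lintegral_toH1_fst hD hb v hB,
    C1Space.lintegral_trace_toH1 hD hb hL hΓ, C1Space.lintegral_toH1_snd hD hb v]
  exact h v.1 v.2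

end Trace

/-! ### The Poincaré inequality, from the Dirichlet boundary through each component -/

section Poincare

variable {N : ℕ} {D Γ : Set (E N)}

/-- The functions with zero trace on `Γ` satisfy a Poincaré inequality on `A`. -/
def PoincareOn (D Γ : Set (E N)) (hΓ : Γ ⊆ frontier D) (A : Set (E N)) : Prop :=
  ∃ C : ENNReal, C ≠ ⊤ ∧ ∀ w ∈ zeroTrace D Γ hΓ,
    ∫⁻ y in A, ‖w.1.fst y‖ₑ ^ 2 ≤ C * ∫⁻ y in D, ‖w.1.snd y‖ₑ ^ 2

variable {hΓ : Γ ⊆ frontier D}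

lemma PoincareOn.mono {A B : Set (E N)} (h : PoincareOn D Γ hΓ B) (hAB : A ⊆ B) :
    PoincareOn D Γ hΓ A := by
  obtain ⟨C, hC, h⟩ := h
  exact ⟨C, hC, fun w hw => (lintegral_mono_set hAB).trans (h w hw)⟩

lemma PoincareOn.union {A B : Set (E N)} (hA : PoincareOn D Γ hΓ A) (hB : PoincareOn D Γ hΓ B) :
    PoincareOn D Γ hΓ (A ∪ B) := by
  obtain ⟨C, hC, h⟩ := hA
  obtain ⟨C', hC', h'⟩ := hB
  refine ⟨C + C', ENNReal.add_ne_top.mpr ⟨hC, hC'⟩, fun w hw => ?_⟩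
  rw [add_mul]
  exact (lintegral_union_le _ _ _).trans (add_le_add (h w hw) (h' w hw))

/-- A function on `A` differs from its translate by at most a multiple of its gradient norm,
provided the connecting segments stay in `D`. This is how the inequality moves from place to place.
-/
lemma PoincareOn.of_translate (hD : IsOpen D) (hb : Bornology.IsBounded D)
    (hL : HasLipschitzBoundary D) {A : Set (E N)} (hA : MeasurableSet A) {w : E N}
    (hAD : ∀ y ∈ A, ∀ s ∈ Set.Icc (0 : ℝ) 1, y + s • w ∈ D)
    (h : PoincareOn D Γ hΓ ((fun y => y + w) '' A)) : PoincareOn D Γ hΓ A := by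
  obtain ⟨C, hC, h⟩ := h
  refine ⟨2 * C + 2 * ‖w‖ₑ ^ 2, ENNReal.add_ne_top.mpr ⟨ENNReal.mul_ne_top (by simp) hC,
    ENNReal.mul_ne_top (by simp) (by simp)⟩, fun u hu => ?_⟩
  have h1 := H1.lintegral_le_of_C1 hD hb hL (A := A) (B := (fun y => y + w) '' A) (Γ := ∅)
    (fun y hy => by simpa using hAD y hy 0 (by simp))
    (by
      rintro _ ⟨y, hy, rfl⟩
      simpa using hAD y hy 1 (by simp))
    (Set.empty_subset _) (a := 0) (b := 2) (g := 2 * ‖w‖ₑ ^ 2) (by simp) (by simp)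
    (ENNReal.mul_ne_top (by simp) (by simp))
    (fun v hv => by
      rw [zero_mul, zero_add]
      exact hv.lintegral_translate_le hA hAD) u
  rw [zero_mul, zero_add] at h1
  refine h1.trans ?_
  rw [add_mul, mul_assoc 2 C]
  gcongr
  exact h u hu

/-- The source of the inequality: in the collar estimate the boundary term vanishes for zero trace,
leaving only the gradient. -/
lemma BoundaryChart.poincareOn_collar (hD : IsOpen D) (hb : Bornology.IsBounded D)
    (hL : HasLipschitzBoundary D) {x : E N} (c : BoundaryChart D x) (hc : c.piece ⊆ Γ) :
    PoincareOn D Γ hΓ c.collar := by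
  refine ⟨2 * ENNReal.ofReal c.rad ^ 2, ENNReal.mul_ne_top (by simp) (by simp), fun u hu => ?_⟩
  have h1 := H1.lintegral_le_of_C1 hD hb hL c.collar_subset (B := ∅) (Set.empty_subset _)
    (c.piece_subset hD) (a := 2 * ENNReal.ofReal c.rad) (b := 0)
    (g := 2 * ENNReal.ofReal c.rad ^ 2) (ENNReal.mul_ne_top (by simp) (by simp)) (by simp)
    (ENNReal.mul_ne_top (by simp) (by simp))
    (fun v hv => by
      rw [zero_mul, add_zero]
      exact c.lintegral_collar_le hv) u
  have h2 : ∫⁻ y in c.piece, ‖trace D u y‖ₑ ^ 2 ∂(surface N) = 0 := by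
    refine lintegral_eq_zero_of_ae_eq_zero ?_
    have hu' : trace D u =ᵐ[(surface N).restrict Γ] 0 := hu
    filter_upwards [ae_mono (Measure.restrict_mono hc le_rfl) hu'] with y hy
    rw [hy]
    simp
  rwa [h2, mul_zero, zero_mul, zero_add, zero_add] at h1

/-- `PoincareOn` holds near `x`. -/
def PoincareAt (D Γ : Set (E N)) (hΓ : Γ ⊆ frontier D) (x : E N) : Prop :=
  ∃ V ∈ 𝓝 x, PoincareOn D Γ hΓ (V ∩ D)

lemma isOpen_poincareAt : IsOpen {x | PoincareAt D Γ hΓ x} := by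
  rw [isOpen_iff_mem_nhds]
  rintro x ⟨V, hV, h⟩
  filter_upwards [eventually_mem_nhds_iff.mpr hV] with y hy
  exact ⟨V, hy, h⟩

/-- Convexity of the ball keeps the segments of the translation by `z' - z` in `D`. It follows that
the points of `D` without a local inequality form an open set. -/
lemma PoincareAt.of_mem_ball (hD : IsOpen D) (hb : Bornology.IsBounded D)
    (hL : HasLipschitzBoundary D) {z z' : E N} {R : ℝ} (hR : Metric.ball z R ⊆ D)
    (hz' : z' ∈ Metric.ball z R) (h : PoincareAt D Γ hΓ z') : PoincareAt D Γ hΓ z := by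
  obtain ⟨V, hV, h⟩ := h
  obtain ⟨r, hr, hrV⟩ := Metric.mem_nhds_iff.mp
    (Filter.inter_mem hV (Metric.isOpen_ball.mem_nhds hz'))
  have hR0 : 0 < R := dist_nonneg.trans_lt hz'
  have himg : ∀ y ∈ Metric.ball z (min r R), y + (z' - z) ∈ Metric.ball z' r := fun y hy => by
    rw [mem_ball_iff_norm] at hy ⊢
    rw [show y + (z' - z) - z' = y - z by abel]
    exact hy.trans_le (min_le_left _ _)
  have hseg : ∀ y ∈ Metric.ball z (min r R), ∀ s ∈ Set.Icc (0 : ℝ) 1, y + s • (z' - z) ∈ D := by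
    intro y hy s hs
    have h1 := (convex_ball z R).add_smul_sub_mem
      (Metric.ball_subset_ball (min_le_right _ _) hy) (hrV (himg y hy)).2 hs
    rw [add_sub_cancel_left] at h1
    exact hR h1
  refine ⟨Metric.ball z (min r R), Metric.ball_mem_nhds z (lt_min hr hR0),
    (PoincareOn.of_translate hD hb hL Metric.isOpen_ball.measurableSet hseg
      (h.mono ?_)).mono Set.inter_subset_left⟩
  rintro _ ⟨y, hy, rfl⟩
  exact ⟨(hrV (himg y hy)).1, hR (hrV (himg y hy)).2⟩

/-- A small collar, translated by `t` along the transverse direction, lands near an interior point,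
where the inequality is known. This treats boundary points without any boundary condition. -/
lemma BoundaryChart.poincareAt (hD : IsOpen D) (hb : Bornology.IsBounded D)
    (hL : HasLipschitzBoundary D) {x : E N} (c : BoundaryChart D x)
    (h : ∀ y ∈ D, PoincareAt D Γ hΓ y) : PoincareAt D Γ hΓ x := by
  obtain ⟨t, ht, htr⟩ : ∃ t, 0 < t ∧ t < c.rad := exists_between c.rad_pos
  have hadd : ∀ x s s', c.toHomeo (x, s) + s' • c.dir = c.toHomeo (x, s + s') := fun x s s' => by
    rw [c.map_eq x s, c.map_eq x (s + s'), add_smul, add_assoc]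
  obtain ⟨V, hV, hP⟩ := h (c.toHomeo (c.center, t))
    (c.inside _ (Metric.mem_ball_self c.rad_pos) t ⟨ht, htr⟩)
  obtain ⟨r, hr, hball⟩ := Metric.mem_nhds_iff.mp
    (c.toHomeo.continuous.continuousAt.preimage_mem_nhds hV)
  rw [← ball_prod_same] at hball
  obtain ⟨ρ, hρ0, hρ⟩ : ∃ ρ, 0 < ρ ∧ ρ < min r (c.rad - t) :=
    exists_between (lt_min hr (by linarith))
  have hρr := hρ.trans_le (min_le_left _ _)
  have hρt := hρ.trans_le (min_le_right _ _)
  have hsub : Metric.ball c.center ρ ⊆ c.dom := Metric.ball_subset_ball (by linarith)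
  refine ⟨c.toHomeo '' (Metric.ball c.center ρ ×ˢ Set.Ioo (-ρ) ρ), ?_,
    PoincareOn.mono (B := c.toHomeo '' (Metric.ball c.center ρ ×ˢ Set.Ioo 0 ρ)) ?_ ?_⟩
  · exact (c.toHomeo.isOpenMap _ (Metric.isOpen_ball.prod isOpen_Ioo)).mem_nhds
      ⟨(c.center, 0), ⟨Metric.mem_ball_self hρ0, by simp [hρ0]⟩, c.map_center⟩
  · refine PoincareOn.of_translate hD hb hL (w := t • c.dir)
      (c.toHomeo.isOpenMap _ (Metric.isOpen_ball.prod isOpen_Ioo)).measurableSet ?_ (hP.mono ?_)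
    · rintro _ ⟨⟨y, s⟩, ⟨hy, hs⟩, rfl⟩ s' hs'
      rw [smul_smul, hadd]
      exact c.inside y (hsub hy) _ ⟨by nlinarith [hs.1, hs'.1], by nlinarith [hs.2, hs'.2, hs'.1]⟩
    · rintro _ ⟨_, ⟨⟨y, s⟩, ⟨hy, hs⟩, rfl⟩, rfl⟩
      change c.toHomeo (y, s) + t • c.dir ∈ _
      rw [hadd]
      refine ⟨hball ⟨Metric.ball_subset_ball hρr.le hy, ?_⟩,
        c.inside y (hsub hy) _ ⟨by linarith [hs.1], by linarith [hs.2]⟩⟩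
      rw [Metric.mem_ball, Real.dist_eq, add_sub_cancel_right, abs_of_pos hs.1]
      exact hs.2.trans hρr
  · rintro _ ⟨⟨⟨y, s⟩, ⟨hy, hs⟩, rfl⟩, hyD⟩
    refine ⟨(y, s), ⟨hy, ?_, hs.2⟩, rfl⟩
    by_contra hneg
    exact c.outside y (hsub hy) s ⟨by linarith [hs.1], not_lt.mp hneg⟩ hyD

/-- The Poincaré inequality for functions which vanish on a part of the boundary that touches every
connected component. -/
lemma poincareOn_self (hD : IsOpen D) (hb : Bornology.IsBounded D)
    (hL : HasLipschitzBoundary D)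
    (hcomp : ∀ x ∈ D, ∃ y ∈ closure (connectedComponentIn D x),
      ∃ c : BoundaryChart D y, c.piece ⊆ Γ) : PoincareOn D Γ hΓ D := by
  have hin : ∀ x ∈ D, PoincareAt D Γ hΓ x := by
    intro x hx
    obtain ⟨y, hy, c, hc⟩ := hcomp x hx
    have hy' : PoincareAt D Γ hΓ y := ⟨c.nhd, c.isOpen_nhd.mem_nhds c.mem_nhd,
      (c.poincareOn_collar hD hb hL hc).mono c.nhd_inter_subset⟩
    obtain ⟨z, hzP, hzC⟩ := mem_closure_iff.mp hy _ isOpen_poincareAt hy'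
    -- The good and the bad points of `D` are both open; a component, being connected and having a
    -- good point near `y`, is entirely good.
    have hopen : IsOpen {x | x ∈ D ∧ ¬ PoincareAt D Γ hΓ x} := by
      rw [isOpen_iff_mem_nhds]
      rintro z ⟨hz, hzP⟩
      obtain ⟨R, hR, hRD⟩ := Metric.isOpen_iff.mp hD z hz
      filter_upwards [Metric.ball_mem_nhds z hR] with z' hz'
      exact ⟨hRD hz', fun h => hzP (h.of_mem_ball hD hb hL hRD hz')⟩
    refine isPreconnected_connectedComponentIn.subset_left_of_subset_union isOpen_poincareAt hopen
      (Set.disjoint_left.mpr fun a ha ha' => ha'.2 ha) (fun a ha => ?_) ⟨z, hzC, hzP⟩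
      (mem_connectedComponentIn hx)
    by_cases h : PoincareAt D Γ hΓ a
    · exact Or.inl h
    · exact Or.inr ⟨connectedComponentIn_subset _ _ ha, h⟩
  have hcl : ∀ x ∈ closure D, PoincareAt D Γ hΓ x := by
    intro x hx
    by_cases hxD : x ∈ D
    · exact hin x hxD
    · obtain ⟨c, -⟩ := hL.exists_chart hD ⟨hx, by rwa [hD.interior_eq]⟩ univ_mem
      exact c.poincareAt hD hb hL hin
  have h := hb.isCompact_closure.induction_on (p := fun S => PoincareOn D Γ hΓ (S ∩ D))
    ⟨0, by simp, fun w _ => by simp⟩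
    (fun s t hst ht => ht.mono (Set.inter_subset_inter_left _ hst))
    (fun s t hs ht => by
      rw [Set.union_inter_distrib_right]
      exact hs.union ht)
    (fun x hx => by
      obtain ⟨V, hV, h⟩ := hcl x hx
      exact ⟨V, mem_nhdsWithin_of_mem_nhds hV, h⟩)
  rwa [Set.inter_eq_self_of_subset_right subset_closure] at h

end Poincare

/-! ### Boundary charts inside the Dirichlet part -/

section Dirichlet

variable {N : ℕ}

lemma mem_relInterior {B A : Set (E N)} {x : E N} :
    x ∈ relInterior B A ↔ x ∈ B ∧ ∃ O, IsOpen O ∧ x ∈ O ∧ O ∩ B ⊆ A := by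
  constructor
  · rintro ⟨y, hy, rfl⟩
    obtain ⟨t, ht, ⟨O, hO, rfl⟩, hyt⟩ := mem_interior.mp hy
    exact ⟨y.2, O, hO, hyt, fun z hz => ht (show (⟨z, hz.2⟩ : B) ∈ _ from hz.1)⟩
  · rintro ⟨hxB, O, hO, hxO, hsub⟩
    exact ⟨⟨x, hxB⟩, mem_interior.mpr ⟨Subtype.val ⁻¹' O, fun z hz => hsub ⟨hz, z.2⟩,
      hO.preimage continuous_subtype_val, hxO⟩, rfl⟩

/-- Near the relative interior in `bdry Ω` of `bdry D ∩ bdry Ω`, the boundaries coincide. -/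
lemma exists_chart_piece_subset {Ω D : Set (E N)} (hΩ : IsOpen Ω) (hLΩ : HasLipschitzBoundary Ω)
    (hD : IsOpen D) (hL : HasLipschitzBoundary D) (hsub : D ⊆ Ω) {y : E N}
    (hy : y ∈ relInterior (frontier Ω) (frontier D ∩ frontier Ω)) :
    ∃ c : BoundaryChart D y, c.piece ⊆ relInterior (frontier Ω) (frontier D ∩ frontier Ω) := by
  obtain ⟨hyΩ, O, hO, hyO, hOA⟩ := mem_relInterior.mp hy
  obtain ⟨c, hc⟩ := hL.exists_chart hD (hOA ⟨hyO, hyΩ⟩).1 (hO.mem_nhds hyO)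
  refine ⟨c, ?_⟩
  have hcO : ∀ p ∈ c.nhd, p ∈ O := by
    rintro _ ⟨⟨x, s⟩, ⟨hx, hs⟩, rfl⟩
    exact hc x hx s hs
  suffices h : c.piece ⊆ frontier Ω by
    intro p hp
    exact mem_relInterior.mpr ⟨h hp, O, hO, hcO p (c.piece_subset_nhd hp), hOA⟩
  -- Inside `O`, boundary points of `Ω` are boundary points of `D`, and the region below the graph
  -- contains none of the latter. Being connected, it lies in `Ω` or outside its closure.
  have hlow : IsPreconnected (c.toHomeo '' (c.dom ×ˢ Set.Ioo (-c.rad) 0)) :=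
    ((convex_ball _ _).isPreconnected.prod isPreconnected_Ioo).image _
      c.toHomeo.continuous.continuousOn
  have hcover : c.toHomeo '' (c.dom ×ˢ Set.Ioo (-c.rad) 0) ⊆ Ω ∪ (closure Ω)ᶜ := by
    rintro _ ⟨⟨x, s⟩, ⟨hx, hs⟩, rfl⟩
    by_contra h
    rw [Set.mem_union, not_or, Set.notMem_compl_iff] at h
    have hf : c.toHomeo (x, s) ∈ frontier Ω := ⟨h.2, by rw [hΩ.interior_eq]; exact h.1⟩
    have h2 := hOA ⟨hc x hx s ⟨hs.1, hs.2.trans c.rad_pos⟩, hf⟩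
    exact c.notMem_closure hx hs h2.1.1
  have hdisj : Disjoint Ω (closure Ω)ᶜ :=
    Set.disjoint_left.mpr fun a ha ha' => ha' (subset_closure ha)
  have hpcl : c.piece ⊆ closure Ω := fun p hp =>
    closure_mono hsub (frontier_subset_closure (c.piece_subset hD hp))
  by_cases hmeet : (c.toHomeo '' (c.dom ×ˢ Set.Ioo (-c.rad) 0) ∩ Ω).Nonempty
  · exfalso
    have h1 := hlow.subset_left_of_subset_union hΩ isClosed_closure.isOpen_compl hdisj hcover hmeet
    -- If the lower region were in `Ω`, the neighborhood of `y` would lie in the closure of `Ω`; the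
    -- Lipschitz boundary of `Ω` provides a nearby point outside this closure.
    obtain ⟨c', hc'⟩ := hLΩ.exists_chart hΩ hyΩ (c.isOpen_nhd.mem_nhds c.mem_nhd)
    have hr := c'.rad_pos
    have h2 := c'.notMem_closure (Metric.mem_ball_self hr) (s := -(c'.rad / 2))
      ⟨by linarith, by linarith⟩
    obtain ⟨⟨x, s⟩, ⟨hx, hs⟩, he⟩ := hc' c'.center (Metric.mem_ball_self hr) (-(c'.rad / 2))
      ⟨by linarith, by linarith⟩
    rw [← he] at h2
    rcases lt_trichotomy s 0 with h | rfl | h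
    · exact h2 (subset_closure (h1 ⟨(x, s), ⟨hx, hs.1, h⟩, rfl⟩))
    · exact h2 (hpcl ⟨x, hx, rfl⟩)
    · exact h2 (subset_closure (hsub (c.inside x hx s ⟨h, hs.2⟩)))
  · rintro _ ⟨x, hx, rfl⟩
    refine ⟨hpcl ⟨x, hx, rfl⟩, ?_⟩
    rw [hΩ.interior_eq]
    intro hxΩ
    have h3 : Continuous fun s : ℝ => c.toHomeo (x, s) := by fun_prop
    have h4 : (0 : ℝ) ∈ closure (Set.Ioo (-c.rad) 0) := by
      rw [closure_Ioo (by linarith [c.rad_pos] : -c.rad < 0).ne]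
      exact ⟨by linarith [c.rad_pos], le_rfl⟩
    obtain ⟨s, hsΩ, hs⟩ := mem_closure_iff.mp h4 _ (hΩ.preimage h3) hxΩ
    exact hmeet ⟨_, ⟨(x, s), ⟨hx, hs⟩, rfl⟩, hsΩ⟩

end Dirichlet

/-! ### The half-step with abstract coupling operators -/

section HalfStep

variable {ι κ : Type*} [Fintype ι] [Fintype κ] {H : ι → Type*} {G : κ → Type*}
  [∀ i, SeminormedAddCommGroup (H i)] [∀ i, InnerProductSpace ℝ (H i)]
  [∀ k, SeminormedAddCommGroup (G k)] [∀ k, InnerProductSpace ℝ (G k)]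

open Classical in
/-- The primal-dual proximal step in a direct sum, with the coupling operator `J` and its adjoint
`R`. -/
noncomputable def primalDualHalfStep (J : (∀ i, H i) → ∀ k, G k) (R : (∀ k, G k) → ∀ i, H i)
    (φ : ∀ i, H i → EReal) (ψ : ∀ k, G k → EReal) (γ μ lam : ℝ)
    (x : (∀ i, H i) × (∀ k, G k)) : (∀ i, H i) × (∀ k, G k) :=
  let u := x.1
  let g := x.2
  let v : ∀ i, H i := fun i => u i - γ • R g i
  let p : ∀ i, H i := fun i => prox (scale γ (φ i)) (v i)
  let l : ∀ k, G k := J u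
  let q : ∀ k, G k := fun k => prox (scale μ (ψ k)) (l k + μ • g k)
  let t : ∀ k, G k := fun k => q k - J p k
  let s : ∀ i, H i := fun i => γ⁻¹ • (u i - p i) + μ⁻¹ • R (fun k => l k - q k) i
  let τ : ℝ := ∑ i, ‖s i‖ ^ 2 + ∑ k, ‖t k‖ ^ 2
  let θ : ℝ := if τ = 0 then 0 else
    lam * (γ⁻¹ * ∑ i, ‖u i - p i‖ ^ 2 + μ⁻¹ * ∑ k, ‖l k - q k‖ ^ 2) / τ
  (fun i => u i - θ • s i, fun k => g k - θ • t k)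

end HalfStep

/-! ### Transfer to the Hilbert direct sum -/

section DirectSum

set_option linter.unusedSectionVars false

variable {ι κ : Type*} [Fintype ι] [Fintype κ] {H : ι → Type*} {G : κ → Type*}
  [∀ i, NormedAddCommGroup (H i)] [∀ i, InnerProductSpace ℝ (H i)]
  [∀ k, NormedAddCommGroup (G k)] [∀ k, InnerProductSpace ℝ (G k)]

/-- The element of the Hilbert direct sum given by two families. -/
def toDirectSum (x : (∀ i, H i) × (∀ k, G k)) : WithLp 2 (PiLp 2 H × PiLp 2 G) :=
  WithLp.toLp 2 (WithLp.toLp 2 x.1, WithLp.toLp 2 x.2)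

lemma inner_toDirectSum (x y : (∀ i, H i) × (∀ k, G k)) :
    (inner ℝ (toDirectSum x) (toDirectSum y) : ℝ) = sumInner x y := by
  rw [WithLp.prod_inner_apply, PiLp.inner_apply, PiLp.inner_apply]
  rfl

lemma norm_toDirectSum_sq (x : (∀ i, H i) × (∀ k, G k)) :
    ‖toDirectSum x‖ ^ 2 = sumNormSq x := by
  rw [WithLp.prod_norm_sq_eq_of_L2, PiLp.norm_sq_eq_of_L2, PiLp.norm_sq_eq_of_L2]
  rfl

lemma toDirectSum_sub (x y : (∀ i, H i) × (∀ k, G k)) :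
    toDirectSum (x - y) = toDirectSum x - toDirectSum y := rfl

lemma toDirectSum_add (x y : (∀ i, H i) × (∀ k, G k)) :
    toDirectSum (x + y) = toDirectSum x + toDirectSum y := rfl

lemma toDirectSum_smul (a : ℝ) (x : (∀ i, H i) × (∀ k, G k)) :
    toDirectSum (a • x) = a • toDirectSum x := rfl

lemma toDirectSum_haugazeau (x₀ x y : (∀ i, H i) × (∀ k, G k)) :
    toDirectSum (haugazeau x₀ x y)
      = haugazeauUpdate (toDirectSum x₀) (toDirectSum x) (toDirectSum y) := by
  simp only [haugazeau, haugazeauUpdate, ← toDirectSum_sub, inner_toDirectSum,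
    norm_toDirectSum_sq, ← toDirectSum_smul, ← toDirectSum_add]
  split_ifs <;> rfl

lemma toDirectSum_surjective (z : WithLp 2 (PiLp 2 H × PiLp 2 G)) :
    ∃ x, toDirectSum x = z :=
  ⟨(z.fst.ofLp, z.snd.ofLp), rfl⟩

lemma toDirectSum_injective {x y : (∀ i, H i) × (∀ k, G k)} (h : toDirectSum x = toDirectSum y) :
    x = y := by
  have h1 : (toDirectSum x).fst = (toDirectSum y).fst := by rw [h]
  have h2 : (toDirectSum x).snd = (toDirectSum y).snd := by rw [h]
  exact Prod.ext (congrArg WithLp.ofLp h1) (congrArg WithLp.ofLp h2)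

variable [∀ i, CompleteSpace (H i)] [∀ k, CompleteSpace (G k)]

/-- The coupling operator between the Hilbert direct sums. -/
noncomputable def directSumMap (J : (∀ i, H i) →L[ℝ] ∀ k, G k) : PiLp 2 H →L[ℝ] PiLp 2 G :=
  ((PiLp.continuousLinearEquiv 2 ℝ G).symm.toContinuousLinearMap.comp J).comp
    (PiLp.continuousLinearEquiv 2 ℝ H).toContinuousLinearMap

lemma directSumMap_apply (J : (∀ i, H i) →L[ℝ] ∀ k, G k) (u : PiLp 2 H) :
    directSumMap J u = WithLp.toLp 2 (J u.ofLp) := rfl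

lemma adjoint_directSumMap {J : (∀ i, H i) →L[ℝ] ∀ k, G k} {R : (∀ k, G k) → ∀ i, H i}
    (hR : ∀ g v, ∑ i, (inner ℝ (R g i) (v i) : ℝ) = ∑ k, (inner ℝ (g k) (J v k) : ℝ))
    (g : PiLp 2 G) : (directSumMap J).adjoint g = WithLp.toLp 2 (R g.ofLp) := by
  refine ext_inner_right ℝ fun v => ?_
  rw [ContinuousLinearMap.adjoint_inner_left, PiLp.inner_apply, PiLp.inner_apply]
  exact (hR g.ofLp v.ofLp).symm

lemma pi_subdifferential_monotone {φ : ∀ i, H i → EReal} (hφ : ∀ i, Gamma0 (φ i))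
    (p a p' a' : PiLp 2 H) (ha : ∀ i, a i ∈ subdifferential (φ i) (p i))
    (ha' : ∀ i, a' i ∈ subdifferential (φ i) (p' i)) :
    0 ≤ (inner ℝ (p - p') (a - a') : ℝ) := by
  rw [PiLp.inner_apply]
  exact Finset.sum_nonneg fun i _ => subdifferential_monotone (hφ i) (ha i) (ha' i)

lemma exists_pi_resolvent {φ : ∀ i, H i → EReal} (hφ : ∀ i, Gamma0 (φ i)) (x : PiLp 2 H) :
    ∃ p : PiLp 2 H, ∀ i, (x - p) i ∈ subdifferential (φ i) (p i) := by
  refine ⟨WithLp.toLp 2 fun i => prox (scale 1 (φ i)) (x i), fun i => ?_⟩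
  have h := prox_mem_subdifferential (hφ i) one_pos (x i)
  rw [inv_one, one_smul] at h
  exact h

/-- The variational inequality gives a Pythagorean inequality, whose extra square yields both
minimality and uniqueness; convexity of `Z` plays no role. -/
lemma isBestApprox_of_inner_le {Z : Set ((∀ i, H i) × (∀ k, G k))}
    {x₀ z : (∀ i, H i) × (∀ k, G k)} (hz : z ∈ Z)
    (h : ∀ w ∈ Z, (inner ℝ (toDirectSum w - toDirectSum z) (toDirectSum x₀ - toDirectSum z) : ℝ)
      ≤ 0) :
    IsBestApprox Z x₀ z ∧ ∀ z', IsBestApprox Z x₀ z' → z' = z := by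
  have key : ∀ w ∈ Z, sumNormSq (x₀ - z) + ‖toDirectSum w - toDirectSum z‖ ^ 2
      ≤ sumNormSq (x₀ - w) := by
    intro w hw
    have h1 : toDirectSum (x₀ - w)
        = (toDirectSum x₀ - toDirectSum z) - (toDirectSum w - toDirectSum z) := by
      rw [toDirectSum_sub]
      abel
    have h2 := norm_sub_sq_real (toDirectSum x₀ - toDirectSum z) (toDirectSum w - toDirectSum z)
    rw [real_inner_comm] at h2
    rw [← norm_toDirectSum_sq, ← norm_toDirectSum_sq, h1, h2, toDirectSum_sub]
    linarith [h w hw]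
  refine ⟨⟨hz, fun w hw => ?_⟩, fun z' hz' => ?_⟩
  · linarith [key w hw, sq_nonneg ‖toDirectSum w - toDirectSum z‖]
  · have h1 := key z' hz'.1
    have h2 := hz'.2 z hz
    have h3 : ‖toDirectSum z' - toDirectSum z‖ ^ 2 ≤ 0 := by linarith
    have h4 : ‖toDirectSum z' - toDirectSum z‖ = 0 := by
      nlinarith [norm_nonneg (toDirectSum z' - toDirectSum z)]
    exact toDirectSum_injective (sub_eq_zero.mp (norm_eq_zero.mp h4))

/-- Strong convergence of the primal-dual algorithm in a direct sum. -/
theorem directSum_tendsto {J : (∀ i, H i) →L[ℝ] ∀ k, G k} {R : (∀ k, G k) → ∀ i, H i}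
    (hR : ∀ g v, ∑ i, (inner ℝ (R g i) (v i) : ℝ) = ∑ k, (inner ℝ (g k) (J v k) : ℝ))
    {φ : ∀ i, H i → EReal} {ψ : ∀ k, G k → EReal} (hφ : ∀ i, Gamma0 (φ i))
    (hψ : ∀ k, Gamma0 (ψ k)) {Z : Set ((∀ i, H i) × (∀ k, G k))}
    (hZ : Z = {x | (∀ k, x.2 k ∈ subdifferential (ψ k) (J x.1 k)) ∧
      ∀ i, - R x.2 i ∈ subdifferential (φ i) (x.1 i)}) (hne : Z.Nonempty)
    {ε : ℝ} (hε : 0 < ε) {γ μ lam : ℕ → ℝ} (hγ : ∀ n, γ n ∈ Set.Icc ε (1 / ε))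
    (hμ : ∀ n, μ n ∈ Set.Icc ε (1 / ε)) (hlam : ∀ n, lam n ∈ Set.Icc ε 1)
    {x : ℕ → (∀ i, H i) × (∀ k, G k)}
    (hx : ∀ n, x (n + 1) = haugazeau (x 0) (x n)
      (primalDualHalfStep J R φ ψ (γ n) (μ n) (lam n) (x n))) :
    ∃ z, IsBestApprox Z (x 0) z ∧ (∀ z', IsBestApprox Z (x 0) z' → z' = z) ∧
      (∀ i, Tendsto (fun n => (x n).1 i) atTop (𝓝 (z.1 i))) ∧
      (∀ k, Tendsto (fun n => (x n).2 k) atTop (𝓝 (z.2 k))) := by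
  have hinv : ∀ {a : ℝ}, a ∈ Set.Icc ε (1 / ε) → a⁻¹ ∈ Set.Icc ε (1 / ε) := fun {a} ha => by
    have ha0 : 0 < a := hε.trans_le ha.1
    constructor
    · rw [le_inv_comm₀ hε ha0, ← one_div]
      exact ha.2
    · rw [one_div]
      exact inv_anti₀ hε ha.1
  obtain ⟨A, hA⟩ : ∃ A : PiLp 2 H → Set (PiLp 2 H),
      A = fun u => {a | ∀ i, a i ∈ subdifferential (φ i) (u i)} := ⟨_, rfl⟩
  obtain ⟨B, hB⟩ : ∃ B : PiLp 2 G → Set (PiLp 2 G),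
      B = fun u => {a | ∀ k, a k ∈ subdifferential (ψ k) (u k)} := ⟨_, rfl⟩
  have hZX : ∀ y, toDirectSum y ∈ operatorKuhnTucker A B (directSumMap J) ↔ y ∈ Z := by
    intro y
    rw [operatorKuhnTucker, Set.mem_ofPred_eq, adjoint_directSumMap hR, directSumMap_apply, hA, hB,
      hZ, and_comm]
    rfl
  obtain ⟨p, hp⟩ : ∃ p : ℕ → ∀ i, H i, p = fun n i =>
    prox (scale (γ n) (φ i)) ((x n).1 i - γ n • R (x n).2 i) := ⟨_, rfl⟩
  obtain ⟨q, hq⟩ : ∃ q : ℕ → ∀ k, G k, q = fun n k =>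
    prox (scale (μ n) (ψ k)) (J (x n).1 k + μ n • (x n).2 k) := ⟨_, rfl⟩
  obtain ⟨r, hr⟩ : ∃ r : ℕ → (∀ i, H i) × (∀ k, G k), r = fun n =>
    (fun i => (γ n)⁻¹ • ((x n).1 i - p n i) + (μ n)⁻¹ • R (fun k => J (x n).1 k - q n k) i,
      fun k => q n k - J (p n) k) := ⟨_, rfl⟩
  obtain ⟨θ, hθ⟩ : ∃ θ : ℕ → ℝ, θ = fun n => if sumNormSq (r n) = 0 then 0 else
    lam n * ((γ n)⁻¹ * ∑ i, ‖(x n).1 i - p n i‖ ^ 2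
      + (μ n)⁻¹ * ∑ k, ‖J (x n).1 k - q n k‖ ^ 2) / sumNormSq (r n) := ⟨_, rfl⟩
  have hhalf : ∀ n, primalDualHalfStep J R φ ψ (γ n) (μ n) (lam n) (x n) = x n - θ n • r n := by
    intro n
    rw [hθ, hr, hp, hq]
    rfl
  have hnormH : ∀ a b : ∀ i, H i, ∑ i, ‖a i - b i‖ ^ 2
      = ‖(WithLp.toLp 2 a : PiLp 2 H) - WithLp.toLp 2 b‖ ^ 2 := fun a b => by
    rw [PiLp.norm_sq_eq_of_L2]
    rfl
  have hnormG : ∀ a b : ∀ k, G k, ∑ k, ‖a k - b k‖ ^ 2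
      = ‖(WithLp.toLp 2 a : PiLp 2 G) - WithLp.toLp 2 b‖ ^ 2 := fun a b => by
    rw [PiLp.norm_sq_eq_of_L2]
    rfl
  have hne' : (operatorKuhnTucker A B (directSumMap J)).Nonempty := by
    obtain ⟨y, hy⟩ := hne
    exact ⟨toDirectSum y, (hZX y).mpr hy⟩
  have hmonA : ∀ p a p' a', a ∈ A p → a' ∈ A p' → 0 ≤ (inner ℝ (p - p') (a - a') : ℝ) := by
    rw [hA]
    exact pi_subdifferential_monotone hφ
  have hmonB : ∀ p a p' a', a ∈ B p → a' ∈ B p' → 0 ≤ (inner ℝ (p - p') (a - a') : ℝ) := by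
    rw [hB]
    exact pi_subdifferential_monotone hψ
  have hresA : ∀ x, ∃ p, x - p ∈ A p := by
    rw [hA]
    exact exists_pi_resolvent hφ
  have hresB : ∀ x, ∃ p, x - p ∈ B p := by
    rw [hB]
    exact exists_pi_resolvent hψ
  -- The abstract scheme is used with the inverse parameters; the interval from `ε` to `1 / ε` is
  -- stable under inversion.
  obtain ⟨z, hz, hproj, hlim⟩ := primalDual_tendsto (L := directSumMap J) hmonA hmonB hresA hresB
    hne' hε (c := fun n => (γ n)⁻¹) (d := fun n => (μ n)⁻¹) (lam := lam)
    (x := fun n => toDirectSum (x n)) (p := fun n => WithLp.toLp 2 (p n))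
    (q := fun n => WithLp.toLp 2 (q n)) (r := fun n => toDirectSum (r n)) (θ := θ)
    (fun n => hinv (hγ n)) (fun n => hinv (hμ n)) hlam
    (fun n => by
      rw [adjoint_directSumMap hR, hA, hp]
      intro i
      have hγ0 : 0 < γ n := hε.trans_le (hγ n).1
      have h := prox_mem_subdifferential (hφ i) hγ0 ((x n).1 i - γ n • R (x n).2 i)
      rw [sub_right_comm, smul_sub, smul_smul, inv_mul_cancel₀ hγ0.ne', one_smul] at h
      exact h)
    (fun n => by
      rw [directSumMap_apply, hB, hq]
      intro k
      have hμ0 : 0 < μ n := hε.trans_le (hμ n).1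
      have h := prox_mem_subdifferential (hψ k) hμ0 (J (x n).1 k + μ n • (x n).2 k)
      rw [add_sub_right_comm, smul_add, smul_smul, inv_mul_cancel₀ hμ0.ne', one_smul,
        add_comm (_ • (_ - _))] at h
      exact h)
    (fun n => by
      rw [adjoint_directSumMap hR, directSumMap_apply, directSumMap_apply, hr]
      rfl)
    (fun n => by
      simp only [norm_toDirectSum_sq, directSumMap_apply]
      rw [hθ]
      simp only [hnormH, hnormG]
      rfl)
    (fun n => by
      rw [hx n, hhalf n, toDirectSum_haugazeau]
      rfl)
  obtain ⟨z, rfl⟩ := toDirectSum_surjective z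
  obtain ⟨h1, h2⟩ := isBestApprox_of_inner_le ((hZX z).mp hz)
    (fun w hw => hproj _ ((hZX w).mpr hw))
  refine ⟨z, h1, h2, fun i => ?_, fun k => ?_⟩
  · have h3 : Continuous fun y : WithLp 2 (PiLp 2 H × PiLp 2 G) => y.fst i := by fun_prop
    exact h3.continuousAt.tendsto.comp hlim
  · have h3 : Continuous fun y : WithLp 2 (PiLp 2 H × PiLp 2 G) => y.snd k := by fun_prop
    exact h3.continuousAt.tendsto.comp hlim

end DirectSum

/-! ### The energy space as a Hilbert space -/

section Energy

variable {N : ℕ} {D Γ : Set (E N)} {hΓ : Γ ⊆ frontier D}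

lemma isClosed_zeroTrace : IsClosed (zeroTrace D Γ hΓ : Set (H1 D)) := by
  have h : (zeroTrace D Γ hΓ : Set (H1 D))
      = {w | ∫⁻ y in Γ, ‖trace D w y‖ₑ ^ 2 ∂(surface N) = 0} := by
    ext w
    have hm : AEMeasurable (fun y => ‖trace D w y‖ₑ ^ 2) ((surface N).restrict Γ) :=
      (((Lp.aestronglyMeasurable (trace D w)).mono_measure
        (Measure.restrict_mono hΓ le_rfl)).enorm).pow_const 2
    rw [Set.mem_ofPred_eq, lintegral_eq_zero_iff' hm]
    change trace D w =ᵐ[(surface N).restrict Γ] 0 ↔ _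
    refine eventually_congr (Eventually.of_forall fun y => ?_)
    simp
  rw [h]
  exact isClosed_singleton.preimage (continuous_lintegral_trace hΓ)

lemma EnergySpace.enorm_sq (u : EnergySpace D Γ hΓ) :
    ‖u‖ₑ ^ 2 = ∫⁻ y in D, ‖u.toH1.1.snd y‖ₑ ^ 2 := by
  rw [← Lp_enorm_sq]
  rfl

/-- With the trivial converse bound, this makes the energy norm and the `H¹` norm equivalent;
definiteness, completeness and continuity of traces follow from it. -/
lemma EnergySpace.exists_norm_toH1_le (hP : PoincareOn D Γ hΓ D) :
    ∃ C : ℝ, ∀ u : EnergySpace D Γ hΓ, ‖u.toH1‖ ≤ C * ‖u‖ := by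
  obtain ⟨C, hC, h⟩ := hP
  refine ⟨_, fun u => norm_le_of_enorm_sq_le
    (ENNReal.add_ne_top.mpr ⟨hC, ENNReal.one_ne_top⟩ : C + 1 ≠ ⊤) ?_⟩
  have h1 := h u.toH1 u.2
  rw [H1.enorm_sq, EnergySpace.enorm_sq, add_mul, one_mul]
  exact add_le_add h1 le_rfl

lemma EnergySpace.norm_le_norm_toH1 (u : EnergySpace D Γ hΓ) : ‖u‖ ≤ ‖u.toH1‖ := by
  change ‖u.toH1.1.snd‖ ≤ ‖u.toH1.1‖
  exact WithLp.norm_snd_le _ _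

lemma EnergySpace.eq_zero_of_norm_eq_zero (hP : PoincareOn D Γ hΓ D) (u : EnergySpace D Γ hΓ)
    (hu : ‖u‖ = 0) : u = 0 := by
  obtain ⟨C, h⟩ := EnergySpace.exists_norm_toH1_le hP
  have h1 := h u
  rw [hu, mul_zero] at h1
  exact Subtype.ext (norm_le_zero_iff.mp h1)

lemma EnergySpace.completeSpace (hP : PoincareOn D Γ hΓ D) :
    CompleteSpace (EnergySpace D Γ hΓ) := by
  obtain ⟨C, h⟩ := EnergySpace.exists_norm_toH1_le hP
  have hanti : AntilipschitzWith 1 (EnergySpace.toH1 : EnergySpace D Γ hΓ →ₗ[ℝ] H1 D) :=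
    AddMonoidHomClass.antilipschitz_of_bound _ fun u => by
      rw [NNReal.coe_one, one_mul]
      exact u.norm_le_norm_toH1
  have huc : UniformContinuous (EnergySpace.toH1 : EnergySpace D Γ hΓ →ₗ[ℝ] H1 D) :=
    (AddMonoidHomClass.uniformContinuous_of_bound _ C h)
  refine (hanti.isUniformInducing huc).completeSpace ?_
  have hr : Set.range (EnergySpace.toH1 : EnergySpace D Γ hΓ →ₗ[ℝ] H1 D)
      = (zeroTrace D Γ hΓ : Set (H1 D)) := Subtype.range_coe
  rw [hr]
  exact isClosed_zeroTrace.isComplete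

/-- The Riesz representation theorem, under the hypothesis that the seminorm is a norm. -/
lemma exists_riesz {H : Type*} [SeminormedAddCommGroup H] [InnerProductSpace ℝ H]
    [CompleteSpace H] (hsep : ∀ u : H, ‖u‖ = 0 → u = 0) (ℓ : H →L[ℝ] ℝ) :
    ∃ u : H, ∀ v, (inner ℝ u v : ℝ) = ℓ v := by
  let : NormedAddCommGroup H := NormedAddCommGroup.ofSeparation hsep
  exact ⟨(InnerProductSpace.toDual ℝ H).symm ℓ, fun v =>
    InnerProductSpace.toDual_symm_apply⟩

end Energy

/-! ### Restriction between spaces of surface functions -/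

section Restriction

variable {N : ℕ}

lemma restrictSurf_coeFn {A B : Set (E N)} (h : A ⊆ B) (w : L2surf B) :
    restrictSurf h w =ᵐ[(surface N).restrict A] w :=
  MemLp.coeFn_toLp _

/-- Restriction as a bounded linear operator. -/
noncomputable def restrictSurfL {A B : Set (E N)} (h : A ⊆ B) : L2surf B →L[ℝ] L2surf A :=
  LinearMap.mkContinuous
    { toFun := restrictSurf h
      map_add' := fun f g => by
        refine Lp.ext ?_
        have h1 := ae_mono (Measure.restrict_mono h le_rfl) (Lp.coeFn_add f g)
        filter_upwards [restrictSurf_coeFn h (f + g), restrictSurf_coeFn h f,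
          restrictSurf_coeFn h g, Lp.coeFn_add (restrictSurf h f) (restrictSurf h g), h1]
          with y e1 e2 e3 e4 e5
        rw [e1, e4, e5, Pi.add_apply, Pi.add_apply, e2, e3]
      map_smul' := fun a f => by
        refine Lp.ext ?_
        have h1 := ae_mono (Measure.restrict_mono h le_rfl) (Lp.coeFn_smul a f)
        filter_upwards [restrictSurf_coeFn h (a • f), restrictSurf_coeFn h f,
          Lp.coeFn_smul a (restrictSurf h f), h1] with y e1 e2 e3 e4
        rw [e1, e4, RingHom.id_apply, e3, Pi.smul_apply, Pi.smul_apply, e2] } 1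
    (fun f => by
      rw [one_mul]
      change ‖restrictSurf h f‖ ≤ ‖f‖
      rw [restrictSurf, Lp.norm_toLp, Lp.norm_def]
      exact ENNReal.toReal_mono (Lp.eLpNorm_ne_top f)
        (eLpNorm_mono_measure _ (Measure.restrict_mono h le_rfl)))

/-- `Υ i j` and `Υ j i` are equal but not definitionally, so the identification of their `L²` spaces
must be shown to be compatible with inner products. -/
lemma inner_restrictSurf_eq {A B : Set (E N)} (h : A = B) (f : L2surf B) (g : L2surf A) :
    (inner ℝ (restrictSurf h.subset f) g : ℝ) = inner ℝ f (restrictSurf h.symm.subset g) := by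
  subst h
  have h1 : ∀ w : L2surf A, restrictSurf subset_rfl w = w := fun w =>
    Lp.ext (restrictSurf_coeFn subset_rfl w)
  rw [h1, h1]

end Restriction

/-! ### Traces, solution operators and jumps of the decomposition -/

section Operators

variable {N m : ℕ} {Ω : Set (E N)} {D : Fin m → Set (E N)}

lemma IsDecomposition.isBounded_sub (hD : IsDecomposition Ω D) (i : Fin m) :
    Bornology.IsBounded (D i) :=
  hD.isBounded.subset (hD.sub_subset i)

lemma IsDecomposition.poincareOn (hD : IsDecomposition Ω D) (i : Fin m) :
    PoincareOn (D i) (Interface Ω D i i) (interface_subset Ω D i i) (D i) := by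
  refine poincareOn_self (hD.isOpen_sub i) (hD.isBounded_sub i) (hD.lipschitz_sub i)
    fun x hx => ?_
  obtain ⟨y, hy, hyI⟩ := hD.component i x hx
  have hI : Interface Ω D i i = relInterior (frontier Ω) (frontier (D i) ∩ frontier Ω) := if_pos rfl
  rw [hI] at hyI
  rw [hI]
  exact ⟨y, hy, exists_chart_piece_subset hD.isOpen hD.lipschitz (hD.isOpen_sub i)
    (hD.lipschitz_sub i) (hD.sub_subset i) hyI⟩

variable (Ω D) in
/-- The trace operator `T i j` as a linear map. -/
noncomputable def traceMap (i j : Fin m) : H Ω D i →ₗ[ℝ] L2surf (Interface Ω D i j) :=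
  ((restrictSurfL (interface_subset Ω D i j)).comp (trace (D i))).toLinearMap ∘ₗ
    EnergySpace.toH1

lemma IsDecomposition.continuous_traceMap (hD : IsDecomposition Ω D) (i j : Fin m) :
    Continuous (traceMap Ω D i j) := by
  obtain ⟨C, h⟩ := EnergySpace.exists_norm_toH1_le (hD.poincareOn i)
  exact ((restrictSurfL (interface_subset Ω D i j)).comp (trace (D i))).continuous.comp
    (AddMonoidHomClass.continuous_of_bound EnergySpace.toH1 C h)

/-- The right-hand side is continuous in `v` for the energy norm, so Riesz gives a weak solution;
hence the chosen `Q` solves the problem. -/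
lemma IsDecomposition.inner_Q (hD : IsDecomposition Ω D) (i : Fin m)
    (h : ∀ j : J Ω D i, L2surf (Interface Ω D i j.1)) (v : H Ω D i) :
    (inner ℝ (Q Ω D i 0 h) v : ℝ)
      = ∑ j : J Ω D i, (if i < j.1 then 1 else -1) * inner ℝ (h j) (T Ω D i j.1 v) := by
  have hweak : ∀ u : H Ω D i, IsWeakSolution Ω D i 0 h u ↔ ∀ v, (inner ℝ u v : ℝ)
      = ∑ j : J Ω D i, (if i < j.1 then 1 else -1) * inner ℝ (h j) (T Ω D i j.1 v) := by
    intro u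
    refine forall_congr' fun v => ?_
    have h0 : ∫ x in D i, (0 : L2 (D i)) x * v.fn x = 0 := by
      refine integral_eq_zero_of_ae ?_
      filter_upwards [Lp.coeFn_zero ℝ 2 (volume.restrict (D i))] with x hx
      rw [hx]
      exact zero_mul _
    have h1 : ∀ j : J Ω D i, ∫ x in Interface Ω D i j.1, h j x * T Ω D i j.1 v x ∂(surface N)
        = inner ℝ (h j) (T Ω D i j.1 v) := fun j => by
      rw [L2.inner_def]
      refine integral_congr_ae (Eventually.of_forall fun x => ?_)
      exact mul_comm _ _
    rw [h0, zero_add]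
    simp only [h1]
  have hex : ∃ u, IsWeakSolution Ω D i 0 h u := by
    have := EnergySpace.completeSpace (hD.poincareOn i)
    have hT : ∀ j, Continuous (traceMap Ω D i j) := hD.continuous_traceMap i
    obtain ⟨u, hu⟩ := exists_riesz
      (EnergySpace.eq_zero_of_norm_eq_zero (hD.poincareOn i))
      (∑ j : J Ω D i, (if i < j.1 then (1 : ℝ) else -1) •
        (innerSL ℝ (h j)).comp (⟨traceMap Ω D i j.1, hT j.1⟩ : H Ω D i →L[ℝ] _))
    refine ⟨u, (hweak u).mpr fun v => ?_⟩
    rw [hu v, sum_apply]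
    rfl
  exact (hweak _).mp (Classical.epsilon_spec hex) v

variable (Ω D) in
/-- The two sides of the active interfaces. -/
def side : K Ω D ⊕ K Ω D → (i : Fin m) × J Ω D i :=
  Sum.elim (fun k => ⟨k.1.1, k.1.2, k.2.1.ne', k.2.2⟩)
    (fun k => ⟨k.1.2, k.1.1, k.2.1.ne, interface_comm Ω D k.1.1 k.1.2 ▸ k.2.2⟩)

lemma side_bijective : Function.Bijective (side Ω D) := by
  constructor
  · rintro (⟨⟨i, j⟩, hk⟩ | ⟨⟨i, j⟩, hk⟩) (⟨⟨i', j'⟩, hk'⟩ | ⟨⟨i', j'⟩, hk'⟩) h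
    all_goals
      have h1 : (side Ω D _).1 = (side Ω D _).1 := congrArg (fun s => s.1) h
      have h2 : (side Ω D _).2.1 = (side Ω D _).2.1 := congrArg (fun s => s.2.1) h
      dsimp only [side, Sum.elim_inl, Sum.elim_inr] at h1 h2
      subst h1 h2
    · rfl
    · exact absurd hk.1 hk'.1.not_gt
    · exact absurd hk.1 hk'.1.not_gt
    · rfl
  · rintro ⟨i, j, hj, hne⟩
    rcases hj.lt_or_gt with h | h
    · exact ⟨Sum.inr ⟨(j, i), h, interface_comm Ω D i j ▸ hne⟩, rfl⟩
    · exact ⟨Sum.inl ⟨(i, j), h, hne⟩, rfl⟩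

/-- Each active interface is seen once from either side, by `side_bijective`, with opposite signs.
The Neumann data summed over subdomains thus become pairings with the jumps: the solution operators
form the adjoint of the jump. -/
lemma IsDecomposition.sum_inner_Q (hD : IsDecomposition Ω D) (g : ∀ k, L Ω D k)
    (v : ∀ i, H Ω D i) :
    ∑ i, (inner ℝ (Q Ω D i 0 (around Ω D g i)) (v i) : ℝ)
      = ∑ k, (inner ℝ (g k) (jump Ω D v k) : ℝ) := by
  obtain ⟨f, hf⟩ : ∃ f : ∀ i, J Ω D i → ℝ, f = fun i j => (if i < j.1 then 1 else -1)
      * inner ℝ (around Ω D g i j) (T Ω D i j.1 (v i)) := ⟨_, rfl⟩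
  have h1 : ∑ i, (inner ℝ (Q Ω D i 0 (around Ω D g i)) (v i) : ℝ)
      = ∑ s : (i : Fin m) × J Ω D i, f s.1 s.2 := by
    rw [Fintype.sum_sigma]
    refine Finset.sum_congr rfl fun i _ => ?_
    rw [hD.inner_Q, hf]
  rw [h1, ← side_bijective.sum_comp fun s : (i : Fin m) × J Ω D i => f s.1 s.2, Fintype.sum_sum_type, ← Finset.sum_add_distrib]
  refine Finset.sum_congr rfl fun k _ => ?_
  have h2 : f (side Ω D (Sum.inl k)).1 (side Ω D (Sum.inl k)).2 = inner ℝ (g k) (T Ω D k.1.1 k.1.2 (v k.1.1)) := by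
    rw [hf]
    change (if k.1.1 < k.1.2 then (1 : ℝ) else -1) * inner ℝ (around Ω D g k.1.1 ⟨k.1.2, _⟩) _ = _
    rw [if_pos k.2.1, one_mul]
    exact congrArg (fun w : L Ω D k => (inner ℝ w (T Ω D k.1.1 k.1.2 (v k.1.1)) : ℝ))
      (dif_pos k.2.1)
  have h3 : f (side Ω D (Sum.inr k)).1 (side Ω D (Sum.inr k)).2
      = - inner ℝ (g k) (swapSides Ω D k.1.1 k.1.2 (T Ω D k.1.2 k.1.1 (v k.1.2))) := by
    rw [hf]
    change (if k.1.2 < k.1.1 then (1 : ℝ) else -1) * inner ℝ (around Ω D g k.1.2 ⟨k.1.1, _⟩) _ = _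
    rw [if_neg k.2.1.not_gt, neg_one_mul]
    refine congrArg Neg.neg (Eq.trans ?_
      (inner_restrictSurf_eq (interface_comm Ω D k.1.2 k.1.1) (g k)
        (T Ω D k.1.2 k.1.1 (v k.1.2))))
    exact congrArg (fun w : L2surf (Interface Ω D k.1.2 k.1.1) =>
      (inner ℝ w (T Ω D k.1.2 k.1.1 (v k.1.2)) : ℝ)) (dif_neg k.2.1.not_gt)
  rw [h2, h3, jump, inner_sub_right, ← sub_eq_add_neg]

variable (Ω D) in
/-- The jump operator as a linear map. -/
noncomputable def jumpMap (hD : IsDecomposition Ω D) :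
    (∀ i, H Ω D i) →L[ℝ] ∀ k, L Ω D k :=
  ContinuousLinearMap.pi fun k =>
    (⟨traceMap Ω D k.1.1 k.1.2, hD.continuous_traceMap _ _⟩ : H Ω D k.1.1 →L[ℝ] L Ω D k).comp
        (ContinuousLinearMap.proj k.1.1)
      - (restrictSurfL (interface_comm Ω D k.1.1 k.1.2).subset).comp
        ((⟨traceMap Ω D k.1.2 k.1.1, hD.continuous_traceMap _ _⟩ :
          H Ω D k.1.2 →L[ℝ] _).comp (ContinuousLinearMap.proj k.1.2))

/-- Strong convergence of the algorithm for the decomposed problem. -/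
theorem IsDecomposition.iterate_tendsto (hD : IsDecomposition Ω D)
    {φ : ∀ i, H Ω D i → EReal} {ψ : ∀ k, L Ω D k → EReal}
    (hφ : ∀ i, Gamma0 (φ i)) (hψ : ∀ k, Gamma0 (ψ k))
    (hKT : (kuhnTucker Ω D φ ψ).Nonempty) (x₀ : PrimalDual Ω D) {ε : ℝ} (hε : 0 < ε)
    {γ μ lam : ℕ → ℝ} (hγ : ∀ n, γ n ∈ Set.Icc ε (1 / ε)) (hμ : ∀ n, μ n ∈ Set.Icc ε (1 / ε))
    (hlam : ∀ n, lam n ∈ Set.Icc ε 1) :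
    ∃ z : PrimalDual Ω D, IsBestApprox (kuhnTucker Ω D φ ψ) x₀ z ∧
      (∀ z', IsBestApprox (kuhnTucker Ω D φ ψ) x₀ z' → z' = z) ∧
      (∀ i, Tendsto (fun n => (iterate Ω D φ ψ γ μ lam x₀ n).1 i) atTop (𝓝 (z.1 i))) ∧
      (∀ k, Tendsto (fun n => (iterate Ω D φ ψ γ μ lam x₀ n).2 k) atTop (𝓝 (z.2 k))) := by
  have hc : ∀ i, CompleteSpace (H Ω D i) := fun i =>
    EnergySpace.completeSpace (hD.poincareOn i)
  -- The energy spaces are declared only as seminormed spaces; the normed structure is supplied here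
  -- from the Poincaré inequality, with the same norm and inner product.
  exact @directSum_tendsto (Fin m) (K Ω D) _ _ (H Ω D) (L Ω D)
    (fun i => NormedAddCommGroup.ofSeparation
      (EnergySpace.eq_zero_of_norm_eq_zero (hD.poincareOn i)))
    (fun i => inferInstanceAs (InnerProductSpace ℝ (H Ω D i))) _ _ hc _ (jumpMap Ω D hD)
    (fun g i => Q Ω D i 0 (around Ω D g i)) hD.sum_inner_Q φ ψ hφ hψ (kuhnTucker Ω D φ ψ) rfl hKT
    ε hε γ μ lam hγ hμ hlam (iterate Ω D φ ψ γ μ lam x₀) (fun n => rfl)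

end Operators

end DomainDecomposition

theorem theorem3p4 {N m : ℕ} (Ω : Set (E N)) (D : Fin m → Set (E N))
    (hD : IsDecomposition Ω D)
    (φ : ∀ i, DomainDecomposition.H Ω D i → EReal)
    (ψ : ∀ k, DomainDecomposition.L Ω D k → EReal)
    (hφ : ∀ i, Gamma0 (φ i)) (hψ : ∀ k, Gamma0 (ψ k))
    (hKT : (kuhnTucker Ω D φ ψ).Nonempty)
    (x₀ : PrimalDual Ω D)
    (ε : ℝ) (hε : ε ∈ Set.Ioo (0 : ℝ) 1)
    (γ μ lam : ℕ → ℝ)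
    (hγ : ∀ n, γ n ∈ Set.Icc ε (1 / ε))
    (hμ : ∀ n, μ n ∈ Set.Icc ε (1 / ε))
    (hlam : ∀ n, lam n ∈ Set.Icc ε 1) :
    ∃ z : PrimalDual Ω D,
      IsBestApprox (kuhnTucker Ω D φ ψ) x₀ z ∧
      (∀ z', IsBestApprox (kuhnTucker Ω D φ ψ) x₀ z' → z' = z) ∧
      (∀ i, Filter.Tendsto (fun n => (iterate Ω D φ ψ γ μ lam x₀ n).1 i)
        Filter.atTop (nhds (z.1 i))) ∧
      (∀ k, Filter.Tendsto (fun n => (iterate Ω D φ ψ γ μ lam x₀ n).2 k)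
        Filter.atTop (nhds (z.2 k))) := by
  exact hD.iterate_tendsto hφ hψ hKT x₀ hε.1 hγ hμ hlam
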